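/- Let $T>0$, $\mathcal X=\{1,\dots,k\}$, let $r:\mathcal X\to[0,\infty)$, let $\sigma(i)\in\mathbb R^{d\times d}$ be invertible for every $i\in\mathcal X$, and put $a(i)=\sigma(i)\sigma(i)^{*}$. Let $\Lambda=(\lambda_{ij})$ be a transition rate matrix on $\mathcal X$ ($\lambda_{ij}\ge 0$ for $i\ne j$, $\sum_j\lambda_{ij}=0$), $\lambda_i=|\lambda_{ii}|$, and let $\mathcal K:(0,\infty)^d\to[0,\infty)$ be Lipschitz continuous. For $x,s\in(0,\infty)^d$, $v>0$, $i\in\mathcal X$ let $$\alpha(x,s,i,v)=\frac{\exp\Big[-\frac12\sum_{l,l'}\big((v\,a(i))^{-1}\big)_{ll'}(z_l-\tilde z_l)(z_{l'}-\tilde z_{l'})\Big]}{\sqrt{(2\pi)^d\det(v\,a(i))}\;x_1x_2\cdots x_d},\qquad z_l=\ln\frac{x_l}{s_l},\quad \tilde z_l=\Big(r(i)-\tfrac12a_{ll}(i)\Big)v,$$ and let $\eta_i(t,s)=E\big[e^{-r(i)(T-t)}\mathcal K(Y(T))\,\big|\,Y(t)=s\big]$ for $0\le t\le T$, where $dY_l=Y_l\big[r(i)\,dt+\sum_j\sigma_{lj}(i)\,dW^j\big]$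 and $W$ is a $d$-dimensional Brownian motion. Let $V$ be the space of functions $\phi$ on $(0,T)\times(0,\infty)^d\times\mathcal X$ such that $\phi(\cdot,\cdot,i)$ is continuous for every $i$ and $\sup_{t,s,i}|\phi(t,s,i)|/(1+\|s\|_1)<\infty$. Consider the integral equation $$\phi(t,s,i)=e^{-\lambda_i(T-t)}\eta_i(t,s)+\int_0^{T-t}e^{-(\lambda_i+r(i))v}\sum_{j\ne i}\lambda_{ij}\int_{(0,\infty)^d}\phi(t+v,x,j)\,\alpha(x,s,i,v)\,dx\,dv \qquad (\mathrm{IE})$$ for $t\in[0,T]$, $s\in(0,\infty)^d$, $i\in\mathcal X$ (at $t=0$ and $t=T$ the equation gives the values of $\phi$ at the end points). Then each $\eta_i$ is a classical solution of the Black–Scholes–Merton equation $\partial_t\eta_i+r(i)\sum_l s_l\partial_{s_l}\eta_i+\frac12\sum_{l,l'}a_{ll'}(i)s_ls_{l'}\partial_{s_l}\partial_{s_{l'}}\eta_i=r(i)\eta_i$ with $\eta_i(T,\cdot)=\mathcal K$, and (IE) has exactly one solution $\phi$ in $V$. Moreover: (i) $\phi$ is a classical solution of the regime-switching Black–Scholes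 system: for every $i\in\mathcal X$, $\phi(\cdot,\cdot,i)$ is continuous on $[0,T]\times(0,\infty)^d$ and of class $C^{1,2}$ on $(0,T)\times(0,\infty)^d$, and $$\Big(\partial_t\phi+r(i)\sum_{l}s_l\,\partial_{s_l}\phi+\frac12\sum_{l,l'}a_{ll'}(i)s_ls_{l'}\,\partial_{s_l}\partial_{s_{l'}}\phi-r(i)\phi\Big)(t,s,i)+\sum_{j=1}^k\lambda_{ij}\phi(t,s,j)=0$$ for all $t\in(0,T)$, $s\in(0,\infty)^d$, $i\in\mathcal X$, with $\phi(T,s,i)=\mathcal K(s)$; (ii) $\phi$ is non-negative and of at most linear growth: $\phi\ge0$ and there is a constant $C$ with $|\phi(t,s,i)|\le C(1+\|s\|_1)$ for all $t\in[0,T]$, $s\in(0,\infty)^d$, $i\in\mathcal X$. -/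

import Mathlib

open MeasureTheory ProbabilityTheory

noncomputable section

namespace RegimeSwitching

/-- The open positive orthant `(0,∞)^d`. -/
def orthant (d : ℕ) : Set (Fin d → ℝ) := {s | ∀ l, 0 < s l}

/-- Instantaneous transition rate matrix of a Markov chain with states `Fin k`. -/
structure IsRateMatrix {k : ℕ} (Λ : Matrix (Fin k) (Fin k) ℝ) : Prop where
  nonneg : ∀ i j, i ≠ j → 0 ≤ Λ i j
  row_sum : ∀ i, ∑ j, Λ i j = 0

/-- The diffusion matrix `a = σ σ*`. -/
def diffusion {d : ℕ} (σ : Matrix (Fin d) (Fin d) ℝ) : Matrix (Fin d) (Fin d) ℝ :=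
  σ * σ.transpose

/-- The lognormal density `x ↦ α(x,s,v)` with interest rate `ρ` and volatility matrix `σ`. -/
def alpha {d : ℕ} (ρ : ℝ) (σ : Matrix (Fin d) (Fin d) ℝ) (x s : Fin d → ℝ) (v : ℝ) : ℝ :=
  Real.exp (-(1 / 2) * ∑ l, ∑ l', (v • diffusion σ)⁻¹ l l'
      * (Real.log (x l / s l) - (ρ - diffusion σ l l / 2) * v)
      * (Real.log (x l' / s l') - (ρ - diffusion σ l' l' / 2) * v))
    / (Real.sqrt ((2 * Real.pi) ^ d * (v • diffusion σ).det) * ∏ l, x l)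

/-- The value after time `τ` of the solution of
`dY_l = Y_l (ρ dt + ∑ j, σ_{lj} dW^j)`, `Y_0 = s`, when the Brownian increment is `w`. -/
def gbm {d : ℕ} (ρ : ℝ) (σ : Matrix (Fin d) (Fin d) ℝ) (s : Fin d → ℝ) (τ : ℝ)
    (w : Fin d → ℝ) : Fin d → ℝ :=
  fun l => s l * Real.exp ((ρ - diffusion σ l l / 2) * τ + ∑ j, σ l j * w j)

/-- The Black–Scholes–Merton price `E[e^{-ρ(T-t)} K(Y(T)) | Y(t) = s]`; the Brownian increment
over `[t,T]` has independent coordinates with law `N(0, T-t)`. -/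
def eta {d : ℕ} (T ρ : ℝ) (σ : Matrix (Fin d) (Fin d) ℝ) (K : (Fin d → ℝ) → ℝ)
    (t : ℝ) (s : Fin d → ℝ) : ℝ :=
  ∫ w, Real.exp (-ρ * (T - t)) * K (gbm ρ σ s (T - t) w)
    ∂(Measure.pi fun _ : Fin d => gaussianReal 0 (T - t).toNNReal)

/-- Right-hand side of the integral equation. -/
def operatorA {d k : ℕ} (T : ℝ) (r : Fin k → ℝ) (σ : Fin k → Matrix (Fin d) (Fin d) ℝ)
    (Λ : Matrix (Fin k) (Fin k) ℝ) (K : (Fin d → ℝ) → ℝ)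
    (φ : ℝ → (Fin d → ℝ) → Fin k → ℝ) (t : ℝ) (s : Fin d → ℝ) (i : Fin k) : ℝ :=
  Real.exp (-|Λ i i| * (T - t)) * eta T (r i) (σ i) K t s
    + ∫ v in (0 : ℝ)..(T - t), Real.exp (-(|Λ i i| + r i) * v)
        * ∑ j ∈ Finset.univ.erase i, Λ i j
          * ∫ x in orthant d, φ (t + v) x j * alpha (r i) (σ i) x s v

/-- `|φ(t,s,i)| ≤ C (1 + ‖s‖₁)` for all `t ∈ I`, `s ∈ (0,∞)^d` and all `i`, for some `C`. -/
def LinearGrowth {d k : ℕ} (I : Set ℝ) (φ : ℝ → (Fin d → ℝ) → Fin k → ℝ) : Prop :=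
  ∃ C : ℝ, ∀ t ∈ I, ∀ s ∈ orthant d, ∀ i, |φ t s i| ≤ C * (1 + ∑ l, |s l|)

/-- The space `V` of functions on `(0,T) × (0,∞)^d × X`, each component of which is continuous,
with finite weighted supremum norm. Only the values on that set matter. -/
def MemV {d k : ℕ} (T : ℝ) (φ : ℝ → (Fin d → ℝ) → Fin k → ℝ) : Prop :=
  (∀ i, ContinuousOn (fun p : ℝ × (Fin d → ℝ) => φ p.1 p.2 i) (Set.Ioo 0 T ×ˢ orthant d)) ∧
    LinearGrowth (Set.Ioo 0 T) φ

/-- `φ` belongs to `V` and solves the integral equation; the equation at `t = 0` and `t = T`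
determines the values of `φ` at these end points. -/
def SolvesIE {d k : ℕ} (T : ℝ) (r : Fin k → ℝ) (σ : Fin k → Matrix (Fin d) (Fin d) ℝ)
    (Λ : Matrix (Fin k) (Fin k) ℝ) (K : (Fin d → ℝ) → ℝ)
    (φ : ℝ → (Fin d → ℝ) → Fin k → ℝ) : Prop :=
  MemV T φ ∧ ∀ t ∈ Set.Icc 0 T, ∀ s ∈ orthant d, ∀ i, φ t s i = operatorA T r σ Λ K φ t s i

/-- `∂f/∂t`. -/
def partialT {d : ℕ} (f : ℝ → (Fin d → ℝ) → ℝ) (t : ℝ) (s : Fin d → ℝ) : ℝ :=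
  deriv (fun τ => f τ s) t

/-- `∂f/∂s_l`. -/
def partialS {d : ℕ} (l : Fin d) (f : ℝ → (Fin d → ℝ) → ℝ) (t : ℝ) (s : Fin d → ℝ) : ℝ :=
  deriv (fun y => f t (Function.update s l y)) (s l)

/-- `f ∈ C^{1,2}((0,T) × (0,∞)^d)`: the partial derivatives `∂_t f`, `∂_l f`, `∂_l ∂_l' f` exist
and are, like `f`, continuous. -/
structure IsC12 {d : ℕ} (T : ℝ) (f : ℝ → (Fin d → ℝ) → ℝ) : Prop where
  diff_t : ∀ t ∈ Set.Ioo 0 T, ∀ s ∈ orthant d, DifferentiableAt ℝ (fun τ => f τ s) t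
  diff_s : ∀ t ∈ Set.Ioo 0 T, ∀ s ∈ orthant d, ∀ l,
    DifferentiableAt ℝ (fun y => f t (Function.update s l y)) (s l)
  diff_ss : ∀ t ∈ Set.Ioo 0 T, ∀ s ∈ orthant d, ∀ l l',
    DifferentiableAt ℝ (fun y => partialS l' f t (Function.update s l y)) (s l)
  cont : ContinuousOn (Function.uncurry f) (Set.Ioo 0 T ×ˢ orthant d)
  cont_t : ContinuousOn (Function.uncurry (partialT f)) (Set.Ioo 0 T ×ˢ orthant d)
  cont_s : ∀ l, ContinuousOn (Function.uncurry (partialS l f)) (Set.Ioo 0 T ×ˢ orthant d)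
  cont_ss : ∀ l l',
    ContinuousOn (Function.uncurry (partialS l (partialS l' f))) (Set.Ioo 0 T ×ˢ orthant d)

/-- The operator `𝕃` of the regime-switching Black–Scholes system. -/
def operatorL {d k : ℕ} (r : Fin k → ℝ) (σ : Fin k → Matrix (Fin d) (Fin d) ℝ)
    (Λ : Matrix (Fin k) (Fin k) ℝ) (φ : ℝ → (Fin d → ℝ) → Fin k → ℝ)
    (t : ℝ) (s : Fin d → ℝ) (i : Fin k) : ℝ :=
  r i * ∑ l, s l * partialS l (fun t s => φ t s i) t s
    + 1 / 2 * ∑ l, ∑ l', diffusion (σ i) l l' * s l * s l'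
        * partialS l (partialS l' fun t s => φ t s i) t s
    - r i * φ t s i
    + ∑ j, Λ i j * φ t s j

/-- `φ` is a classical solution of `∂_t φ + 𝕃 φ = 0` on `(0,T) × (0,∞)^d × X` with terminal data
`K`: it is of class `C^{1,2}` there and continuous on `[0,T] × (0,∞)^d × X`. -/
structure IsClassicalSolution {d k : ℕ} (T : ℝ) (r : Fin k → ℝ)
    (σ : Fin k → Matrix (Fin d) (Fin d) ℝ) (Λ : Matrix (Fin k) (Fin k) ℝ)
    (K : (Fin d → ℝ) → ℝ) (φ : ℝ → (Fin d → ℝ) → Fin k → ℝ) : Prop where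
  regular : ∀ i, IsC12 T fun t s => φ t s i
  cont : ∀ i, ContinuousOn (fun p : ℝ × (Fin d → ℝ) => φ p.1 p.2 i) (Set.Icc 0 T ×ˢ orthant d)
  pde : ∀ t ∈ Set.Ioo 0 T, ∀ s ∈ orthant d, ∀ i,
    partialT (fun t s => φ t s i) t s + operatorL r σ Λ φ t s i = 0
  terminal : ∀ s ∈ orthant d, ∀ i, φ T s i = K s

end RegimeSwitching

end

/-! ### Gaussian integrals and the heat kernel -/

noncomputable section

namespace RegimeSwitching

open Real Set Filter Topology

variable {d : ℕ}

/-! Fix a regime `i` and put c = λ_i + r(i). In the coordinates y = σ⁻¹ log s − t·drift the price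
process is a Brownian motion, and splitting off a factor e^{ct} removes the zeroth-order terms. The
right-hand side of (IE) becomes e^{ct} times the sum of a heat flow of the payoff and a Duhamel
integral, whose source f is the discounted inflow from the other regimes (`operatorA_eq_heat`). If
this sum Z solves ∂_t Z + ½ΔZ + f = 0 classically, the chain rule turns that equation into the
regime-switching system (`IsRepresented.pde`).

The difficulty is the Hessian of the Duhamel integral. Two derivatives of the heat kernel cost 1/v,
which is not integrable at v = 0, and an element of V gives a source that is only continuous. A
source Lipschitz in space suffices: the weight w_i w_j − δ_ij of the second derivative has mean
zero, so the value at the centre may be subtracted, which gains √v and leaves the integrable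
singularity v^{-1/2} (`IsSource.abs_gaussAvg_weightTwo_le`). In time the source is only continuous.
Therefore the Duhamel integral is first rewritten by Fubini as the integral over [t,T] of f +
½Δ(itself) (`IsSource.duhamel_eq_integral`), and the fundamental theorem of calculus then gives the
time derivative.

The Lipschitz bound comes from the fixed point argument. Discounted prices are martingales, so in
the norm weighted by 1 + ‖s‖₁ the discount compensates the growth of the prices, and the map
contracts with factor at most 1 − e^{−λ_i T} in regime `i` (`abs_operatorA_sub_le`). The map also
preserves non-negativity and, with the same constant as the payoff, Lipschitz continuity in s.
Picard iteration from 0 thus converges to a non-negative Lipschitz solution (`exists_solution`).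
Uniqueness in all of V (`SolvesIE.eq_of_solvesIE`) identifies every solution with this one and
transfers its properties. The claim about η_i is the case Λ = 0. -/

/-- The standard normal law on `ℝ^d`. -/
def stdNormal (d : ℕ) : Measure (Fin d → ℝ) := Measure.pi fun _ => gaussianReal 0 1

instance : IsProbabilityMeasure (stdNormal d) := by
  unfold stdNormal; infer_instance

/-- The heat kernel of `½ Δ` on `ℝ^d` at time `v`. -/
def heatKernel (v : ℝ) (z : Fin d → ℝ) : ℝ :=
  (√(2 * π * v))⁻¹ ^ d * exp (-(∑ l, z l ^ 2) / (2 * v))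

lemma heatKernel_nonneg (v : ℝ) (z : Fin d → ℝ) : 0 ≤ heatKernel v z := by
  unfold heatKernel; positivity

@[fun_prop]
lemma continuous_heatKernel (v : ℝ) : Continuous (heatKernel v : (Fin d → ℝ) → ℝ) := by
  unfold heatKernel; fun_prop

lemma heatKernel_one_eq_prod (z : Fin d → ℝ) :
    heatKernel 1 z = ∏ l, gaussianPDFReal 0 1 (z l) := by
  simp only [heatKernel, gaussianPDFReal, Finset.prod_mul_distrib, ← exp_sum]
  simp [Finset.sum_div, neg_div]

lemma stdNormal_eq_withDensity :
    stdNormal d = volume.withDensity fun z => ENNReal.ofReal (heatKernel 1 z) := by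
  have hInt : Integrable (heatKernel 1 : (Fin d → ℝ) → ℝ) := by
    simp_rw [funext heatKernel_one_eq_prod]
    exact Integrable.fintype_prod fun _ => integrable_gaussianPDFReal 0 1
  unfold stdNormal
  refine Measure.pi_eq fun s hs => ?_
  rw [withDensity_apply _ (MeasurableSet.univ_pi hs),
    ← ofReal_integral_eq_lintegral_ofReal hInt.integrableOn
      (Eventually.of_forall fun z => heatKernel_nonneg 1 z)]
  simp_rw [heatKernel_one_eq_prod]
  rw [volume_pi, Measure.restrict_pi_pi,
    integral_fintype_prod_eq_prod (fun _ : Fin d => gaussianPDFReal 0 1),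
    ENNReal.ofReal_prod_of_nonneg fun l _ =>
      integral_nonneg fun x => gaussianPDFReal_nonneg 0 1 x]
  exact Finset.prod_congr rfl fun l _ => (gaussianReal_apply_eq_integral 0 one_ne_zero _).symm

lemma integral_stdNormal (f : (Fin d → ℝ) → ℝ) :
    ∫ w, f w ∂stdNormal d = ∫ z, heatKernel 1 z * f z := by
  rw [stdNormal_eq_withDensity, integral_withDensity_eq_integral_toReal_smul (by fun_prop)
    (by simp)]
  simp [ENNReal.toReal_ofReal (heatKernel_nonneg 1 _)]

/-- Parabolic self-similarity; the factor √v ^ d is the Jacobian that cancels in the substitution z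
= x/√v. -/
lemma heatKernel_smul {v : ℝ} (hv : 0 < v) (z : Fin d → ℝ) :
    heatKernel 1 ((√v)⁻¹ • z) = √v ^ d * heatKernel v z := by
  have h : (√v)⁻¹ ^ 2 = v⁻¹ := by rw [inv_pow, sq_sqrt hv.le]
  simp only [heatKernel, Pi.smul_apply, smul_eq_mul, mul_pow, h, ← Finset.mul_sum]
  rw [sqrt_mul' _ hv.le, mul_inv, mul_pow, ← mul_assoc]
  congr 1
  · have := (sqrt_pos.2 hv).ne'
    rw [mul_left_comm, ← mul_pow √v, mul_inv_cancel₀ this]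
    simp
  · congr 1; field_simp

/-- Gaussian averages as integrals against the heat kernel. -/
lemma integral_stdNormal_eq_heatKernel {v : ℝ} (hv : 0 < v) (y : Fin d → ℝ)
    (f : (Fin d → ℝ) → ℝ) :
    ∫ w, f w ∂stdNormal d = ∫ x, heatKernel v (x - y) * f ((√v)⁻¹ • (x - y)) := by
  have hv' := sqrt_pos.2 hv
  rw [integral_stdNormal, integral_sub_right_eq_self fun x => heatKernel v x * f ((√v)⁻¹ • x)]
  have := Measure.integral_comp_inv_smul_of_nonneg volume (fun z => heatKernel 1 z * f z) hv'.le
  simp only [heatKernel_smul hv, Module.finrank_fin_fun, smul_eq_mul, mul_assoc] at this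
  rw [integral_const_mul] at this
  exact (mul_left_cancel₀ (by positivity) this).symm

/-- The standard normal law scaled by `√τ`. -/
lemma map_stdNormal_smul {τ : ℝ} (hτ : 0 ≤ τ) :
    (stdNormal d).map (fun w => √τ • w)
      = Measure.pi fun _ : Fin d => gaussianReal 0 τ.toNNReal := by
  unfold stdNormal
  have h : (gaussianReal 0 1).map (fun x => √τ * x) = gaussianReal 0 τ.toNNReal := by
    rw [gaussianReal_map_const_mul]
    congr 1
    · simp
    · ext; simp [hτ]
  rw [← h]
  exact Measure.pi_map_pi (f := fun _ x => √τ * x) fun _ => by fun_prop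

/-- e^{κ|x|} is at most e^{κx} + e^{−κx}, and Gaussians have all exponential moments. -/
lemma integrable_exp_abs_gaussianReal (κ : ℝ) :
    Integrable (fun x => exp (κ * |x|)) (gaussianReal 0 1) := by
  refine ((integrable_exp_mul_gaussianReal κ).add (integrable_exp_mul_gaussianReal (-κ))).mono'
    (by fun_prop) (Eventually.of_forall fun x => ?_)
  rw [norm_of_nonneg (exp_pos _).le]
  simp only [Pi.add_apply]
  rcases abs_cases x with ⟨h, _⟩ | ⟨h, _⟩ <;> rw [h]
  · linarith [exp_pos (-κ * x)]
  · rw [mul_neg, ← neg_mul]; linarith [exp_pos (κ * x)]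

lemma integrable_exp_sum_abs (κ : ℝ) :
    Integrable (fun w : Fin d → ℝ => exp (κ * ∑ l, |w l|)) (stdNormal d) := by
  simp_rw [Finset.mul_sum, exp_sum]
  exact Integrable.fintype_prod fun _ => integrable_exp_abs_gaussianReal κ

lemma integrable_exp_sum_mul (c : Fin d → ℝ) :
    Integrable (fun w : Fin d → ℝ => exp (∑ l, c l * w l)) (stdNormal d) := by
  simp_rw [exp_sum]
  exact Integrable.fintype_prod (f := fun l x => exp (c l * x))
    fun l => integrable_exp_mul_gaussianReal (c l)

lemma integral_exp_sum_mul (c : Fin d → ℝ) :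
    ∫ w, exp (∑ l, c l * w l) ∂stdNormal d = exp (∑ l, c l ^ 2 / 2) := by
  simp_rw [exp_sum]
  refine (integral_fintype_prod_eq_prod (fun l x => exp (c l * x))).trans ?_
  refine Finset.prod_congr rfl fun l _ => ?_
  have := congrFun (mgf_fun_id_gaussianReal (μ := 0) (v := 1)) (c l)
  simpa [mgf] using this

lemma integral_gaussian_sq : ∫ x, x ^ 2 ∂gaussianReal 0 1 = 1 := by
  have h := variance_id_gaussianReal (μ := 0) (v := 1)
  rw [variance_eq_integral (by fun_prop)] at h
  simpa using h

/-- The covariance matrix of the standard normal law is the identity. -/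
lemma integral_mul_sub_one (i j : Fin d) :
    ∫ w, (w i * w j - (1 : Matrix (Fin d) (Fin d) ℝ) i j) ∂stdNormal d = 0 := by
  have hmem : ∀ i, MemLp (fun w : Fin d → ℝ => w i) 2 (stdNormal d) := fun i =>
    (memLp_id_gaussianReal (μ := 0) (v := 1) 2).comp_measurePreserving
      (measurePreserving_eval (fun _ : Fin d => gaussianReal 0 1) i)
  have hInt : Integrable (fun w : Fin d → ℝ => w i * w j) (stdNormal d) :=
    (hmem i).integrable_mul (hmem j)
  rw [integral_sub hInt (integrable_const _)]
  simp only [integral_const, probReal_univ, one_smul]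
  rw [sub_eq_zero]
  rcases eq_or_ne i j with rfl | hij
  · rw [Matrix.one_apply_eq]
    refine Eq.trans ?_ integral_gaussian_sq
    have := (measurePreserving_eval (fun _ : Fin d => gaussianReal 0 1) i).map_eq
    rw [← this, integral_map (measurable_pi_apply i).aemeasurable (by fun_prop)]
    simp [stdNormal, sq]
  · rw [Matrix.one_apply_ne hij]
    have h := (iIndepFun_pi (μ := fun _ : Fin d => gaussianReal 0 1) (X := fun _ x => x)
      (fun _ => by fun_prop)).indepFun hij
    have h2 := h.integral_fun_mul_eq_mul_integral
      (measurable_pi_apply i).aestronglyMeasurable (measurable_pi_apply j).aestronglyMeasurable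
    have h3 : ∫ w : Fin d → ℝ, w i ∂stdNormal d = 0 := by
      have := (measurePreserving_eval (fun _ : Fin d => gaussianReal 0 1) i).map_eq
      rw [← integral_id_gaussianReal (μ := 0) (v := 1), ← this,
        integral_map (measurable_pi_apply i).aemeasurable (by fun_prop)]
      rfl
    refine h2.trans ?_
    rw [stdNormal] at h3
    rw [h3, zero_mul]

/-- By completing the square, half of the quadratic term absorbs the linear one at the price of the
constant a²/(2b). -/
lemma integrable_exp_abs_sub_sq (a : ℝ) {b : ℝ} (hb : 0 < b) :
    Integrable fun x : ℝ => exp (a * |x| - b * x ^ 2) := by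
  have hbound : Integrable fun x : ℝ => exp (a ^ 2 / (2 * b)) * exp (-(b / 2) * x ^ 2) :=
    (integrable_exp_neg_mul_sq (half_pos hb)).const_mul _
  refine hbound.mono' (by fun_prop) (Eventually.of_forall fun x => ?_)
  rw [norm_of_nonneg (exp_pos _).le, ← exp_add, exp_le_exp]
  have h : 0 ≤ (b * |x| - a) ^ 2 / (2 * b) := by positivity
  have e : (b * |x| - a) ^ 2 / (2 * b) = b / 2 * x ^ 2 - a * |x| + a ^ 2 / (2 * b) := by
    rw [← sq_abs x]; field_simp; ring
  linarith

lemma integrable_exp_sum_abs_sub_sq (a : ℝ) {b : ℝ} (hb : 0 < b) :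
    Integrable fun x : Fin d → ℝ => exp (a * ∑ l, |x l| - b * ∑ l, x l ^ 2) := by
  simp_rw [Finset.mul_sum, ← Finset.sum_sub_distrib, exp_sum]
  exact Integrable.fintype_prod fun _ => integrable_exp_abs_sub_sq a hb

end RegimeSwitching

end

/-! ### Gaussian averages of functions of exponential growth -/

noncomputable section

namespace RegimeSwitching

open Real Set Filter Topology

variable {d : ℕ}

/-- `|g y| ≤ C e^{κ ‖y‖₁}`. -/
def ExpGrowth (κ C : ℝ) (g : (Fin d → ℝ) → ℝ) : Prop :=
  ∀ y, |g y| ≤ C * exp (κ * ∑ l, |y l|)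

lemma ExpGrowth.nonneg {κ C : ℝ} {g : (Fin d → ℝ) → ℝ} (h : ExpGrowth κ C g) : 0 ≤ C := by
  have := (abs_nonneg _).trans (h 0)
  simpa using this

lemma abs_le_sum_abs (w : Fin d → ℝ) (i : Fin d) : |w i| ≤ ∑ l, |w l| :=
  Finset.single_le_sum (f := fun l => |w l|) (fun _ _ => abs_nonneg _) (Finset.mem_univ i)

lemma sum_abs_nonneg (w : Fin d → ℝ) : 0 ≤ ∑ l, |w l| := Finset.sum_nonneg fun _ _ => abs_nonneg _

/-- The Gaussian average `E[g(y + √v W) m(W)]` with weight `m`. -/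
def gaussAvg (m g : (Fin d → ℝ) → ℝ) (v : ℝ) (y : Fin d → ℝ) : ℝ :=
  ∫ w, g (y + √v • w) * m w ∂stdNormal d

/-- The weight of the first derivative. -/
def weightOne (i : Fin d) (w : Fin d → ℝ) : ℝ := w i

/-- The weight of the second derivative. -/
def weightTwo (i j : Fin d) (w : Fin d → ℝ) : ℝ := w i * w j - (1 : Matrix (Fin d) (Fin d) ℝ) i j

@[fun_prop]
lemma continuous_weightOne (i : Fin d) : Continuous (weightOne i) := by
  unfold weightOne; fun_prop

@[fun_prop]
lemma continuous_weightTwo (i j : Fin d) : Continuous (weightTwo i j) := by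
  unfold weightTwo; fun_prop

lemma abs_one_matrix_le (i j : Fin d) : |(1 : Matrix (Fin d) (Fin d) ℝ) i j| ≤ 1 := by
  rw [Matrix.one_apply]; split_ifs <;> simp

/-- The pair (2, 2) is common to the weights of the value, the gradient and the Hessian, so that one
estimate serves all three. The Hessian weight dictates it: |w_i w_j| and δ_ij are each at most
e^{2‖w‖₁}. -/
lemma expGrowth_const_one : ExpGrowth 2 2 (fun _ : Fin d → ℝ => (1 : ℝ)) := fun y => by
  have := one_le_exp (mul_nonneg zero_le_two (sum_abs_nonneg y))
  rw [abs_one]; linarith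

lemma expGrowth_weightOne (i : Fin d) : ExpGrowth 2 2 (weightOne i) := fun y => by
  have h1 := abs_le_sum_abs y i
  have h2 := add_one_le_exp (2 * ∑ l, |y l|)
  have := sum_abs_nonneg y
  unfold weightOne; linarith

lemma expGrowth_weightTwo (i j : Fin d) : ExpGrowth 2 2 (weightTwo i j) := fun y => by
  have h1 := abs_le_sum_abs y i
  have h1' := abs_le_sum_abs y j
  have h2 := add_one_le_exp (∑ l, |y l|)
  have h3 := sum_abs_nonneg y
  have h4 : exp (2 * ∑ l, |y l|) = exp (∑ l, |y l|) * exp (∑ l, |y l|) := by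
    rw [← exp_add]; ring_nf
  have h5 : |y i * y j| ≤ exp (2 * ∑ l, |y l|) := by
    rw [abs_mul, h4]
    exact mul_le_mul (by linarith) (by linarith) (abs_nonneg _) (exp_pos _).le
  have h6 := one_le_exp (mul_nonneg zero_le_two h3)
  unfold weightTwo
  have := abs_sub (y i * y j) ((1 : Matrix (Fin d) (Fin d) ℝ) i j)
  have := abs_one_matrix_le i j
  linarith

lemma sum_abs_add_smul_le (y w : Fin d → ℝ) {v V : ℝ} (hv : v ≤ V) :
    ∑ l, |(y + √v • w) l| ≤ ∑ l, |y l| + √V * ∑ l, |w l| := by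
  rw [Finset.mul_sum, ← Finset.sum_add_distrib]
  refine Finset.sum_le_sum fun l _ => (abs_add_le _ _).trans ?_
  simp only [Pi.smul_apply, smul_eq_mul, abs_mul, abs_of_nonneg (sqrt_nonneg v)]
  gcongr

section Average

variable {κ C : ℝ} {m g : (Fin d → ℝ) → ℝ}

/-- The bound separates `y` from `w` and depends on `v` only through the upper limit `V`; it is the
majorant for all integrals over the normal law. -/
lemma abs_avg_integrand_le (hκ : 0 ≤ κ) (hg : ExpGrowth κ C g) (hm : ExpGrowth 2 2 m) {v V : ℝ}
    (hv : v ≤ V) (y w : Fin d → ℝ) :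
    |g (y + √v • w) * m w|
      ≤ C * exp (κ * ∑ l, |y l|) * (2 * exp ((κ * √V + 2) * ∑ l, |w l|)) := by
  have hC := hg.nonneg
  rw [abs_mul]
  calc |g (y + √v • w)| * |m w|
      ≤ (C * exp (κ * (∑ l, |y l| + √V * ∑ l, |w l|))) * (2 * exp (2 * ∑ l, |w l|)) := by
        refine mul_le_mul ((hg _).trans ?_) (hm w) (abs_nonneg _) (by positivity)
        gcongr
        exact sum_abs_add_smul_le y w hv
    _ = _ := by
        rw [show κ * (∑ l, |y l| + √V * ∑ l, |w l|) = κ * ∑ l, |y l| + κ * √V * ∑ l, |w l| by ring,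
          show (κ * √V + 2) * ∑ l, |w l| = κ * √V * ∑ l, |w l| + 2 * ∑ l, |w l| by ring,
          exp_add, exp_add]
        ring

lemma integrable_avg (hκ : 0 ≤ κ) (hgc : Continuous g) (hg : ExpGrowth κ C g)
    (hmc : Continuous m) (hm : ExpGrowth 2 2 m) (v : ℝ) (y : Fin d → ℝ) :
    Integrable (fun w => g (y + √v • w) * m w) (stdNormal d) :=
  (((integrable_exp_sum_abs (κ * √v + 2)).const_mul 2).const_mul _).mono'
    (by fun_prop) (Eventually.of_forall fun w => abs_avg_integrand_le hκ hg hm le_rfl y w)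

/-- The constant in the growth bound of Gaussian averages up to time `V`. -/
def avgConst (d : ℕ) (κ V : ℝ) : ℝ :=
  ∫ w, 2 * exp ((κ * √V + 2) * ∑ l, |w l|) ∂stdNormal d

lemma avgConst_nonneg (κ V : ℝ) : 0 ≤ avgConst d κ V :=
  integral_nonneg fun w => by positivity

lemma abs_gaussAvg_le (hκ : 0 ≤ κ) (hg : ExpGrowth κ C g) (hm : ExpGrowth 2 2 m) {v V : ℝ}
    (hv : v ≤ V) (y : Fin d → ℝ) :
    |gaussAvg m g v y| ≤ C * exp (κ * ∑ l, |y l|) * avgConst d κ V := by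
  unfold gaussAvg avgConst
  rw [← integral_const_mul, ← norm_eq_abs]
  exact norm_integral_le_of_norm_le
    (((integrable_exp_sum_abs (κ * √V + 2)).const_mul 2).const_mul _)
    (Eventually.of_forall fun w => abs_avg_integrand_le hκ hg hm hv y w)

/-- Moves the dependence on `y` and `v` from the merely continuous `g` to the smooth kernel, where
it can be differentiated. -/
lemma gaussAvg_eq_heatKernel {v : ℝ} (hv : 0 < v) (y : Fin d → ℝ) :
    gaussAvg m g v y = ∫ x, heatKernel v (x - y) * (g x * m ((√v)⁻¹ • (x - y))) := by
  unfold gaussAvg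
  rw [integral_stdNormal_eq_heatKernel hv y]
  have := (sqrt_pos.2 hv).ne'
  simp [smul_smul, this]

/-- Joint continuity of Gaussian averages of a continuous family. -/
lemma continuous_gaussAvg {X : Type*} [TopologicalSpace X] [FirstCountableTopology X]
    {g : X → (Fin d → ℝ) → ℝ} (hκ : 0 ≤ κ) (hgc : Continuous (Function.uncurry g))
    (hg : ∀ u, ExpGrowth κ C (g u)) (hmc : Continuous m) (hm : ExpGrowth 2 2 m) :
    Continuous fun p : X × ℝ × (Fin d → ℝ) => gaussAvg m (g p.1) p.2.1 p.2.2 := by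
  rw [continuous_iff_continuousAt]
  rintro ⟨u₀, v₀, y₀⟩
  unfold gaussAvg
  have hs : Continuous fun p : X × ℝ × (Fin d → ℝ) => ∑ l, |p.2.2 l| := by fun_prop
  refine continuousAt_of_dominated (bound := fun w =>
    C * exp (κ * (∑ l, |y₀ l| + 1)) * (2 * exp ((κ * √(v₀ + 1) + 2) * ∑ l, |w l|))) ?_ ?_ ?_ ?_
  · refine Eventually.of_forall fun p => ?_
    have : Continuous (g p.1) := hgc.comp (by fun_prop : Continuous fun y => (p.1, y))
    fun_prop
  · have h1 : ∀ᶠ p in 𝓝 (u₀, v₀, y₀), (p : X × ℝ × (Fin d → ℝ)).2.1 < v₀ + 1 :=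
      (continuous_fst.comp continuous_snd).continuousAt.eventually_lt_const (by simp)
    have h2 : ∀ᶠ p in 𝓝 (u₀, v₀, y₀), ∑ l, |(p : X × ℝ × (Fin d → ℝ)).2.2 l| < ∑ l, |y₀ l| + 1 :=
      hs.continuousAt.eventually_lt_const (by simp)
    filter_upwards [h1, h2] with p h1 h2
    refine Eventually.of_forall fun w => (abs_avg_integrand_le hκ (hg _) hm h1.le _ w).trans ?_
    have := (hg u₀).nonneg
    gcongr
  · exact ((integrable_exp_sum_abs _).const_mul 2).const_mul _
  -- Continuity holds at every real `v`, zero and negative values included, because `√` is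
  -- continuous on ℝ and vanishes on the negative axis.
  · refine Eventually.of_forall fun w => Continuous.continuousAt ?_
    exact (hgc.comp (f := fun p : X × ℝ × (Fin d → ℝ) => (p.1, p.2.2 + √p.2.1 • w))
      (by fun_prop)).mul continuous_const

end Average

/-- The linear form with coefficients `c`. -/
def grad (c : Fin d → ℝ) : (Fin d → ℝ) →L[ℝ] ℝ := ∑ i, c i • ContinuousLinearMap.proj i

@[simp]
lemma grad_apply (c h : Fin d → ℝ) : grad c h = ∑ i, c i * h i := by
  simp [grad]

lemma norm_proj_le (i : Fin d) : ‖(ContinuousLinearMap.proj i : (Fin d → ℝ) →L[ℝ] ℝ)‖ ≤ 1 :=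
  ContinuousLinearMap.opNorm_le_bound _ zero_le_one fun x => by
    simpa using norm_le_pi_norm x i

lemma norm_grad_le (c : Fin d → ℝ) : ‖grad c‖ ≤ ∑ i, |c i| := by
  refine (norm_sum_le _ _).trans (Finset.sum_le_sum fun i _ => ?_)
  rw [norm_smul, norm_eq_abs]
  exact mul_le_of_le_one_right (abs_nonneg _) (norm_proj_le i)

@[fun_prop]
lemma continuous_grad : Continuous (grad : (Fin d → ℝ) → (Fin d → ℝ) →L[ℝ] ℝ) := by
  unfold grad; fun_prop

lemma integral_grad {α : Type*} [MeasurableSpace α] {μ : Measure α} {c : α → Fin d → ℝ}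
    (hc : ∀ i, Integrable (fun a => c a i) μ) :
    ∫ a, grad (c a) ∂μ = grad fun i => ∫ a, c a i ∂μ := by
  unfold grad
  rw [integral_finsetSum _ fun i _ => (hc i).smul_const _]
  exact Finset.sum_congr rfl fun i _ => integral_smul_const _ _

lemma hasFDerivAt_heatKernel (v : ℝ) (x y : Fin d → ℝ) :
    HasFDerivAt (fun y => heatKernel v (x - y))
      (grad fun i => heatKernel v (x - y) * ((x i - y i) / v)) y := by
  have h : ∀ l, HasFDerivAt (fun y : Fin d → ℝ => (x l - y l) ^ 2)
      ((-2 * (x l - y l)) • (ContinuousLinearMap.proj l : (Fin d → ℝ) →L[ℝ] ℝ)) y := fun l => by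
    have h1 : HasFDerivAt (fun y : Fin d → ℝ => x l - y l)
        (-(ContinuousLinearMap.proj l : (Fin d → ℝ) →L[ℝ] ℝ)) y :=
      (ContinuousLinearMap.proj (R := ℝ) (φ := fun _ : Fin d => ℝ) l).hasFDerivAt.const_sub (x l)
    convert! h1.pow 2 using 1
    ext; simp
  have h2 := ((HasFDerivAt.fun_sum fun l (_ : l ∈ Finset.univ) => h l).mul_const
    (-(2 * v)⁻¹)).exp.const_mul ((√(2 * π * v))⁻¹ ^ d)
  convert! h2 using 1
  · ext y; simp [heatKernel, div_eq_mul_inv]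
  · ext e
    simp only [grad_apply, smul_apply, sum_apply,
      ContinuousLinearMap.proj_apply, smul_eq_mul, heatKernel, Finset.mul_sum, Pi.sub_apply]
    refine Finset.sum_congr rfl fun i _ => ?_
    rw [mul_neg (∑ l, (x l - y l) ^ 2), ← neg_mul, ← div_eq_mul_inv, mul_inv]
    ring

lemma hasDerivAt_heatKernel {v : ℝ} (hv : 0 < v) (z : Fin d → ℝ) :
    HasDerivAt (fun v => heatKernel v z)
      (heatKernel v z * ((∑ l, z l ^ 2) / (2 * v ^ 2) - d / (2 * v))) v := by
  have hpos : 0 < 2 * π * v := by positivity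
  have hs := (sqrt_pos.2 hpos).ne'
  have h1 : HasDerivAt (fun v => (√(2 * π * v))⁻¹) (-(√(2 * π * v))⁻¹ / (2 * v)) v := by
    have h0 : HasDerivAt (fun v => 2 * π * v) (2 * π) v := by
      simpa using (hasDerivAt_id v).const_mul (2 * π)
    convert! (h0.sqrt hpos.ne').inv hs using 1
    have : √(2 * π * v) ^ 2 = 2 * π * v := sq_sqrt hpos.le
    field_simp
    rw [this]
  have h2 : HasDerivAt (fun v => exp (-(∑ l, z l ^ 2) / (2 * v)))
      (exp (-(∑ l, z l ^ 2) / (2 * v)) * ((∑ l, z l ^ 2) / (2 * v ^ 2))) v := by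
    have h0 : HasDerivAt (fun v : ℝ => 2 * v) 2 v := by
      simpa using (hasDerivAt_id v).const_mul 2
    have := (h0.inv (by positivity)).const_mul (-(∑ l, z l ^ 2))
    convert! this.exp using 1
    simp only [div_eq_mul_inv, Pi.inv_apply]
    field_simp
  convert! (h1.pow d).mul h2 using 1
  unfold heatKernel
  -- The power rule produces the natural number exponent d − 1, so d = 0 is separate.
  rcases Nat.eq_zero_or_pos d with rfl | hd
  · simp
  · obtain ⟨n, rfl⟩ : ∃ n, d = n + 1 := ⟨d - 1, by omega⟩
    simp only [Nat.add_sub_cancel, pow_succ, Pi.pow_apply]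
    push_cast
    field_simp
    ring

end RegimeSwitching

end

/-! ### Derivatives of Gaussian averages -/

noncomputable section

namespace RegimeSwitching

open Real Set Filter Topology

variable {d : ℕ}

/-- A Gaussian bound of the heat kernel, locally uniform in time and in the pole. -/
lemma exists_heatKernel_le {v₀ : ℝ} (hv₀ : 0 < v₀) (R : ℝ) :
    ∃ B, 0 ≤ B ∧ ∀ v ∈ Icc (v₀ / 2) (2 * v₀), ∀ x y : Fin d → ℝ, (∀ l, |y l| ≤ R) →
      heatKernel v (x - y) ≤ B * exp (-((8 * v₀)⁻¹ * ∑ l, x l ^ 2)) := by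
  -- The prefactor is largest at the smallest time v₀/2. In the exponent (x − y)² ≥ x²/2 − R² is
  -- used in each coordinate; v ≤ 2v₀ then gives the rate 1/(8v₀), and v ≥ v₀/2 the loss R²/v₀.
  refine ⟨(√(2 * π * (v₀ / 2)))⁻¹ ^ d * exp (d * (R ^ 2 / v₀)), by positivity, ?_⟩
  rintro v ⟨hv1, hv2⟩ x y hy
  have hv : 0 < v := by linarith
  rw [heatKernel, mul_assoc _ (exp _) (exp _), ← exp_add]
  refine mul_le_mul ?_ (exp_le_exp.2 ?_) (exp_pos _).le (by positivity)
  · gcongr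
  · have h : ∀ l, -((x - y) l ^ 2) / (2 * v) ≤ R ^ 2 / v₀ + -((8 * v₀)⁻¹ * x l ^ 2) := fun l => by
      have h1 : y l ^ 2 ≤ R ^ 2 := by
        rw [← sq_abs]; gcongr; exact hy l
      have h2 : x l ^ 2 / 2 - R ^ 2 ≤ (x - y) l ^ 2 := by
        simp only [Pi.sub_apply]; nlinarith [sq_nonneg (x l - 2 * y l)]
      have h3 : (x l ^ 2 / 2 - R ^ 2) / (2 * v) ≤ (x - y) l ^ 2 / (2 * v) := by gcongr
      have h4 : R ^ 2 / (2 * v) ≤ R ^ 2 / v₀ := by gcongr; linarith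
      have h5 : x l ^ 2 / (8 * v₀) ≤ x l ^ 2 / (4 * v) :=
        div_le_div_of_nonneg_left (sq_nonneg _) (by positivity) (by linarith)
      have h6 : (x l ^ 2 / 2 - R ^ 2) / (2 * v) = x l ^ 2 / (4 * v) - R ^ 2 / (2 * v) := by
        field_simp; ring
      rw [neg_div, inv_mul_eq_div]; linarith
    calc -(∑ l, (x - y) l ^ 2) / (2 * v) = ∑ l, -((x - y) l ^ 2) / (2 * v) := by
          rw [← Finset.sum_neg_distrib, Finset.sum_div]
      _ ≤ ∑ l : Fin d, (R ^ 2 / v₀ + -((8 * v₀)⁻¹ * x l ^ 2)) := Finset.sum_le_sum fun l _ => h l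
      _ = _ := by
          rw [Finset.sum_add_distrib, Finset.sum_neg_distrib, ← Finset.mul_sum]; simp

/-- Polynomial factors are traded for exponentials, which the Gaussian decay of the kernel absorbs;
the square of this bound covers every quadratic factor below. -/
lemma abs_sub_le_exp {R : ℝ} {x y : Fin d → ℝ} (hy : ∀ l, |y l| ≤ R) (i : Fin d) :
    |x i - y i| ≤ exp (R + ∑ l, |x l|) := by
  have h1 := abs_sub (x i) (y i)
  have h2 := abs_le_sum_abs x i
  have h3 := add_one_le_exp (R + ∑ l, |x l|)
  linarith [hy i]

lemma one_le_exp_add {R : ℝ} (hR : 0 ≤ R) (x : Fin d → ℝ) : 1 ≤ exp (R + ∑ l, |x l|) :=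
  one_le_exp (add_nonneg hR (sum_abs_nonneg x))

lemma abs_mul_sub_le_exp {R : ℝ} {x y : Fin d → ℝ} (hy : ∀ l, |y l| ≤ R) (i j : Fin d) :
    |(x i - y i) * (x j - y j)| ≤ exp (R + ∑ l, |x l|) ^ 2 := by
  rw [abs_mul, sq]
  exact mul_le_mul (abs_sub_le_exp hy i) (abs_sub_le_exp hy j) (abs_nonneg _) (exp_pos _).le

section Derivatives

variable {κ C : ℝ} {g : (Fin d → ℝ) → ℝ}

/-- An integrable majorant, locally uniform in time and in the pole, of the heat kernel times
a function of exponential growth times a polynomial. -/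
lemma exists_majorant (hg : ExpGrowth κ C g) {v₀ : ℝ} (hv₀ : 0 < v₀) {R A : ℝ} :
    ∃ G : (Fin d → ℝ) → ℝ, Integrable G ∧
      ∀ v ∈ Icc (v₀ / 2) (2 * v₀), ∀ x y : Fin d → ℝ, (∀ l, |y l| ≤ R) →
        ∀ q, |q| ≤ A * exp (R + ∑ l, |x l|) ^ 2 → |heatKernel v (x - y) * (g x * q)| ≤ G x := by
  obtain ⟨B, hB, hker⟩ := exists_heatKernel_le (d := d) hv₀ R
  have hC := hg.nonneg
  refine ⟨fun x => B * C * A * exp (2 * R)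
    * exp ((κ + 2) * ∑ l, |x l| - (8 * v₀)⁻¹ * ∑ l, x l ^ 2),
    (integrable_exp_sum_abs_sub_sq _ (by positivity)).const_mul _, ?_⟩
  intro v hv x y hy q hq
  rw [abs_mul, abs_mul, abs_of_nonneg (heatKernel_nonneg _ _)]
  calc heatKernel v (x - y) * (|g x| * |q|)
      ≤ (B * exp (-((8 * v₀)⁻¹ * ∑ l, x l ^ 2)))
        * ((C * exp (κ * ∑ l, |x l|)) * (A * exp (R + ∑ l, |x l|) ^ 2)) := by
        refine mul_le_mul (hker v hv x y hy) (mul_le_mul (hg x) hq (abs_nonneg _) (by positivity))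
          (by positivity) (by positivity)
    _ = B * C * A * (exp (-((8 * v₀)⁻¹ * ∑ l, x l ^ 2)) * exp (κ * ∑ l, |x l|)
        * exp (R + ∑ l, |x l|) ^ 2) := by ring
    _ = _ := by
        dsimp only
        rw [← exp_nat_mul, ← exp_add, ← exp_add, mul_assoc _ (exp _) (exp _), ← exp_add]
        congr 2
        push_cast
        ring

lemma abs_le_of_dist_lt_one {y₀ y : Fin d → ℝ} (h : y ∈ Metric.ball y₀ 1) (l : Fin d) :
    |y l| ≤ ‖y₀‖ + 1 := by
  have h1 : ‖y‖ ≤ ‖y₀‖ + ‖y - y₀‖ := by simpa using norm_add_le y₀ (y - y₀)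
  have h2 : ‖y - y₀‖ < 1 := by rwa [← dist_eq_norm]
  have := norm_le_pi_norm y l
  rw [norm_eq_abs] at this
  linarith

/-- Differentiation under the integral sign for integrals against heat kernels
multiplied by polynomials. -/
lemma hasFDerivAt_integral_heatKernel (hgc : Continuous g) (hg : ExpGrowth κ C g) {v : ℝ}
    (hv : 0 < v) {q : (Fin d → ℝ) → (Fin d → ℝ) → ℝ} {q' : (Fin d → ℝ) → (Fin d → ℝ) → Fin d → ℝ}
    (hqc : ∀ y, Continuous (q y)) (hqc' : ∀ y i, Continuous fun x => q' y x i) {A : ℝ}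
    (hq : ∀ y₀ : Fin d → ℝ, ∀ y ∈ Metric.ball y₀ 1, ∀ x,
      |q y x| ≤ A * exp (‖y₀‖ + 1 + ∑ l, |x l|) ^ 2)
    (hq' : ∀ y₀ : Fin d → ℝ, ∀ y ∈ Metric.ball y₀ 1, ∀ x i,
      |q' y x i| ≤ A * exp (‖y₀‖ + 1 + ∑ l, |x l|) ^ 2)
    (hderiv : ∀ x y, HasFDerivAt (fun y => heatKernel v (x - y) * q y x)
      (grad fun i => heatKernel v (x - y) * q' y x i) y) (y₀ : Fin d → ℝ) :
    HasFDerivAt (fun y => ∫ x, heatKernel v (x - y) * (g x * q y x))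
      (grad fun i => ∫ x, heatKernel v (x - y₀) * (g x * q' y₀ x i)) y₀ := by
  -- This radius makes the majorant valid for all poles in the unit ball around `y₀`.
  obtain ⟨G, hG, hbound⟩ := exists_majorant hg hv (R := ‖y₀‖ + 1) (A := A)
  have hvmem : v ∈ Icc (v / 2) (2 * v) := ⟨by linarith, by linarith⟩
  have hy₀ : y₀ ∈ Metric.ball y₀ (1 : ℝ) := Metric.mem_ball_self one_pos
  have hInt' : ∀ i, Integrable fun x => heatKernel v (x - y₀) * (g x * q' y₀ x i) := fun i => by
    have := hqc' y₀ i
    exact hG.mono' (by fun_prop) (Eventually.of_forall fun x =>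
      hbound v hvmem x y₀ (abs_le_of_dist_lt_one hy₀) _ (hq' y₀ y₀ hy₀ x i))
  rw [← integral_grad hInt']
  refine hasFDerivAt_integral_of_dominated_of_fderiv_le
    (F' := fun y x => grad fun i => heatKernel v (x - y) * (g x * q' y x i))
    (bound := fun x => ∑ _i : Fin d, G x) (Metric.ball_mem_nhds y₀ one_pos)
    (Eventually.of_forall fun y => ?_) ?_ ?_ (Eventually.of_forall fun x y hy => ?_) ?_
    (Eventually.of_forall fun x y _ => ?_)
  · have := hqc y
    fun_prop
  · have := hqc y₀
    exact hG.mono' (by fun_prop) (Eventually.of_forall fun x =>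
      hbound v hvmem x y₀ (abs_le_of_dist_lt_one hy₀) _ (hq y₀ y₀ hy₀ x))
  · have : Continuous fun x => (fun i => heatKernel v (x - y₀) * (g x * q' y₀ x i)) :=
      continuous_pi fun i => by have := hqc' y₀ i; fun_prop
    exact (continuous_grad.comp this).aestronglyMeasurable
  · exact (norm_grad_le _).trans (Finset.sum_le_sum fun i _ =>
      hbound v hvmem x y (abs_le_of_dist_lt_one hy) _ (hq' y₀ y hy x i))
  · exact integrable_finsetSum _ fun i _ => hG
  · convert! (hderiv x y).const_mul (g x) using 1
    · ext y; ring
    · ext e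
      simp only [grad_apply, smul_apply, smul_eq_mul, Finset.mul_sum]
      exact Finset.sum_congr rfl fun i _ => by ring

/-- The gradient of a Gaussian average. -/
lemma hasFDerivAt_gaussAvg_one (hgc : Continuous g) (hg : ExpGrowth κ C g) {v : ℝ} (hv : 0 < v)
    (y₀ : Fin d → ℝ) :
    HasFDerivAt (gaussAvg (fun _ => 1) g v)
      (grad fun i => (√v)⁻¹ * gaussAvg (weightOne i) g v y₀) y₀ := by
  have h := hasFDerivAt_integral_heatKernel hgc hg hv (q := fun _ _ => 1)
    (q' := fun y x i => (x i - y i) / v) (A := 1 + v⁻¹) (fun y => by fun_prop)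
    (fun y i => by fun_prop) ?_ ?_ ?_ y₀
  · convert! h using 1
    · ext y; rw [gaussAvg_eq_heatKernel hv]
    · congr 1
      ext i
      rw [gaussAvg_eq_heatKernel hv, ← integral_const_mul]
      refine integral_congr_ae (Eventually.of_forall fun x => ?_)
      -- One factor normalises x − y to the Gaussian variable `w`, the other remains in front as the
      -- cost of one derivative.
      have : v⁻¹ = (√v)⁻¹ * (√v)⁻¹ := by rw [← mul_inv, mul_self_sqrt hv.le]
      simp only [weightOne, Pi.smul_apply, Pi.sub_apply, smul_eq_mul, div_eq_mul_inv, this]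
      ring
  · intro y₀ y hy x
    have := one_le_exp_add (R := ‖y₀‖ + 1) (by positivity) x
    have h2 : 1 ≤ exp (‖y₀‖ + 1 + ∑ l, |x l|) ^ 2 := one_le_pow₀ this
    rw [abs_one]
    nlinarith [inv_pos.2 hv]
  · intro y₀ y hy x i
    have h1 := one_le_exp_add (R := ‖y₀‖ + 1) (by positivity) x
    have h2 := abs_sub_le_exp (x := x) (abs_le_of_dist_lt_one hy) i
    rw [div_eq_inv_mul, abs_mul, abs_of_pos (inv_pos.2 hv)]
    refine mul_le_mul (by linarith) (h2.trans (le_self_pow₀ h1 two_ne_zero)) (abs_nonneg _)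
      (by positivity)
  · intro x y
    simpa using hasFDerivAt_heatKernel v x y

/-- The second derivatives of a Gaussian average. -/
lemma hasFDerivAt_gaussAvg_weightOne (hgc : Continuous g) (hg : ExpGrowth κ C g) {v : ℝ}
    (hv : 0 < v) (i : Fin d) (y₀ : Fin d → ℝ) :
    HasFDerivAt (gaussAvg (weightOne i) g v)
      (grad fun j => (√v)⁻¹ * gaussAvg (weightTwo i j) g v y₀) y₀ := by
  have hs : v⁻¹ = (√v)⁻¹ * (√v)⁻¹ := by rw [← mul_inv, mul_self_sqrt hv.le]
  have h := hasFDerivAt_integral_heatKernel hgc hg hv (q := fun y x => (√v)⁻¹ * (x i - y i))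
    (q' := fun y x j => (√v)⁻¹ * ((x i - y i) * (x j - y j) / v
      - (1 : Matrix (Fin d) (Fin d) ℝ) i j)) (A := (√v)⁻¹ * (1 + v⁻¹)) (fun y => by fun_prop)
    (fun y i => by fun_prop) ?_ ?_ ?_ y₀
  · convert! h using 1
    · ext y; rw [gaussAvg_eq_heatKernel hv]; rfl
    · congr 1
      ext j
      rw [gaussAvg_eq_heatKernel hv, ← integral_const_mul]
      refine integral_congr_ae (Eventually.of_forall fun x => ?_)
      simp only [weightTwo, Pi.smul_apply, Pi.sub_apply, smul_eq_mul, div_eq_mul_inv, hs]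
      ring
  · intro y₀ y hy x
    have h1 := one_le_exp_add (R := ‖y₀‖ + 1) (by positivity) x
    have h2 := abs_sub_le_exp (x := x) (abs_le_of_dist_lt_one hy) i
    rw [abs_mul, abs_of_nonneg (by positivity : (0 : ℝ) ≤ (√v)⁻¹)]
    refine mul_le_mul ?_ (h2.trans (le_self_pow₀ h1 two_ne_zero)) (abs_nonneg _)
      (by positivity)
    exact le_mul_of_one_le_right (by positivity) (by linarith [inv_pos.2 hv])
  · intro y₀ y hy x j
    have h1 := one_le_exp_add (R := ‖y₀‖ + 1) (by positivity) x
    have h2 := abs_mul_sub_le_exp (x := x) (abs_le_of_dist_lt_one hy) i j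
    have h3 : 1 ≤ exp (‖y₀‖ + 1 + ∑ l, |x l|) ^ 2 := one_le_pow₀ h1
    rw [abs_mul, abs_of_nonneg (by positivity : (0 : ℝ) ≤ (√v)⁻¹), mul_assoc]
    gcongr
    refine (abs_sub _ _).trans ?_
    rw [abs_div, abs_of_pos hv, div_eq_inv_mul]
    have := abs_one_matrix_le i j
    have h4 := mul_le_mul_of_nonneg_left h2 (inv_pos.2 hv).le
    linarith
  · intro x y
    have h1 : HasFDerivAt (fun y : Fin d → ℝ => (√v)⁻¹ * (x i - y i))
        ((√v)⁻¹ • -(ContinuousLinearMap.proj i : (Fin d → ℝ) →L[ℝ] ℝ)) y :=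
      ((ContinuousLinearMap.proj (R := ℝ) (φ := fun _ : Fin d => ℝ) i).hasFDerivAt.const_sub
        (x i)).const_mul _
    convert! (hasFDerivAt_heatKernel v x y).mul h1 using 1
    ext e
    simp only [grad_apply, smul_apply, smul_eq_mul, add_apply, neg_apply,
      ContinuousLinearMap.proj_apply, Finset.mul_sum]
    have : e i = ∑ j, (1 : Matrix (Fin d) (Fin d) ℝ) i j * e j := by
      simp [Matrix.one_apply]
    rw [this, ← Finset.sum_neg_distrib, Finset.mul_sum, Finset.mul_sum, ← Finset.sum_add_distrib]
    exact Finset.sum_congr rfl fun j _ => by ring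

/-- The heat equation for Gaussian averages. -/
lemma hasDerivAt_gaussAvg (hgc : Continuous g) (hg : ExpGrowth κ C g) {v : ℝ} (hv : 0 < v)
    (y : Fin d → ℝ) :
    HasDerivAt (fun v => gaussAvg (fun _ => 1) g v y)
      (∑ i, (2 * v)⁻¹ * gaussAvg (weightTwo i i) g v y) v := by
  -- The summand 1 covers the undifferentiated integrand. The other two bound d/(2u) and the
  -- coefficient in |x − y|²/(2u²) for all times u ≥ v/2.
  obtain ⟨G, hG, hbound⟩ := exists_majorant hg hv (R := ‖y‖ + 1) (A := 1 + (d / v + 2 * d / v ^ 2))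
  have hy : ∀ l, |y l| ≤ ‖y‖ + 1 := abs_le_of_dist_lt_one (Metric.mem_ball_self one_pos)
  have hvmem : v ∈ Icc (v / 2) (2 * v) := ⟨by linarith, by linarith⟩
  have hQ : ∀ x : Fin d → ℝ, 1 ≤ exp (‖y‖ + 1 + ∑ l, |x l|) ^ 2 := fun x =>
    one_le_pow₀ (one_le_exp_add (by positivity) x)
  have key := hasDerivAt_integral_of_dominated_loc_of_deriv_le (μ := volume)
    (F := fun v x => heatKernel v (x - y) * (g x * 1))
    (F' := fun v x => heatKernel v (x - y)
      * (g x * ((∑ l, (x - y) l ^ 2) / (2 * v ^ 2) - d / (2 * v))))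
    (bound := G) (x₀ := v) (Icc_mem_nhds (by linarith : v / 2 < v) (by linarith : v < 2 * v))
    (Eventually.of_forall fun v => by fun_prop) ?_ (by fun_prop)
    (Eventually.of_forall fun x u hu => hbound u hu x y hy _ ?_) hG
    (Eventually.of_forall fun x u hu => ?_)
  · have h2 := key.2
    have he : (fun v => gaussAvg (fun _ => 1) g v y)
        =ᶠ[𝓝 v] fun v => ∫ x, heatKernel v (x - y) * (g x * 1) := by
      filter_upwards [lt_mem_nhds hv] with u hu
      exact gaussAvg_eq_heatKernel hu y
    refine (h2.congr_of_eventuallyEq he).congr_deriv ?_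
    have hInt : ∀ i : Fin d, Integrable fun x =>
        heatKernel v (x - y) * (g x * weightTwo i i ((√v)⁻¹ • (x - y))) := fun i => by
      obtain ⟨G, hG, hbound⟩ := exists_majorant hg hv (R := ‖y‖ + 1) (A := v⁻¹ + 1)
      refine hG.mono' (by fun_prop) (Eventually.of_forall fun x => hbound v hvmem x y hy _ ?_)
      have h2 := abs_mul_sub_le_exp (x := x) hy i i
      have hs : v⁻¹ = (√v)⁻¹ * (√v)⁻¹ := by rw [← mul_inv, mul_self_sqrt hv.le]
      have h3 : weightTwo i i ((√v)⁻¹ • (x - y)) = v⁻¹ * ((x i - y i) * (x i - y i)) - 1 := by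
        rw [hs]; simp [weightTwo]; ring
      rw [h3]
      refine (abs_sub _ _).trans ?_
      rw [abs_mul, abs_of_pos (inv_pos.2 hv), abs_one]
      have h4 := mul_le_mul_of_nonneg_left h2 (inv_pos.2 hv).le
      linarith [hQ x]
    simp_rw [gaussAvg_eq_heatKernel hv, ← integral_const_mul]
    rw [← integral_finsetSum _ fun i _ => (hInt i).const_mul _]
    refine integral_congr_ae (Eventually.of_forall fun x => ?_)
    have hs : (√v)⁻¹ ^ 2 = v⁻¹ := by rw [inv_pow, sq_sqrt hv.le]
    have h3 : ∀ i, weightTwo i i ((√v)⁻¹ • (x - y)) = v⁻¹ * (x - y) i ^ 2 - 1 := fun i => by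
      rw [← hs]; simp [weightTwo]; ring
    simp only [h3, ← Finset.mul_sum, Finset.sum_sub_distrib]
    simp only [Finset.sum_const, Finset.card_univ, Fintype.card_fin, nsmul_eq_mul, mul_one]
    field_simp
  · refine hG.mono' (by fun_prop) (Eventually.of_forall fun x => hbound v hvmem x y hy _ ?_)
    rw [abs_one]
    have : 0 ≤ (d / v + 2 * d / v ^ 2) := by positivity
    nlinarith [hQ x]
  · have hu0 : 0 < u := by linarith [hu.1]
    refine (abs_sub _ _).trans ?_
    have h1 : ∑ l, (x - y) l ^ 2 ≤ d * exp (‖y‖ + 1 + ∑ l, |x l|) ^ 2 := by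
      have : ∑ _l : Fin d, exp (‖y‖ + 1 + ∑ l, |x l|) ^ 2
          = d * exp (‖y‖ + 1 + ∑ l, |x l|) ^ 2 := by simp
      rw [← this]
      refine Finset.sum_le_sum fun l _ => ?_
      rw [sq]
      exact (le_abs_self _).trans (abs_mul_sub_le_exp (x := x) hy l l)
    have h2 : (∑ l, (x - y) l ^ 2) / (2 * u ^ 2)
        ≤ d * exp (‖y‖ + 1 + ∑ l, |x l|) ^ 2 / (2 * (v / 2) ^ 2) := by
      gcongr; exact hu.1
    have h3 : (d : ℝ) / (2 * u) ≤ d / v := by gcongr; linarith [hu.1]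
    have h4 : d * exp (‖y‖ + 1 + ∑ l, |x l|) ^ 2 / (2 * (v / 2) ^ 2)
      = 2 * d / v ^ 2 * exp (‖y‖ + 1 + ∑ l, |x l|) ^ 2 := by field_simp
    rw [abs_of_nonneg (by positivity), abs_of_nonneg (by positivity)]
    have h5 : d / v ≤ d / v * exp (‖y‖ + 1 + ∑ l, |x l|) ^ 2 :=
      le_mul_of_one_le_right (by positivity) (hQ x)
    linarith [hQ x]
  · have hu0 : 0 < u := by linarith [hu.1]
    convert! (hasDerivAt_heatKernel hu0 (x - y)).mul_const (g x * 1) using 1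
    ring

end Derivatives

end RegimeSwitching

end

/-! ### Lipschitz sources and integrals with a singularity of order v^{-1/2} -/

noncomputable section

namespace RegimeSwitching

open Real Set Filter Topology

variable {d : ℕ}

/-- A continuous family of functions of uniform exponential growth. -/
structure IsGrowing (κ C : ℝ) (g : ℝ → (Fin d → ℝ) → ℝ) : Prop where
  exponent_nonneg : 0 ≤ κ
  cont : Continuous (Function.uncurry g)
  growth : ∀ u, ExpGrowth κ C (g u)

/-- A continuous family of locally Lipschitz functions of uniform exponential growth. -/
structure IsSource (κ C : ℝ) (g : ℝ → (Fin d → ℝ) → ℝ) : Prop extends IsGrowing κ C g where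
  lip : ∀ u x y, |g u x - g u y|
    ≤ C * (∑ l, |x l - y l|) * (exp (κ * ∑ l, |x l|) + exp (κ * ∑ l, |y l|))

lemma IsGrowing.cont_apply {κ C : ℝ} {g : ℝ → (Fin d → ℝ) → ℝ} (h : IsGrowing κ C g) (u : ℝ) :
    Continuous (g u) :=
  h.cont.comp (by fun_prop : Continuous fun y => (u, y))

/-- The constant in the bound of second derivatives up to time `V`. -/
def lipConst (d : ℕ) (κ V : ℝ) : ℝ :=
  ∫ w, 4 * exp ((κ * √V + 3) * ∑ l, |w l|) ∂stdNormal d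

lemma lipConst_nonneg (κ V : ℝ) : 0 ≤ lipConst d κ V :=
  integral_nonneg fun w => by positivity

/-- The Lipschitz bound gains a factor `√v` in averages whose weight is centred. -/
lemma IsSource.abs_gaussAvg_weightTwo_le {κ C : ℝ} {g : ℝ → (Fin d → ℝ) → ℝ}
    (h : IsSource κ C g) (u : ℝ) (i j : Fin d) {v V : ℝ} (hvV : v ≤ V)
    (y : Fin d → ℝ) :
    |gaussAvg (weightTwo i j) (g u) v y| ≤ √v * (C * exp (κ * ∑ l, |y l|) * lipConst d κ V) := by
  have hC := (h.growth u).nonneg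
  have hκ := h.exponent_nonneg
  have hInt := integrable_avg hκ (h.cont_apply u) (h.growth u)
    (continuous_weightTwo i j) (expGrowth_weightTwo i j) v y
  have hInt2 : Integrable (fun w => g u y * weightTwo i j w) (stdNormal d) := by
    simpa using integrable_avg hκ (h.cont_apply u) (h.growth u)
      (continuous_weightTwo i j) (expGrowth_weightTwo i j) 0 y
  -- The weight is centred, so g(u,y) can be subtracted under the integral; the difference g(u, y +
  -- √v w) − g(u,y) then supplies the factor √v.
  have hzero : ∫ w, g u y * weightTwo i j w ∂stdNormal d = 0 := by
    rw [integral_const_mul]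
    unfold weightTwo
    rw [integral_mul_sub_one, mul_zero]
  unfold gaussAvg lipConst
  rw [← sub_zero (∫ w, g u (y + √v • w) * weightTwo i j w ∂stdNormal d), ← hzero,
    ← integral_sub hInt hInt2, ← integral_const_mul, ← integral_const_mul, ← norm_eq_abs]
  refine norm_integral_le_of_norm_le
    ((((integrable_exp_sum_abs (κ * √V + 3)).const_mul 4).const_mul _).const_mul _)
    (Eventually.of_forall fun w => ?_)
  rw [← sub_mul, norm_mul, norm_eq_abs, norm_eq_abs]
  set S := ∑ l, |w l| with hS
  have hS0 : 0 ≤ S := sum_abs_nonneg w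
  have h1 : ∑ l, |(y + √v • w) l - y l| = √v * S := by
    rw [hS, Finset.mul_sum]
    refine Finset.sum_congr rfl fun l _ => ?_
    simp [abs_mul, abs_of_nonneg (sqrt_nonneg v)]
  have h2 : exp (κ * ∑ l, |(y + √v • w) l|) ≤ exp (κ * ∑ l, |y l|) * exp (κ * √V * S) := by
    rw [← exp_add, exp_le_exp, mul_assoc κ, ← mul_add]
    exact mul_le_mul_of_nonneg_left (sum_abs_add_smul_le y w hvV) hκ
  have h3 : exp (κ * ∑ l, |y l|) ≤ exp (κ * ∑ l, |y l|) * exp (κ * √V * S) :=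
    le_mul_of_one_le_right (exp_pos _).le (one_le_exp (by positivity))
  -- The displacement is linear in `S`. Absorbing it costs one unit of exponent, and with the 2 of
  -- the weight this makes the 3 in `lipConst`.
  have h4 : S ≤ exp S := by linarith [add_one_le_exp S]
  calc |g u (y + √v • w) - g u y| * |weightTwo i j w|
      ≤ (C * (√v * S) * (2 * (exp (κ * ∑ l, |y l|) * exp (κ * √V * S)))) * (2 * exp (2 * S)) := by
        refine mul_le_mul ((h.lip u _ _).trans ?_) (expGrowth_weightTwo i j w) (abs_nonneg _)
          (by positivity)
        rw [h1]
        gcongr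
        linarith
    _ ≤ (C * (√v * exp S) * (2 * (exp (κ * ∑ l, |y l|) * exp (κ * √V * S))))
        * (2 * exp (2 * S)) := by gcongr
    _ = _ := by
        rw [show (κ * √V + 3) * S = S + κ * √V * S + 2 * S by ring, exp_add, exp_add]
        ring

/-- On the positive axis this is a power with exponent above −1. On the negative axis `√v` is 0 and
so is its inverse, hence the end points need no sign condition. -/
lemma intervalIntegrable_inv_sqrt (a b : ℝ) :
    IntervalIntegrable (fun v => (√v)⁻¹) volume a b := by
  have h0 : ∀ c, 0 ≤ c → IntervalIntegrable (fun v => (√v)⁻¹) volume 0 c := fun c hc => by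
    refine (intervalIntegral.intervalIntegrable_rpow' (a := 0) (b := c)
      (by norm_num : (-1 : ℝ) < -(1 / 2))).congr fun x hx => ?_
    rw [uIoc_of_le hc] at hx
    rw [rpow_neg hx.1.le, sqrt_eq_rpow]
  have h1 : ∀ c, c ≤ 0 → IntervalIntegrable (fun v => (√v)⁻¹) volume 0 c := fun c hc => by
    refine (intervalIntegrable_const (c := (0 : ℝ))).congr fun x hx => ?_
    rw [uIoc_of_ge hc] at hx
    simp [sqrt_eq_zero_of_nonpos hx.2]
  have h2 : ∀ c, IntervalIntegrable (fun v => (√v)⁻¹) volume 0 c := fun c =>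
    (le_total 0 c).elim (h0 c) (h1 c)
  exact (h2 a).symm.trans (h2 b)

/-- Continuity of integrals with an integrable singularity at the lower end point. -/
lemma continuousOn_integral_of_singular {T : ℝ} {Φ : ℝ → ℝ → (Fin d → ℝ) → ℝ}
    (hc : ContinuousOn (fun p : ℝ × ℝ × (Fin d → ℝ) => Φ p.1 p.2.1 p.2.2) {p | 0 < p.2.1})
    {M : ℝ → (Fin d → ℝ) → ℝ} (hM : ∀ V, Continuous (M V))
    (hb : ∀ V t v y, 0 < v → v ≤ V → |Φ t v y| ≤ M V y * (√v)⁻¹) :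
    ContinuousOn (fun p : ℝ × (Fin d → ℝ) => ∫ v in (0 : ℝ)..(T - p.1), Φ p.1 v p.2)
      (Iio T ×ˢ univ) := by
  have hopen : IsOpen (Iio T ×ˢ (univ : Set (Fin d → ℝ))) := isOpen_Iio.prod isOpen_univ
  rw [hopen.continuousOn_iff]
  rintro ⟨t₀, y₀⟩ ⟨ht₀, -⟩
  have ht₀ : t₀ < T := ht₀
  -- The substitution v = (T − t)θ fixes the interval of integration, so that dominated convergence
  -- applies; the majorant becomes a multiple of θ^{-1/2}.
  have heq : (fun p : ℝ × (Fin d → ℝ) => ∫ v in (0 : ℝ)..(T - p.1), Φ p.1 v p.2)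
      = fun p => ∫ θ in (0 : ℝ)..1, (T - p.1) * Φ p.1 ((T - p.1) * θ) p.2 := by
    ext p
    rw [intervalIntegral.integral_const_mul,
      intervalIntegral.mul_integral_comp_mul_left (f := fun v => Φ p.1 v p.2)]
    simp
  rw [heq]
  have hcont : ∀ θ : ℝ, 0 < θ → ∀ p : ℝ × (Fin d → ℝ), p.1 < T →
      ContinuousAt (fun p : ℝ × (Fin d → ℝ) => (T - p.1) * Φ p.1 ((T - p.1) * θ) p.2) p := by
    intro θ hθ p hp
    have hpos : 0 < (T - p.1) * θ := mul_pos (by linarith) hθ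
    have h1 : ContinuousAt (fun p : ℝ × ℝ × (Fin d → ℝ) => Φ p.1 p.2.1 p.2.2)
        (p.1, (T - p.1) * θ, p.2) :=
      hc.continuousAt ((isOpen_lt continuous_const (by fun_prop)).mem_nhds hpos)
    have h2 : ContinuousAt (fun p : ℝ × (Fin d → ℝ) => (p.1, (T - p.1) * θ, p.2)) p := by
      fun_prop
    have h3 := ContinuousAt.comp (f := fun p : ℝ × (Fin d → ℝ) => (p.1, (T - p.1) * θ, p.2)) h1 h2
    exact (by fun_prop : ContinuousAt (fun p : ℝ × (Fin d → ℝ) => T - p.1) p).mul h3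
  have hnear : ∀ᶠ p : ℝ × (Fin d → ℝ) in 𝓝 (t₀, y₀), p.1 < T ∧ T - p.1 < T - t₀ + 1 ∧
      M (T - t₀ + 1) p.2 < M (T - t₀ + 1) y₀ + 1 := by
    refine ((continuous_fst.tendsto (t₀, y₀)).eventually_lt_const ht₀).and (Eventually.and ?_ ?_)
    · have h : Continuous fun p : ℝ × (Fin d → ℝ) => T - p.1 := by fun_prop
      exact h.continuousAt.eventually_lt_const (by simp)
    · exact ((hM _).comp continuous_snd).continuousAt.eventually_lt_const (by simp)
  set V := T - t₀ + 1
  refine intervalIntegral.continuousAt_of_dominated_interval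
    (bound := fun θ => √V * (M V y₀ + 1) * (√θ)⁻¹) ?_ ?_ ?_ ?_
  · filter_upwards [hnear] with p hp
    refine ContinuousOn.aestronglyMeasurable ?_ measurableSet_uIoc
    rw [uIoc_of_le zero_le_one]
    refine ContinuousOn.mul continuousOn_const
      (hc.comp (f := fun θ => (p.1, (T - p.1) * θ, p.2)) (by fun_prop) fun θ hθ => ?_)
    exact mul_pos (by linarith [hp.1]) hθ.1
  · filter_upwards [hnear] with p ⟨hp1, hp2, hp3⟩
    refine Eventually.of_forall fun θ hθ => ?_
    rw [uIoc_of_le zero_le_one] at hθ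
    have hτ : 0 < T - p.1 := by linarith
    have h1 := hb V p.1 ((T - p.1) * θ) p.2 (mul_pos hτ hθ.1)
      ((mul_le_of_le_one_right hτ.le hθ.2).trans hp2.le)
    rw [norm_mul, norm_of_nonneg hτ.le, norm_eq_abs]
    have hτs : (T - p.1) * (√(T - p.1))⁻¹ = √(T - p.1) := by
      have := (sqrt_pos.2 hτ).ne'
      field_simp
      rw [sq_sqrt hτ.le]
    have hM0 : 0 ≤ M V p.2 := by
      have := (abs_nonneg _).trans h1
      have hpos : 0 < (√((T - p.1) * θ))⁻¹ := inv_pos.2 (sqrt_pos.2 (mul_pos hτ hθ.1))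
      exact nonneg_of_mul_nonneg_left this hpos
    calc (T - p.1) * |Φ p.1 ((T - p.1) * θ) p.2|
        ≤ (T - p.1) * (M V p.2 * (√((T - p.1) * θ))⁻¹) := by gcongr
      _ = √(T - p.1) * M V p.2 * (√θ)⁻¹ := by
          rw [sqrt_mul hτ.le, mul_inv]
          linear_combination (M V p.2 * (√θ)⁻¹) * hτs
      _ ≤ √V * (M V y₀ + 1) * (√θ)⁻¹ := by gcongr
  · exact (intervalIntegrable_inv_sqrt 0 1).const_mul _
  · refine Eventually.of_forall fun θ hθ => ?_
    rw [uIoc_of_le zero_le_one] at hθ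
    exact hcont θ hθ.1 _ ht₀

/-- Differentiation under an integral sign with an integrable singularity at `0`. -/
lemma hasFDerivAt_integral_of_singular {τ : ℝ} (hτ : 0 ≤ τ) {F : ℝ → (Fin d → ℝ) → ℝ}
    {c : Fin d → ℝ → (Fin d → ℝ) → ℝ} {M N : (Fin d → ℝ) → ℝ} (hM : Continuous M)
    (hFc : ∀ y, ContinuousOn (fun v => F v y) (Ioi 0))
    (hcc : ∀ i y, ContinuousOn (fun v => c i v y) (Ioi 0))
    (hF : ∀ v ∈ Ioc 0 τ, ∀ y, |F v y| ≤ N y * (√v)⁻¹)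
    (hcb : ∀ i, ∀ v ∈ Ioc 0 τ, ∀ y, |c i v y| ≤ M y * (√v)⁻¹)
    (hderiv : ∀ v ∈ Ioc 0 τ, ∀ y, HasFDerivAt (F v) (grad fun i => c i v y) y)
    (y₀ : Fin d → ℝ) :
    HasFDerivAt (fun y => ∫ v in (0 : ℝ)..τ, F v y)
      (grad fun i => ∫ v in (0 : ℝ)..τ, c i v y₀) y₀ := by
  simp_rw [intervalIntegral.integral_of_le hτ]
  have hI : IntegrableOn (fun v => (√v)⁻¹) (Ioc 0 τ) :=
    (intervalIntegrable_iff_integrableOn_Ioc_of_le hτ).1 (intervalIntegrable_inv_sqrt 0 τ)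
  have hsub : Ioc 0 τ ⊆ Ioi (0 : ℝ) := fun x hx => hx.1
  have hmeas : ∀ i y, AEStronglyMeasurable (fun v => c i v y) (volume.restrict (Ioc 0 τ)) :=
    fun i y => ((hcc i y).mono hsub).aestronglyMeasurable measurableSet_Ioc
  have hInt : ∀ i, Integrable (fun v => c i v y₀) (volume.restrict (Ioc 0 τ)) := fun i =>
    (hI.const_mul (M y₀)).mono' (hmeas i y₀)
      (ae_restrict_of_forall_mem measurableSet_Ioc fun v hv => hcb i v hv y₀)
  rw [← integral_grad hInt]
  refine hasFDerivAt_integral_of_dominated_of_fderiv_le (s := {y | M y < M y₀ + 1})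
    (F' := fun y v => grad fun i => c i v y)
    (bound := fun v => ∑ _i : Fin d, (M y₀ + 1) * (√v)⁻¹)
    ((isOpen_lt hM continuous_const).mem_nhds (by simp))
    (Eventually.of_forall fun y =>
      ((hFc y).mono hsub).aestronglyMeasurable measurableSet_Ioc) ?_ ?_ ?_ ?_ ?_
  · exact (hI.const_mul (N y₀)).mono'
      (((hFc y₀).mono hsub).aestronglyMeasurable measurableSet_Ioc)
      (ae_restrict_of_forall_mem measurableSet_Ioc fun v hv => hF v hv y₀)
  · exact continuous_grad.comp_aestronglyMeasurable
      (aemeasurable_pi_lambda _ fun i => (hmeas i y₀).aemeasurable).aestronglyMeasurable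
  · refine ae_restrict_of_forall_mem measurableSet_Ioc fun v hv y hy => ?_
    refine (norm_grad_le _).trans (Finset.sum_le_sum fun i _ => (hcb i v hv y).trans ?_)
    gcongr
    exact le_of_lt hy
  · exact integrable_finsetSum _ fun i _ => hI.const_mul _
  · exact ae_restrict_of_forall_mem measurableSet_Ioc fun v hv y _ => hderiv v hv y

/-- Interchange of the order of integration over a triangle, for a kernel with an integrable
singularity at `0` in its first argument. -/
lemma integral_triangle_swap {t T M : ℝ} (htT : t ≤ T) {Q : ℝ → ℝ → ℝ}
    (hQc : ContinuousOn (Function.uncurry Q) {p | 0 < p.1})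
    (hQ : ∀ v ∈ Ioc 0 (T - t), ∀ u, |Q v u| ≤ M * (√v)⁻¹) :
    ∫ τ in t..T, ∫ v in (0 : ℝ)..(T - τ), Q v (τ + v)
      = ∫ u in t..T, ∫ v in (0 : ℝ)..(u - t), Q v u := by
  have hτ : 0 ≤ T - t := by linarith
  have hI : IntegrableOn (fun v => (√v)⁻¹) (Ioc 0 (T - t)) :=
    (intervalIntegrable_iff_integrableOn_Ioc_of_le hτ).1 (intervalIntegrable_inv_sqrt 0 _)
  have hprod : Integrable (fun p : ℝ × ℝ => (1 : ℝ) * (M * (√p.2)⁻¹))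
      ((volume.restrict (Ioc t T)).prod (volume.restrict (Ioc 0 (T - t)))) :=
    Integrable.mul_prod (integrable_const _) (hI.const_mul M)
  -- Both sides are extended by indicators to the rectangle (t,T] × (0,T−t], where M·v^{-1/2} is an
  -- integrable majorant and Fubini applies.
  have hswap : ∀ (S : Set (ℝ × ℝ)), MeasurableSet S → S ⊆ {p | 0 < p.2} →
      ∀ f : ℝ → ℝ → ℝ, ContinuousOn (Function.uncurry f) {p | 0 < p.2} →
      (∀ v ∈ Ioc 0 (T - t), ∀ a, |f a v| ≤ M * (√v)⁻¹) →
      ∫ a in Ioc t T, ∫ v in Ioc 0 (T - t), S.indicator (Function.uncurry f) (a, v)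
        = ∫ v in Ioc 0 (T - t), ∫ a in Ioc t T, S.indicator (Function.uncurry f) (a, v) := by
    intro S hS hS0 f hf hfb
    refine integral_integral_swap (hprod.mono' ?_ ?_)
    · change AEStronglyMeasurable (S.indicator (Function.uncurry f)) _
      rw [aestronglyMeasurable_indicator_iff hS]
      exact (hf.mono hS0).aestronglyMeasurable hS
    · rw [Measure.prod_restrict]
      refine ae_restrict_of_forall_mem (measurableSet_Ioc.prod measurableSet_Ioc) ?_
      rintro ⟨a, v⟩ ⟨-, hv⟩
      change ‖S.indicator (Function.uncurry f) (a, v)‖ ≤ _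
      rw [one_mul]
      exact (norm_indicator_le_norm_self _ _).trans (hfb v hv a)
  have hS1 : MeasurableSet {p : ℝ × ℝ | 0 < p.2 ∧ p.1 + p.2 ≤ T} :=
    (measurableSet_lt measurable_const measurable_snd).inter
      (measurableSet_le (measurable_fst.add measurable_snd) measurable_const)
  -- The inequality is strict because it is the image of τ > t under u = τ + v. With this choice the
  -- two indicators agree pointwise after the translation by `v`.
  have hS2 : MeasurableSet {p : ℝ × ℝ | 0 < p.2 ∧ t + p.2 < p.1} :=
    (measurableSet_lt measurable_const measurable_snd).inter
      (measurableSet_lt (measurable_snd.const_add t) measurable_fst)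
  have h1 := hswap _ hS1 (fun p hp => hp.1) (fun τ v => Q v (τ + v))
    (hQc.comp (f := fun p : ℝ × ℝ => (p.2, p.1 + p.2)) (by fun_prop) fun p hp => hp)
    fun v hv a => hQ v hv _
  have h2 := hswap _ hS2 (fun p hp => hp.1) (fun u v => Q v u)
    (hQc.comp (f := fun p : ℝ × ℝ => (p.2, p.1)) (by fun_prop) fun p hp => hp)
    fun v hv a => hQ v hv _
  have e1 : ∫ τ in t..T, ∫ v in (0 : ℝ)..(T - τ), Q v (τ + v)
      = ∫ τ in Ioc t T, ∫ v in Ioc 0 (T - t), indicator {p : ℝ × ℝ | 0 < p.2 ∧ p.1 + p.2 ≤ T}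
        (Function.uncurry fun τ v => Q v (τ + v)) (τ, v) := by
    rw [intervalIntegral.integral_of_le htT]
    refine setIntegral_congr_fun measurableSet_Ioc fun τ hτ => ?_
    rw [intervalIntegral.integral_of_le (by linarith [hτ.2])]
    rw [← integral_indicator measurableSet_Ioc, ← integral_indicator measurableSet_Ioc]
    congr 1
    ext v
    simp only [indicator, mem_Ioc, mem_ofPred_eq, Function.uncurry]
    have := hτ.1
    split_ifs <;> first | rfl | (exfalso; grind)
  have e2 : ∫ u in t..T, ∫ v in (0 : ℝ)..(u - t), Q v u
      = ∫ u in Ioc t T, ∫ v in Ioc 0 (T - t), indicator {p : ℝ × ℝ | 0 < p.2 ∧ t + p.2 < p.1}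
        (Function.uncurry fun u v => Q v u) (u, v) := by
    rw [intervalIntegral.integral_of_le htT]
    refine setIntegral_congr_fun measurableSet_Ioc fun u hu => ?_
    rw [intervalIntegral.integral_of_le (by linarith [hu.1]), integral_Ioc_eq_integral_Ioo]
    rw [← integral_indicator measurableSet_Ioc, ← integral_indicator measurableSet_Ioo]
    congr 1
    ext v
    simp only [indicator, mem_Ioc, mem_Ioo, mem_ofPred_eq, Function.uncurry]
    have := hu.2
    split_ifs <;> first | rfl | (exfalso; grind)
  rw [e1, e2, h1, h2]
  refine setIntegral_congr_fun measurableSet_Ioc fun v hv => ?_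
  rw [← integral_indicator measurableSet_Ioc, ← integral_indicator measurableSet_Ioc,
    ← integral_sub_right_eq_self _ v]
  congr 1
  ext u
  simp only [indicator, mem_Ioc, mem_ofPred_eq, Function.uncurry, sub_add_cancel]
  have := hv.1
  have := hv.2
  split_ifs <;> first | rfl | (exfalso; grind)

end RegimeSwitching

end

/-! ### The heat equation with a source: heat flow and Duhamel integral -/

noncomputable section

namespace RegimeSwitching

open Real Set Filter Topology

variable {d : ℕ}

/-- `Z` is a solution of `∂_t Z + ½ Δ Z + f = 0` for `t < T` with continuous gradient `Z₁` and
continuous Hessian `Z₂`. -/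
structure SolvesHeat (T : ℝ) (f Z : ℝ → (Fin d → ℝ) → ℝ) (Z₁ : Fin d → ℝ → (Fin d → ℝ) → ℝ)
    (Z₂ : Fin d → Fin d → ℝ → (Fin d → ℝ) → ℝ) : Prop where
  cont : Continuous (Function.uncurry Z)
  deriv_t : ∀ t < T, ∀ y, HasDerivAt (fun τ => Z τ y) (-f t y - 1 / 2 * ∑ i, Z₂ i i t y) t
  deriv_y : ∀ t < T, ∀ y, HasFDerivAt (Z t) (grad fun i => Z₁ i t y) y
  deriv_yy : ∀ i, ∀ t < T, ∀ y, HasFDerivAt (Z₁ i t) (grad fun j => Z₂ i j t y) y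
  cont_y : ∀ i, ContinuousOn (Function.uncurry (Z₁ i)) (Iio T ×ˢ univ)
  cont_yy : ∀ i j, ContinuousOn (Function.uncurry (Z₂ i j)) (Iio T ×ˢ univ)

lemma grad_add (b c : Fin d → ℝ) : grad b + grad c = grad fun i => b i + c i := by
  ext e; simp [add_mul, Finset.sum_add_distrib]

lemma SolvesHeat.add {T : ℝ} {f f' Z Z' : ℝ → (Fin d → ℝ) → ℝ}
    {Z₁ Z₁' : Fin d → ℝ → (Fin d → ℝ) → ℝ} {Z₂ Z₂' : Fin d → Fin d → ℝ → (Fin d → ℝ) → ℝ}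
    (h : SolvesHeat T f Z Z₁ Z₂) (h' : SolvesHeat T f' Z' Z₁' Z₂') :
    SolvesHeat T (fun t y => f t y + f' t y) (fun t y => Z t y + Z' t y)
      (fun i t y => Z₁ i t y + Z₁' i t y) (fun i j t y => Z₂ i j t y + Z₂' i j t y) where
  cont := h.cont.add h'.cont
  deriv_t t ht y := by
    refine ((h.deriv_t t ht y).add (h'.deriv_t t ht y)).congr_deriv ?_
    rw [Finset.sum_add_distrib]; ring
  deriv_y t ht y := by
    rw [← grad_add]; exact (h.deriv_y t ht y).add (h'.deriv_y t ht y)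
  deriv_yy i t ht y := by
    rw [← grad_add]; exact (h.deriv_yy i t ht y).add (h'.deriv_yy i t ht y)
  cont_y i := (h.cont_y i).add (h'.cont_y i)
  cont_yy i j := (h.cont_yy i j).add (h'.cont_yy i j)

section

variable {κ C : ℝ} {g : ℝ → (Fin d → ℝ) → ℝ}

lemma grad_const_mul (a : ℝ) (c : Fin d → ℝ) : a • grad c = grad fun i => a * c i := by
  ext e; simp [Finset.mul_sum, mul_assoc]

/-- Heat flow from the terminal datum `k`. -/
lemma solvesHeat_gaussAvg (hκ : 0 ≤ κ) {k : (Fin d → ℝ) → ℝ} (hkc : Continuous k)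
    (hk : ExpGrowth κ C k) (T : ℝ) :
    SolvesHeat T (fun _ _ => 0) (fun t y => gaussAvg (fun _ => 1) k (T - t) y)
      (fun i t y => (√(T - t))⁻¹ * gaussAvg (weightOne i) k (T - t) y)
      (fun i j t y => (√(T - t))⁻¹ * ((√(T - t))⁻¹ * gaussAvg (weightTwo i j) k (T - t) y)) := by
  have hcont : ∀ m : (Fin d → ℝ) → ℝ, Continuous m → ExpGrowth 2 2 m →
      Continuous fun p : ℝ × (Fin d → ℝ) => gaussAvg m k (T - p.1) p.2 := fun m hmc hm =>
    (continuous_gaussAvg (X := Unit) (g := fun _ => k) hκ (by fun_prop) (fun _ => hk) hmc hm).comp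
      (f := fun p : ℝ × (Fin d → ℝ) => ((), T - p.1, p.2)) (by fun_prop)
  have hs : ContinuousOn (fun p : ℝ × (Fin d → ℝ) => (√(T - p.1))⁻¹) (Iio T ×ˢ univ) := by
    refine ContinuousOn.inv₀ (by fun_prop) fun p hp => ?_
    exact (sqrt_pos.2 (sub_pos.2 hp.1)).ne'
  refine ⟨hcont _ continuous_const expGrowth_const_one, fun t ht y => ?_, fun t ht y => ?_,
    fun i t ht y => ?_, fun i => hs.mul
      (hcont _ (continuous_weightOne i) (expGrowth_weightOne i)).continuousOn,
    fun i j => hs.mul (hs.mul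
      (hcont _ (continuous_weightTwo i j) (expGrowth_weightTwo i j)).continuousOn)⟩
  · have hpos : 0 < T - t := by linarith
    have h1 := (hasDerivAt_gaussAvg hkc hk hpos y).scomp t ((hasDerivAt_id t).const_sub T)
    refine h1.congr_deriv ?_
    have : (2 * (T - t))⁻¹ = 1 / 2 * ((√(T - t))⁻¹ * (√(T - t))⁻¹) := by
      rw [← mul_inv (√(T - t)), mul_self_sqrt hpos.le, mul_inv]; ring
    simp only [this, smul_eq_mul, Finset.mul_sum, neg_zero, zero_sub, ← Finset.sum_neg_distrib]
    exact Finset.sum_congr rfl fun i _ => by ring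
  · exact hasFDerivAt_gaussAvg_one hkc hk (by linarith) y
  · rw [← grad_const_mul]
    exact (hasFDerivAt_gaussAvg_weightOne hkc hk (by linarith) i y).const_mul _

/-- The Duhamel integral of the source `g`. -/
def duhamel (T : ℝ) (g : ℝ → (Fin d → ℝ) → ℝ) (t : ℝ) (y : Fin d → ℝ) : ℝ :=
  ∫ v in (0 : ℝ)..(T - t), gaussAvg (fun _ => 1) (g (t + v)) v y

/-- The gradient of the Duhamel integral. -/
def duhamelGrad (T : ℝ) (g : ℝ → (Fin d → ℝ) → ℝ) (i : Fin d) (t : ℝ) (y : Fin d → ℝ) : ℝ :=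
  ∫ v in (0 : ℝ)..(T - t), (√v)⁻¹ * gaussAvg (weightOne i) (g (t + v)) v y

/-- The Hessian of the Duhamel integral. -/
def duhamelHess (T : ℝ) (g : ℝ → (Fin d → ℝ) → ℝ) (i j : Fin d) (t : ℝ) (y : Fin d → ℝ) : ℝ :=
  ∫ v in (0 : ℝ)..(T - t), (√v)⁻¹ * ((√v)⁻¹ * gaussAvg (weightTwo i j) (g (t + v)) v y)

/-- A constant bounding Gaussian averages and their derivatives up to time `V`. -/
def derivBound (d : ℕ) (κ C V : ℝ) (y : Fin d → ℝ) : ℝ :=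
  C * exp (κ * ∑ l, |y l|) * (√V * avgConst d κ V + avgConst d κ V + lipConst d κ V)

@[fun_prop]
lemma continuous_derivBound (V : ℝ) : Continuous (derivBound d κ C V) := by
  unfold derivBound; fun_prop

namespace IsGrowing

lemma continuous_avg (h : IsGrowing κ C g)
    {m : (Fin d → ℝ) → ℝ} (hmc : Continuous m) (hm : ExpGrowth 2 2 m) :
    Continuous fun p : ℝ × ℝ × (Fin d → ℝ) => gaussAvg m (g p.1) p.2.1 p.2.2 :=
  continuous_gaussAvg h.exponent_nonneg h.cont h.growth hmc hm

/-- Without derivatives the integrand is not singular, so no Lipschitz bound is needed and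
continuity extends to t = T. This matters during the fixed point argument, when no Lipschitz bound
may be assumed. -/
lemma continuous_duhamel (h : IsGrowing κ C g)
    (T : ℝ) : Continuous (Function.uncurry (duhamel T g)) := by
  have h1 : Continuous (Function.uncurry fun (p : ℝ × (Fin d → ℝ)) (v : ℝ) =>
      gaussAvg (fun _ => 1) (g (p.1 + v)) v p.2) :=
    (h.continuous_avg continuous_const expGrowth_const_one).comp
      (f := fun q : (ℝ × (Fin d → ℝ)) × ℝ => (q.1.1 + q.2, q.2, q.1.2)) (by fun_prop)
  exact intervalIntegral.continuous_parametric_intervalIntegral_of_continuous (a₀ := 0) h1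
    (s := fun p : ℝ × (Fin d → ℝ) => T - p.1) (by fun_prop)

end IsGrowing

namespace IsSource

/-- The average itself is bounded; the singular factor enters through 1 ≤ √V/√v only to give value,
gradient and Hessian a common majorant. -/
lemma abs_avg_le (h : IsSource κ C g)
    {v V : ℝ} (hv : 0 < v) (hvV : v ≤ V) (u : ℝ) (y : Fin d → ℝ) :
    |gaussAvg (fun _ => 1) (g u) v y| ≤ derivBound d κ C V y * (√v)⁻¹ := by
  have hC := (h.growth u).nonneg
  have hs := sqrt_pos.2 hv
  have h1 := avgConst_nonneg (d := d) κ V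
  have h2 := lipConst_nonneg (d := d) κ V
  refine (abs_gaussAvg_le h.exponent_nonneg (h.growth u) expGrowth_const_one hvV y).trans ?_
  rw [derivBound, mul_assoc _ (_ + _ + _) (√v)⁻¹]
  gcongr
  have h3 : avgConst d κ V ≤ √V * avgConst d κ V * (√v)⁻¹ := by
    rw [mul_right_comm]
    refine le_mul_of_one_le_left h1 ?_
    rw [← div_eq_mul_inv, one_le_div hs]
    exact sqrt_le_sqrt hvV
  refine h3.trans ?_
  gcongr
  linarith

/-- For one derivative the growth bound alone is enough: the cost v^{-1/2} is already integrable. -/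
lemma abs_avg_weightOne_le (h : IsSource κ C g)
    {v V : ℝ} (hv : 0 < v) (hvV : v ≤ V) (u : ℝ) (i : Fin d)
    (y : Fin d → ℝ) :
    |(√v)⁻¹ * gaussAvg (weightOne i) (g u) v y| ≤ derivBound d κ C V y * (√v)⁻¹ := by
  have hC := (h.growth u).nonneg
  have hs := sqrt_pos.2 hv
  have h1 := avgConst_nonneg (d := d) κ V
  have h2 := lipConst_nonneg (d := d) κ V
  rw [abs_mul, abs_of_pos (inv_pos.2 hs), mul_comm]
  gcongr
  refine (abs_gaussAvg_le h.exponent_nonneg (h.growth u) (expGrowth_weightOne i) hvV y).trans ?_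
  rw [derivBound]
  gcongr
  have : 0 ≤ √V * avgConst d κ V := by positivity
  linarith

/-- Of the two factors v^{-1/2}, one is cancelled by the gain from the Lipschitz bound. This is the
place where a merely continuous source would fail. -/
lemma abs_avg_weightTwo_le (h : IsSource κ C g)
    {v V : ℝ} (hv : 0 < v) (hvV : v ≤ V) (u : ℝ) (i j : Fin d)
    (y : Fin d → ℝ) :
    |(√v)⁻¹ * ((√v)⁻¹ * gaussAvg (weightTwo i j) (g u) v y)|
      ≤ derivBound d κ C V y * (√v)⁻¹ := by
  have hC := (h.growth u).nonneg
  have hs := sqrt_pos.2 hv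
  have h1 := avgConst_nonneg (d := d) κ V
  have h2 := lipConst_nonneg (d := d) κ V
  rw [abs_mul, abs_of_pos (inv_pos.2 hs), mul_comm]
  gcongr
  rw [abs_mul, abs_of_pos (inv_pos.2 hs), inv_mul_le_iff₀ hs]
  refine (h.abs_gaussAvg_weightTwo_le u i j hvV y).trans ?_
  rw [derivBound]
  gcongr
  have : 0 ≤ √V * avgConst d κ V := by positivity
  linarith

lemma continuousOn_duhamelGrad (h : IsSource κ C g)
    (T : ℝ) (i : Fin d) :
    ContinuousOn (Function.uncurry (duhamelGrad T g i)) (Iio T ×ˢ univ) := by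
  refine continuousOn_integral_of_singular
    (Φ := fun t v y => (√v)⁻¹ * gaussAvg (weightOne i) (g (t + v)) v y)
    (M := derivBound d κ C) ?_ (fun V => by fun_prop)
    fun V t v y hv hvV => h.abs_avg_weightOne_le hv hvV _ i y
  refine ContinuousOn.mul (ContinuousOn.inv₀ (by fun_prop) fun p hp => (sqrt_pos.2 hp).ne') ?_
  exact ((h.continuous_avg (continuous_weightOne i) (expGrowth_weightOne i)).comp
    (f := fun p : ℝ × ℝ × (Fin d → ℝ) => (p.1 + p.2.1, p.2.1, p.2.2)) (by fun_prop)).continuousOn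

lemma continuousOn_duhamelHess (h : IsSource κ C g)
    (T : ℝ) (i j : Fin d) :
    ContinuousOn (Function.uncurry (duhamelHess T g i j)) (Iio T ×ˢ univ) := by
  refine continuousOn_integral_of_singular
    (Φ := fun t v y => (√v)⁻¹ * ((√v)⁻¹ * gaussAvg (weightTwo i j) (g (t + v)) v y))
    (M := derivBound d κ C) ?_ (fun V => by fun_prop)
    fun V t v y hv hvV => h.abs_avg_weightTwo_le hv hvV _ i j y
  have hs : ContinuousOn (fun p : ℝ × ℝ × (Fin d → ℝ) => (√p.2.1)⁻¹) {p | 0 < p.2.1} :=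
    ContinuousOn.inv₀ (by fun_prop) fun p hp => (sqrt_pos.2 hp).ne'
  exact hs.mul (hs.mul ((h.continuous_avg (continuous_weightTwo i j)
    (expGrowth_weightTwo i j)).comp
    (f := fun p : ℝ × ℝ × (Fin d → ℝ) => (p.1 + p.2.1, p.2.1, p.2.2)) (by fun_prop)).continuousOn)

lemma continuousOn_avg_shift (h : IsSource κ C g)
    {m : (Fin d → ℝ) → ℝ} (hmc : Continuous m) (hm : ExpGrowth 2 2 m)
    (t : ℝ) (y : Fin d → ℝ) (s : Set ℝ) :
    ContinuousOn (fun v => gaussAvg m (g (t + v)) v y) s :=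
  ((h.continuous_avg hmc hm).comp
    (f := fun v : ℝ => (t + v, v, y)) (by fun_prop)).continuousOn

lemma hasFDerivAt_duhamel (h : IsSource κ C g)
    {t T : ℝ} (ht : t < T) (y : Fin d → ℝ) :
    HasFDerivAt (duhamel T g t) (grad fun i => duhamelGrad T g i t y) y := by
  have hs : ContinuousOn (fun v : ℝ => (√v)⁻¹) (Ioi 0) :=
    ContinuousOn.inv₀ (by fun_prop) fun p hp => (sqrt_pos.2 hp).ne'
  exact hasFDerivAt_integral_of_singular (sub_nonneg.2 ht.le)
    (F := fun v y => gaussAvg (fun _ => 1) (g (t + v)) v y)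
    (c := fun i v y => (√v)⁻¹ * gaussAvg (weightOne i) (g (t + v)) v y)
    (M := derivBound d κ C (T - t)) (N := derivBound d κ C (T - t)) (by fun_prop)
    (fun y => h.continuousOn_avg_shift continuous_const expGrowth_const_one t y _)
    (fun i y => hs.mul (h.continuousOn_avg_shift (continuous_weightOne i)
      (expGrowth_weightOne i) t y _))
    (fun v hv y => h.abs_avg_le hv.1 hv.2 _ y)
    (fun i v hv y => h.abs_avg_weightOne_le hv.1 hv.2 _ i y)
    (fun v hv y => hasFDerivAt_gaussAvg_one (h.cont_apply _) (h.growth _) hv.1 y) y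

lemma hasFDerivAt_duhamelGrad (h : IsSource κ C g)
    {t T : ℝ} (ht : t < T) (i : Fin d) (y : Fin d → ℝ) :
    HasFDerivAt (duhamelGrad T g i t) (grad fun j => duhamelHess T g i j t y) y := by
  have hs : ContinuousOn (fun v : ℝ => (√v)⁻¹) (Ioi 0) :=
    ContinuousOn.inv₀ (by fun_prop) fun p hp => (sqrt_pos.2 hp).ne'
  refine hasFDerivAt_integral_of_singular (sub_nonneg.2 ht.le)
    (F := fun v y => (√v)⁻¹ * gaussAvg (weightOne i) (g (t + v)) v y)
    (c := fun j v y => (√v)⁻¹ * ((√v)⁻¹ * gaussAvg (weightTwo i j) (g (t + v)) v y))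
    (M := derivBound d κ C (T - t)) (N := derivBound d κ C (T - t)) (by fun_prop)
    (fun y => hs.mul (h.continuousOn_avg_shift (continuous_weightOne i)
      (expGrowth_weightOne i) t y _))
    (fun j y => hs.mul (hs.mul (h.continuousOn_avg_shift (continuous_weightTwo i j)
      (expGrowth_weightTwo i j) t y _)))
    (fun v hv y => h.abs_avg_weightOne_le hv.1 hv.2 _ i y)
    (fun j v hv y => h.abs_avg_weightTwo_le hv.1 hv.2 _ i j y)
    (fun v hv y => ?_) y
  rw [← grad_const_mul]
  exact (hasFDerivAt_gaussAvg_weightOne (h.cont_apply _) (h.growth _) hv.1 i y).const_mul _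

/-- The heat flow as the integral of half its Laplacian. -/
lemma gaussAvg_sub_eq_integral (h : IsSource κ C g)
    {v : ℝ} (hv : 0 ≤ v) (u : ℝ) (y : Fin d → ℝ) :
    ∫ w in (0 : ℝ)..v, 1 / 2 * ∑ i, (√w)⁻¹ * ((√w)⁻¹ * gaussAvg (weightTwo i i) (g u) w y)
      = gaussAvg (fun _ => 1) (g u) v y - g u y := by
  have h0 : gaussAvg (fun _ => 1) (g u) 0 y = g u y := by simp [gaussAvg]
  rw [← h0]
  have hcont : ∀ m : (Fin d → ℝ) → ℝ, Continuous m → ExpGrowth 2 2 m →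
      Continuous fun w => gaussAvg m (g u) w y := fun m hmc hm =>
    (h.continuous_avg hmc hm).comp (f := fun w : ℝ => (u, w, y)) (by fun_prop)
  -- The heat equation holds only for w > 0. The fundamental theorem still reaches w = 0, since the
  -- flow is continuous there and its derivative is O(w^{-1/2}), hence integrable.
  refine intervalIntegral.integral_eq_sub_of_hasDerivAt_of_le hv
    (f := fun w => gaussAvg (fun _ => 1) (g u) w y)
    (hcont _ continuous_const expGrowth_const_one).continuousOn (fun w hw => ?_) ?_
  · refine (hasDerivAt_gaussAvg (h.cont_apply u) (h.growth u) hw.1 y).congr_deriv ?_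
    have : (2 * w)⁻¹ = 1 / 2 * ((√w)⁻¹ * (√w)⁻¹) := by
      rw [← mul_inv (√w), mul_self_sqrt hw.1.le, mul_inv]; ring
    simp only [this, Finset.mul_sum]
    exact Finset.sum_congr rfl fun i _ => by ring
  · have hs : ContinuousOn (fun v : ℝ => (√v)⁻¹) (Ioc 0 v) :=
      ContinuousOn.inv₀ (by fun_prop) fun p hp => (sqrt_pos.2 hp.1).ne'
    rw [intervalIntegrable_iff_integrableOn_Ioc_of_le hv]
    have hI : IntegrableOn (fun v => (√v)⁻¹) (Ioc 0 v) :=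
      (intervalIntegrable_iff_integrableOn_Ioc_of_le hv).1 (intervalIntegrable_inv_sqrt 0 v)
    refine Integrable.const_mul (integrable_finsetSum _ fun i _ => ?_) _
    refine (hI.const_mul (derivBound d κ C v y)).mono' ?_
      (ae_restrict_of_forall_mem measurableSet_Ioc fun w hw =>
        h.abs_avg_weightTwo_le hw.1 hw.2 u i i y)
    exact (hs.mul (hs.mul (hcont _ (continuous_weightTwo i i)
      (expGrowth_weightTwo i i)).continuousOn)).aestronglyMeasurable measurableSet_Ioc

lemma intervalIntegrable_avg_weightTwo (h : IsSource κ C g)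
    {v : ℝ} (hv : 0 ≤ v) (t : ℝ) (i j : Fin d)
    (y : Fin d → ℝ) :
    IntervalIntegrable
      (fun v => (√v)⁻¹ * ((√v)⁻¹ * gaussAvg (weightTwo i j) (g (t + v)) v y)) volume 0 v := by
  have hs : ContinuousOn (fun v : ℝ => (√v)⁻¹) (Ioc 0 v) :=
    ContinuousOn.inv₀ (by fun_prop) fun p hp => (sqrt_pos.2 hp.1).ne'
  have hI := (intervalIntegrable_iff_integrableOn_Ioc_of_le hv).1 (intervalIntegrable_inv_sqrt 0 v)
  rw [intervalIntegrable_iff_integrableOn_Ioc_of_le hv]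
  refine (hI.const_mul (derivBound d κ C v y)).mono' ?_
    (ae_restrict_of_forall_mem measurableSet_Ioc fun w hw =>
      h.abs_avg_weightTwo_le hw.1 hw.2 _ i j y)
  exact (hs.mul (hs.mul (h.continuousOn_avg_shift (continuous_weightTwo i j)
    (expGrowth_weightTwo i j) t y _))).aestronglyMeasurable measurableSet_Ioc

/-- The Hessian at time τ is dominated by the integral of the singular majorant over the longer
interval (0, T − t), a constant independent of τ. The end point τ = T is left out because continuity
is known only before it. -/
lemma intervalIntegrable_duhamelHess (h : IsSource κ C g)
    {t T : ℝ} (ht : t ≤ T) (i j : Fin d) (y : Fin d → ℝ) :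
    IntervalIntegrable (fun τ => duhamelHess T g i j τ y) volume t T := by
  rw [intervalIntegrable_iff_integrableOn_Ioo_of_le ht]
  have hc : ContinuousOn (fun τ => duhamelHess T g i j τ y) (Ioo t T) :=
    (h.continuousOn_duhamelHess T i j).comp (f := fun τ => (τ, y)) (by fun_prop)
      fun τ hτ => ⟨hτ.2, mem_univ _⟩
  refine Integrable.mono' (g := fun _ => ∫ v in (0 : ℝ)..(T - t),
    derivBound d κ C (T - t) y * (√v)⁻¹) (integrable_const _)
    (hc.aestronglyMeasurable measurableSet_Ioo)
    (ae_restrict_of_forall_mem measurableSet_Ioo fun τ hτ => ?_)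
  have hC := (h.growth 0).nonneg
  have h1 := avgConst_nonneg (d := d) κ (T - t)
  have h2 := lipConst_nonneg (d := d) κ (T - t)
  have hB : 0 ≤ derivBound d κ C (T - t) y := by unfold derivBound; positivity
  refine (intervalIntegral.norm_integral_le_of_norm_le (by linarith [hτ.2])
    (g := fun v => derivBound d κ C (T - t) y * (√v)⁻¹)
    (Eventually.of_forall fun v hv => h.abs_avg_weightTwo_le hv.1
      (by linarith [hv.2, hτ.1]) _ i j y) ((intervalIntegrable_inv_sqrt _ _).const_mul _)).trans ?_
  refine intervalIntegral.integral_mono_interval le_rfl (by linarith [hτ.2]) (by linarith [hτ.1])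
    (Eventually.of_forall fun v => by positivity) ((intervalIntegrable_inv_sqrt _ _).const_mul _)

lemma intervalIntegrable_laplacian (h : IsSource κ C g)
    {t T : ℝ} (ht : t ≤ T) (y : Fin d → ℝ) :
    IntervalIntegrable (fun τ => 1 / 2 * ∑ i, duhamelHess T g i i τ y) volume t T := by
  refine ((IntervalIntegrable.sum (f := fun i τ => duhamelHess T g i i τ y) Finset.univ
    fun i _ => h.intervalIntegrable_duhamelHess ht i i y).const_mul (1 / 2)).congr fun τ _ => ?_
  simp

/-- The Duhamel integral as the time integral of its own generator. -/
lemma duhamel_eq_integral (h : IsSource κ C g)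
    {t T : ℝ} (ht : t ≤ T) (y : Fin d → ℝ) :
    duhamel T g t y = ∫ τ in t..T, (g τ y + 1 / 2 * ∑ i, duhamelHess T g i i τ y) := by
  have hg : Continuous fun τ => g τ y := h.cont.comp (f := fun τ => (τ, y)) (by fun_prop)
  have hlap : IntervalIntegrable (fun τ => 1 / 2 * ∑ i, duhamelHess T g i i τ y) volume t T :=
    h.intervalIntegrable_laplacian ht y
  have hB : ∀ v ∈ Ioc 0 (T - t), ∀ u,
      |1 / 2 * ∑ i, (√v)⁻¹ * ((√v)⁻¹ * gaussAvg (weightTwo i i) (g u) v y)|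
        ≤ 1 / 2 * ∑ _i : Fin d, derivBound d κ C (T - t) y * (√v)⁻¹ := fun v hv u => by
    rw [abs_mul, abs_of_pos one_half_pos]
    gcongr
    exact (Finset.abs_sum_le_sum_abs _ _).trans (Finset.sum_le_sum fun i _ =>
      h.abs_avg_weightTwo_le hv.1 hv.2 u i i y)
  -- Exchanging the order puts the integral over the age `v` inside, with the source time `u` fixed;
  -- there the half Laplacian integrates to the increment of the heat flow of `g u`. Its −g cancels
  -- the source, and what remains is the Duhamel integral after a shift.
  have hswap := integral_triangle_swap ht
    (Q := fun v u => 1 / 2 * ∑ i, (√v)⁻¹ * ((√v)⁻¹ * gaussAvg (weightTwo i i) (g u) v y))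
    (M := 1 / 2 * ∑ _i : Fin d, derivBound d κ C (T - t) y) ?_ fun v hv u => ?_
  · have e1 : ∫ τ in t..T, 1 / 2 * ∑ i, duhamelHess T g i i τ y
        = ∫ τ in t..T, ∫ v in (0 : ℝ)..(T - τ),
          1 / 2 * ∑ i, (√v)⁻¹ * ((√v)⁻¹ * gaussAvg (weightTwo i i) (g (τ + v)) v y) := by
      refine intervalIntegral.integral_congr fun τ hτ => ?_
      rw [uIcc_of_le ht] at hτ
      rw [intervalIntegral.integral_const_mul, intervalIntegral.integral_finsetSum fun i _ =>
        h.intervalIntegrable_avg_weightTwo (by linarith [hτ.2]) τ i i y]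
      rfl
    have e2 : ∫ u in t..T, ∫ v in (0 : ℝ)..(u - t),
          1 / 2 * ∑ i, (√v)⁻¹ * ((√v)⁻¹ * gaussAvg (weightTwo i i) (g u) v y)
        = ∫ u in t..T, (gaussAvg (fun _ => 1) (g u) (u - t) y - g u y) := by
      refine intervalIntegral.integral_congr fun u hu => ?_
      rw [uIcc_of_le ht] at hu
      exact h.gaussAvg_sub_eq_integral (by linarith [hu.1]) u y
    have hav : Continuous fun u => gaussAvg (fun _ => 1) (g u) (u - t) y :=
      (h.continuous_avg continuous_const expGrowth_const_one).comp
        (f := fun u : ℝ => (u, u - t, y)) (by fun_prop)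
    rw [intervalIntegral.integral_add (hg.intervalIntegrable _ _) hlap, e1, hswap, e2,
      intervalIntegral.integral_sub (hav.intervalIntegrable _ _) (hg.intervalIntegrable _ _)]
    have e3 := intervalIntegral.integral_comp_add_left (a := 0) (b := T - t)
      (fun u => gaussAvg (fun _ => 1) (g u) (u - t) y) t
    simp only [add_sub_cancel_left, add_zero, add_sub_cancel] at e3
    rw [duhamel, e3]; ring
  · refine ContinuousOn.mul continuousOn_const (continuousOn_finsetSum _ fun i _ => ?_)
    have hs : ContinuousOn (fun p : ℝ × ℝ => (√p.1)⁻¹) {p | 0 < p.1} :=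
      ContinuousOn.inv₀ (by fun_prop) fun p hp => (sqrt_pos.2 hp).ne'
    exact hs.mul (hs.mul ((h.continuous_avg (continuous_weightTwo i i)
      (expGrowth_weightTwo i i)).comp (f := fun p : ℝ × ℝ => (p.2, p.1, y))
        (by fun_prop)).continuousOn)
  · refine (hB v hv u).trans_eq ?_
    rw [← Finset.sum_mul, mul_assoc]

/-- Differentiating g(t + v) under the integral would need a time derivative of the source. In the
form of `duhamel_eq_integral` only the lower limit and a continuous integrand occur, and the lower
limit accounts for the signs. -/
lemma hasDerivAt_duhamel (h : IsSource κ C g)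
    {t T : ℝ} (ht : t < T) (y : Fin d → ℝ) :
    HasDerivAt (fun τ => duhamel T g τ y)
      (-g t y - 1 / 2 * ∑ i, duhamelHess T g i i t y) t := by
  have hg : Continuous fun τ => g τ y := h.cont.comp (f := fun τ => (τ, y)) (by fun_prop)
  have hc : ContinuousOn (fun τ => g τ y + 1 / 2 * ∑ i, duhamelHess T g i i τ y) (Iio T) :=
    hg.continuousOn.add (ContinuousOn.mul continuousOn_const (continuousOn_finsetSum _ fun i _ =>
      (h.continuousOn_duhamelHess T i i).comp (f := fun τ => (τ, y)) (by fun_prop)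
        fun τ hτ => ⟨hτ, mem_univ _⟩))
  have hInt : IntervalIntegrable (fun τ => g τ y + 1 / 2 * ∑ i, duhamelHess T g i i τ y)
      volume t T :=
    (hg.intervalIntegrable _ _).add (h.intervalIntegrable_laplacian ht.le y)
  have key := intervalIntegral.integral_hasDerivAt_left hInt
    (hc.stronglyMeasurableAtFilter isOpen_Iio t ht) (hc.continuousAt (Iio_mem_nhds ht))
  refine (key.congr_deriv (by ring)).congr_of_eventuallyEq ?_
  filter_upwards [Iio_mem_nhds ht] with τ hτ
  exact h.duhamel_eq_integral (le_of_lt hτ) y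

lemma solvesHeat_duhamel (h : IsSource κ C g)
    (T : ℝ) :
    SolvesHeat T g (duhamel T g) (duhamelGrad T g) (duhamelHess T g) where
  cont := h.continuous_duhamel T
  deriv_t _ ht y := h.hasDerivAt_duhamel ht y
  deriv_y _ ht y := h.hasFDerivAt_duhamel ht y
  deriv_yy i _ ht y := h.hasFDerivAt_duhamelGrad ht i y
  cont_y := h.continuousOn_duhamelGrad T
  cont_yy := h.continuousOn_duhamelHess T

end IsSource

end

end RegimeSwitching

end

/-! ### The lognormal transition and its density -/

noncomputable section

namespace RegimeSwitching

open Real Set Filter Topology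

variable {d : ℕ}

/-- The expectation `E[f(Y(v)) | Y(0) = s]`. -/
def transition (ρ : ℝ) (σ : Matrix (Fin d) (Fin d) ℝ) (v : ℝ) (f : (Fin d → ℝ) → ℝ)
    (s : Fin d → ℝ) : ℝ :=
  ∫ w, f (gbm ρ σ s v (√v • w)) ∂stdNormal d

variable {ρ : ℝ} {σ : Matrix (Fin d) (Fin d) ℝ}

lemma gbm_mem_orthant {s : Fin d → ℝ} (hs : s ∈ orthant d) (v : ℝ) (w : Fin d → ℝ) :
    gbm ρ σ s v w ∈ orthant d := fun l => mul_pos (hs l) (exp_pos _)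

@[fun_prop]
lemma continuous_gbm : Continuous fun p : (Fin d → ℝ) × ℝ × (Fin d → ℝ) =>
    gbm ρ σ p.1 p.2.1 p.2.2 := by
  unfold gbm; fun_prop

lemma continuous_comp_gbm {f : (Fin d → ℝ) → ℝ} (hf : ContinuousOn f (orthant d))
    {s : Fin d → ℝ} (hs : s ∈ orthant d) (v a : ℝ) :
    Continuous fun w => f (gbm ρ σ s v (a • w)) :=
  hf.comp_continuous (continuous_gbm.comp (f := fun w => (s, v, a • w)) (by fun_prop))
    fun _ => gbm_mem_orthant hs _ _

/-- N(0, T−t) is the standard normal law scaled by √(T−t); at t = T both sides live on the Dirac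
mass. -/
lemma eta_eq_transition {T t : ℝ} (ht : t ≤ T) {K : (Fin d → ℝ) → ℝ}
    (hK : ContinuousOn K (orthant d)) {s : Fin d → ℝ} (hs : s ∈ orthant d) :
    eta T ρ σ K t s = exp (-ρ * (T - t)) * transition ρ σ (T - t) K s := by
  have hτ : 0 ≤ T - t := by linarith
  unfold eta transition
  rw [integral_const_mul, ← map_stdNormal_smul hτ, integral_map (by fun_prop)]
  have := continuous_comp_gbm (ρ := ρ) (σ := σ) hK hs (T - t) 1
  simp only [one_smul] at this
  exact this.aestronglyMeasurable

/-- With x the price reached by the increment √v w, the centred log-return is √v σw, so the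
quadratic form of (v σσ*)⁻¹ collapses to |w|². The Jacobian (∏ x_l) √v^d |det σ| cancels the
normalisation of the density up to (2π)^{d/2}. -/
lemma abs_det_mul_alpha (hσ : IsUnit σ) {v : ℝ} (hv : 0 < v) {s : Fin d → ℝ}
    (hs : s ∈ orthant d) (w : Fin d → ℝ) :
    |(Matrix.diagonal (gbm ρ σ s v (√v • w)) * (√v • σ)).det|
      * alpha ρ σ (gbm ρ σ s v (√v • w)) s v = heatKernel 1 w := by
  have hdet : σ.det ≠ 0 := ((Matrix.isUnit_iff_isUnit_det σ).1 hσ).ne_zero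
  set x := gbm ρ σ s v (√v • w) with hx
  have hxpos : ∀ l, 0 < x l := gbm_mem_orthant hs v _
  have hprod : 0 < ∏ l, x l := Finset.prod_pos fun l _ => hxpos l
  have hsv := sqrt_pos.2 hv
  have hlog : ∀ l, log (x l / s l) - (ρ - diffusion σ l l / 2) * v = √v * (σ.mulVec w) l := by
    intro l
    rw [hx, gbm, mul_div_cancel_left₀ _ (hs l).ne', log_exp]
    simp only [Pi.smul_apply, smul_eq_mul, Matrix.mulVec, dotProduct, Finset.mul_sum]
    rw [add_sub_cancel_left]
    exact Finset.sum_congr rfl fun j _ => by ring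
  have hinv : (v • diffusion σ)⁻¹ = v⁻¹ • (σ⁻¹.transpose * σ⁻¹) := by
    refine Matrix.inv_eq_right_inv ?_
    rw [Matrix.smul_mul, Matrix.mul_smul, smul_smul, mul_inv_cancel₀ hv.ne', one_smul, diffusion,
      Matrix.mul_assoc, ← Matrix.mul_assoc σ.transpose, ← Matrix.transpose_mul,
      Matrix.nonsing_inv_mul _ hdet.isUnit, Matrix.transpose_one, Matrix.one_mul,
      Matrix.mul_nonsing_inv _ hdet.isUnit]
  have hquad : ∑ l, ∑ l', (v • diffusion σ)⁻¹ l l'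
      * (log (x l / s l) - (ρ - diffusion σ l l / 2) * v)
      * (log (x l' / s l') - (ρ - diffusion σ l' l' / 2) * v) = ∑ l, w l ^ 2 := by
    have h1 : (σ⁻¹.transpose * σ⁻¹).mulVec (σ.mulVec w) = σ⁻¹.transpose.mulVec w := by
      rw [Matrix.mulVec_mulVec, Matrix.mul_assoc, Matrix.nonsing_inv_mul _ hdet.isUnit,
        Matrix.mul_one]
    have h2 : dotProduct (σ.mulVec w) (σ⁻¹.transpose.mulVec w) = ∑ l, w l ^ 2 := by
      rw [Matrix.dotProduct_mulVec, Matrix.vecMul_transpose, Matrix.mulVec_mulVec,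
        Matrix.nonsing_inv_mul _ hdet.isUnit, Matrix.one_mulVec, dotProduct]
      exact Finset.sum_congr rfl fun l _ => (sq _).symm
    rw [← h2, ← h1, dotProduct]
    refine Finset.sum_congr rfl fun l _ => ?_
    change _ = (σ.mulVec w) l * ∑ l', (σ⁻¹.transpose * σ⁻¹) l l' * (σ.mulVec w) l'
    rw [Finset.mul_sum]
    refine Finset.sum_congr rfl fun l' _ => ?_
    rw [hinv, hlog, hlog, Matrix.smul_apply, smul_eq_mul]
    have hvv : v⁻¹ * (√v * √v) = 1 := by rw [mul_self_sqrt hv.le, inv_mul_cancel₀ hv.ne']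
    linear_combination ((σ⁻¹.transpose * σ⁻¹) l l' * (σ.mulVec w) l * (σ.mulVec w) l') * hvv
  have hsqrt : √((2 * π) ^ d * (v • diffusion σ).det) = √(2 * π) ^ d * (√v ^ d * |σ.det|) := by
    rw [Matrix.det_smul, Fintype.card_fin, diffusion, Matrix.det_mul, Matrix.det_transpose,
      sqrt_mul (by positivity), sqrt_mul (by positivity), sqrt_mul_self_eq_abs]
    congr 1
    · rw [← sqrt_sq (by positivity : 0 ≤ √(2 * π) ^ d), ← pow_mul, mul_comm d, pow_mul,
        sq_sqrt (by positivity)]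
    · rw [← sqrt_sq (by positivity : 0 ≤ √v ^ d), ← pow_mul, mul_comm d, pow_mul,
        sq_sqrt hv.le]
  rw [alpha, hquad, hsqrt, Matrix.det_mul, Matrix.det_diagonal, Matrix.det_smul, Fintype.card_fin,
    abs_mul, abs_mul, abs_of_pos hprod, abs_of_pos (pow_pos hsv d), heatKernel]
  have := abs_pos.2 hdet
  have h2 : -(1 / 2) * ∑ l, w l ^ 2 = -(∑ l, w l ^ 2) / (2 * 1) := by ring
  rw [h2, mul_one (2 * π), inv_pow]
  field_simp

/-- Integrals against the lognormal density are expectations. -/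
lemma integral_alpha (hσ : IsUnit σ) {v : ℝ} (hv : 0 < v) {s : Fin d → ℝ}
    (hs : s ∈ orthant d) (f : (Fin d → ℝ) → ℝ) :
    ∫ x in orthant d, f x * alpha ρ σ x s v = transition ρ σ v f s := by
  have hdet : σ.det ≠ 0 := ((Matrix.isUnit_iff_isUnit_det σ).1 hσ).ne_zero
  have hsv := sqrt_pos.2 hv
  let Ψ : (Fin d → ℝ) → (Fin d → ℝ) := fun w => gbm ρ σ s v (√v • w)
  let M : (Fin d → ℝ) → Matrix (Fin d) (Fin d) ℝ := fun w =>
    Matrix.diagonal (gbm ρ σ s v (√v • w)) * (√v • σ)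
  have hderiv : ∀ w, HasFDerivAt Ψ (LinearMap.toContinuousLinearMap (Matrix.toLin' (M w))) w := by
    intro w
    rw [hasFDerivAt_pi']
    intro l
    have h1 : ∀ j, HasFDerivAt (fun w : Fin d → ℝ => σ l j * (√v • w) j)
        ((√v * σ l j) • (ContinuousLinearMap.proj j : (Fin d → ℝ) →L[ℝ] ℝ)) w := fun j => by
      convert! ((ContinuousLinearMap.proj (R := ℝ) (φ := fun _ : Fin d => ℝ) j).hasFDerivAt
        (x := w)).const_mul (√v * σ l j) using 1
      ext w; simp; ring
    have h2 := (((HasFDerivAt.fun_sum fun j (_ : j ∈ Finset.univ) => h1 j).const_add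
      ((ρ - diffusion σ l l / 2) * v)).exp).const_mul (s l)
    convert! h2 using 1
    ext e
    simp [M, Matrix.diagonal_mul, gbm, Matrix.mulVec, dotProduct, Finset.mul_sum]
    refine Finset.sum_congr rfl fun j _ => by ring
  have hinj : InjOn Ψ univ := by
    intro w _ w' _ h
    have h1 : σ.mulVec w = σ.mulVec w' := by
      ext l
      have h2 := congrFun h l
      simp only [Ψ, gbm, mul_right_inj' (hs l).ne', exp_eq_exp, add_right_inj, Pi.smul_apply,
        smul_eq_mul, mul_left_comm _ (√v), ← Finset.mul_sum, mul_right_inj' hsv.ne'] at h2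
      exact h2
    exact Matrix.mulVec_injective_of_isUnit hσ h1
  have himage : Ψ '' univ = orthant d := by
    ext x
    constructor
    · rintro ⟨w, -, rfl⟩
      exact gbm_mem_orthant hs _ _
    · intro hx
      refine ⟨(√v)⁻¹ • σ⁻¹.mulVec fun l => log (x l / s l) - (ρ - diffusion σ l l / 2) * v,
        mem_univ _, ?_⟩
      ext l
      have h1 : ∀ z : Fin d → ℝ, ∑ j, σ l j * σ⁻¹.mulVec z j = z l := fun z => by
        have := Matrix.mulVec_mulVec z σ σ⁻¹
        rw [Matrix.mul_nonsing_inv _ hdet.isUnit, Matrix.one_mulVec] at this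
        exact congrFun this l
      simp only [Ψ, gbm, smul_smul, mul_inv_cancel₀ hsv.ne', one_smul, h1]
      rw [add_sub_cancel, exp_log (div_pos (hx l) (hs l)), mul_div_cancel₀ _ (hs l).ne']
  rw [← himage, integral_image_eq_integral_abs_det_fderiv_smul volume MeasurableSet.univ
    (fun w _ => (hderiv w).hasFDerivWithinAt) hinj, Measure.restrict_univ, transition,
    integral_stdNormal]
  refine integral_congr_ae (Eventually.of_forall fun w => ?_)
  have h1 : (LinearMap.toContinuousLinearMap (Matrix.toLin' (M w))).det = (M w).det := by
    rw [LinearMap.det_toContinuousLinearMap, LinearMap.det_toLin']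
  simp only [h1, smul_eq_mul]
  rw [← abs_det_mul_alpha hσ hv hs w (ρ := ρ)]
  ring

end RegimeSwitching

end

/-! ### Estimates for the integral operator -/

noncomputable section

namespace RegimeSwitching

open Real Set Filter Topology

variable {d k : ℕ} {ρ : ℝ} {σ : Matrix (Fin d) (Fin d) ℝ}

lemma gbm_apply_eq (s : Fin d → ℝ) (v : ℝ) (w : Fin d → ℝ) (l : Fin d) :
    gbm ρ σ s v (√v • w) l
      = s l * exp ((ρ - diffusion σ l l / 2) * v) * exp (∑ j, √v * σ l j * w j) := by
  rw [gbm, exp_add, mul_assoc]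
  congr 3
  exact Finset.sum_congr rfl fun j _ => by simp; ring

lemma integrable_gbm (s : Fin d → ℝ) (v : ℝ) (l : Fin d) :
    Integrable (fun w => gbm ρ σ s v (√v • w) l) (stdNormal d) := by
  simp_rw [gbm_apply_eq]
  exact (integrable_exp_sum_mul _).const_mul _

/-- The discounted price process is a martingale. -/
lemma integral_gbm (s : Fin d → ℝ) {v : ℝ} (hv : 0 ≤ v) (l : Fin d) :
    ∫ w, gbm ρ σ s v (√v • w) l ∂stdNormal d = s l * exp (ρ * v) := by
  simp_rw [gbm_apply_eq]
  rw [integral_const_mul, integral_exp_sum_mul, mul_assoc, ← exp_add]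
  congr 2
  have h : diffusion σ l l = ∑ j, σ l j ^ 2 := by
    simp [diffusion, Matrix.mul_apply, sq]
  -- The exponent of the Gaussian moment generating function is exactly the Itô correction in the
  -- drift, so the two cancel.
  have h2 : ∑ j, (√v * σ l j) ^ 2 / 2 = v * diffusion σ l l / 2 := by
    rw [h, Finset.mul_sum, Finset.sum_div]
    exact Finset.sum_congr rfl fun j _ => by rw [mul_pow, sq_sqrt hv]
  rw [h2]; ring

/-- The weight `1 + ‖s‖₁`. -/
def weight (s : Fin d → ℝ) : ℝ := 1 + ∑ l, |s l|

lemma weight_pos (s : Fin d → ℝ) : 0 < weight s := by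
  have := sum_abs_nonneg s
  unfold weight; linarith

@[fun_prop]
lemma continuous_weight : Continuous (weight : (Fin d → ℝ) → ℝ) := by
  unfold weight; fun_prop

lemma integrable_weight_gbm (s : Fin d → ℝ) (v : ℝ) :
    Integrable (fun w => weight (gbm ρ σ s v (√v • w))) (stdNormal d) :=
  (integrable_const _).add (integrable_finsetSum _ fun l _ => (integrable_gbm s v l).abs)

/-- On the orthant the weight is affine, so the martingale identity computes its mean. The constant
1 does not grow, and ρ ≥ 0 is needed to bound it by e^{ρv}. -/
lemma integral_weight_gbm_le (hρ : 0 ≤ ρ) {s : Fin d → ℝ} (hs : s ∈ orthant d) {v : ℝ}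
    (hv : 0 ≤ v) :
    ∫ w, weight (gbm ρ σ s v (√v • w)) ∂stdNormal d ≤ weight s * exp (ρ * v) := by
  have h1 : ∀ w, weight (gbm ρ σ s v (√v • w)) = 1 + ∑ l, gbm ρ σ s v (√v • w) l := fun w => by
    unfold weight
    congr 1
    exact Finset.sum_congr rfl fun l _ => abs_of_pos (gbm_mem_orthant hs v _ l)
  simp_rw [h1]
  rw [integral_add (integrable_const _) (integrable_finsetSum _ fun l _ => integrable_gbm s v l),
    integral_finsetSum _ fun l _ => integrable_gbm s v l]
  simp_rw [integral_gbm s hv, ← Finset.sum_mul]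
  have h2 : 1 ≤ exp (ρ * v) := one_le_exp (by positivity)
  have h3 : weight s = 1 + ∑ l, s l := by
    unfold weight
    congr 1
    exact Finset.sum_congr rfl fun l _ => abs_of_pos (hs l)
  rw [h3]
  simp only [integral_const, probReal_univ, one_smul]
  linarith

section Transition

variable {f f' : (Fin d → ℝ) → ℝ} {C C' D : ℝ}

lemma integrable_comp_gbm (hf : ContinuousOn f (orthant d))
    (hb : ∀ x ∈ orthant d, |f x| ≤ C * weight x) {s : Fin d → ℝ} (hs : s ∈ orthant d) (v : ℝ) :
    Integrable (fun w => f (gbm ρ σ s v (√v • w))) (stdNormal d) :=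
  ((integrable_weight_gbm s v).const_mul C).mono'
    (continuous_comp_gbm hf hs v _).aestronglyMeasurable
    (Eventually.of_forall fun _ => hb _ (gbm_mem_orthant hs v _))

lemma abs_transition_sub_le (hρ : 0 ≤ ρ) (hf : ContinuousOn f (orthant d))
    (hb : ∀ x ∈ orthant d, |f x| ≤ C * weight x) (hf' : ContinuousOn f' (orthant d))
    (hb' : ∀ x ∈ orthant d, |f' x| ≤ C' * weight x) (hD : 0 ≤ D)
    (h : ∀ x ∈ orthant d, |f x - f' x| ≤ D * weight x)
    {s : Fin d → ℝ} (hs : s ∈ orthant d) {v : ℝ} (hv : 0 ≤ v) :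
    |transition ρ σ v f s - transition ρ σ v f' s| ≤ D * weight s * exp (ρ * v) := by
  unfold transition
  rw [← integral_sub (integrable_comp_gbm hf hb hs v) (integrable_comp_gbm hf' hb' hs v),
    ← norm_eq_abs]
  refine (norm_integral_le_of_norm_le ((integrable_weight_gbm s v).const_mul D)
    (Eventually.of_forall fun w => h _ (gbm_mem_orthant hs v _))).trans ?_
  rw [integral_const_mul, mul_assoc]
  exact mul_le_mul_of_nonneg_left (integral_weight_gbm_le hρ hs hv) hD

lemma abs_transition_le (hρ : 0 ≤ ρ) (hf : ContinuousOn f (orthant d)) (hC : 0 ≤ C)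
    (hb : ∀ x ∈ orthant d, |f x| ≤ C * weight x)
    {s : Fin d → ℝ} (hs : s ∈ orthant d) {v : ℝ} (hv : 0 ≤ v) :
    |transition ρ σ v f s| ≤ C * weight s * exp (ρ * v) := by
  have := abs_transition_sub_le (f' := fun _ => 0) (σ := σ) (C' := 0) hρ hf hb continuousOn_const
    (by simp) hC (by simpa using hb) hs hv
  simpa [transition] using this

/-- Prices are linear in the starting point, so the coordinatewise distance of two prices driven by
the same noise is again a price process, started at |s_l − s'_l|, with known mean. -/
lemma abs_transition_sub_le_of_lipschitz (hf : ContinuousOn f (orthant d))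
    (hb : ∀ x ∈ orthant d, |f x| ≤ C * weight x)
    (h : ∀ x ∈ orthant d, ∀ x' ∈ orthant d, |f x - f x'| ≤ D * ∑ l, |x l - x' l|)
    {s s' : Fin d → ℝ} (hs : s ∈ orthant d) (hs' : s' ∈ orthant d) {v : ℝ} (hv : 0 ≤ v) :
    |transition ρ σ v f s - transition ρ σ v f s'| ≤ D * (∑ l, |s l - s' l|) * exp (ρ * v) := by
  have hI : Integrable (fun w => ∑ l, gbm ρ σ (fun l => |s l - s' l|) v (√v • w) l)
      (stdNormal d) := integrable_finsetSum _ fun l _ => integrable_gbm _ v l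
  unfold transition
  rw [← integral_sub (integrable_comp_gbm hf hb hs v) (integrable_comp_gbm hf hb hs' v),
    ← norm_eq_abs]
  refine (norm_integral_le_of_norm_le (hI.const_mul D) (Eventually.of_forall fun w => ?_)).trans ?_
  · refine (h _ (gbm_mem_orthant hs v _) _ (gbm_mem_orthant hs' v _)).trans_eq ?_
    congr 1
    refine Finset.sum_congr rfl fun l _ => ?_
    simp only [gbm]
    rw [← sub_mul, abs_mul, abs_of_pos (exp_pos _)]
  · rw [integral_const_mul, integral_finsetSum _ fun l _ => integrable_gbm _ v l]
    simp_rw [integral_gbm _ hv]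
    rw [← Finset.sum_mul, mul_assoc]

lemma transition_nonneg (h : ∀ x ∈ orthant d, 0 ≤ f x) {s : Fin d → ℝ} (hs : s ∈ orthant d)
    (v : ℝ) : 0 ≤ transition ρ σ v f s :=
  integral_nonneg fun _ => h _ (gbm_mem_orthant hs v _)

end Transition

section Memory

variable {Λ : Matrix (Fin k) (Fin k) ℝ}

lemma IsRateMatrix.diag_nonpos (hΛ : IsRateMatrix Λ) (i : Fin k) : Λ i i ≤ 0 := by
  have h := hΛ.row_sum i
  rw [← Finset.add_sum_erase _ _ (Finset.mem_univ i)] at h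
  have := Finset.sum_nonneg fun j (hj : j ∈ Finset.univ.erase i) =>
    hΛ.nonneg i j (Finset.ne_of_mem_erase hj).symm
  linarith

lemma IsRateMatrix.sum_erase (hΛ : IsRateMatrix Λ) (i : Fin k) :
    ∑ j ∈ Finset.univ.erase i, Λ i j = |Λ i i| := by
  have h := hΛ.row_sum i
  rw [← Finset.add_sum_erase _ _ (Finset.mem_univ i)] at h
  rw [abs_of_nonpos (hΛ.diag_nonpos i)]
  linarith

lemma integral_mul_exp_neg (a τ : ℝ) :
    ∫ v in (0 : ℝ)..τ, a * exp (-a * v) = 1 - exp (-a * τ) := by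
  have h : ∀ v, HasDerivAt (fun v => -exp (-a * v)) (a * exp (-a * v)) v := fun v => by
    have h0 : HasDerivAt (fun v => -a * v) (-a) v := by
      simpa using (hasDerivAt_id v).const_mul (-a)
    exact h0.exp.neg.congr_deriv (by ring)
  rw [intervalIntegral.integral_eq_sub_of_hasDerivAt (fun v _ => h v)
    ((by fun_prop : Continuous fun v => a * exp (-a * v)).intervalIntegrable _ _)]
  simp; ring

/-- Bound of the difference of two memory integrals. -/
lemma abs_memory_sub_le (hΛ : IsRateMatrix Λ) (i : Fin k) {τ B : ℝ} (hτ : 0 ≤ τ)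
    {X Y : Fin k → ℝ → ℝ}
    (hX : IntervalIntegrable (fun v => exp (-(|Λ i i| + ρ) * v)
      * ∑ j ∈ Finset.univ.erase i, Λ i j * X j v) volume 0 τ)
    (hY : IntervalIntegrable (fun v => exp (-(|Λ i i| + ρ) * v)
      * ∑ j ∈ Finset.univ.erase i, Λ i j * Y j v) volume 0 τ)
    (h : ∀ j, ∀ v ∈ Ioo 0 τ, |X j v - Y j v| ≤ B * exp (ρ * v)) :
    |(∫ v in (0 : ℝ)..τ, exp (-(|Λ i i| + ρ) * v) * ∑ j ∈ Finset.univ.erase i, Λ i j * X j v)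
      - ∫ v in (0 : ℝ)..τ, exp (-(|Λ i i| + ρ) * v) * ∑ j ∈ Finset.univ.erase i, Λ i j * Y j v|
      ≤ B * (1 - exp (-|Λ i i| * τ)) := by
  rw [← intervalIntegral.integral_sub hX hY, ← integral_mul_exp_neg,
    ← intervalIntegral.integral_const_mul, ← norm_eq_abs]
  refine intervalIntegral.norm_integral_le_of_norm_le hτ ?_
    ((by fun_prop : Continuous fun v =>
      B * (|Λ i i| * exp (-|Λ i i| * v))).intervalIntegrable _ _)
  -- The hypothesis excludes v = τ: there t + v = T in the applications, where an element of V is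
  -- not controlled.
  have hne : ∀ᵐ v : ℝ, v ≠ τ := by simp [ae_iff]
  filter_upwards [hne] with v hvτ hv
  have hv' : v ∈ Ioo 0 τ := ⟨hv.1, lt_of_le_of_ne hv.2 hvτ⟩
  rw [← mul_sub, ← Finset.sum_sub_distrib, norm_mul, norm_of_nonneg (exp_pos _).le]
  have h1 : ‖∑ j ∈ Finset.univ.erase i, (Λ i j * X j v - Λ i j * Y j v)‖
      ≤ |Λ i i| * (B * exp (ρ * v)) := by
    rw [← hΛ.sum_erase i, Finset.sum_mul]
    refine (norm_sum_le _ _).trans (Finset.sum_le_sum fun j hj => ?_)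
    have h0 := hΛ.nonneg i j (Finset.ne_of_mem_erase hj).symm
    rw [← mul_sub, norm_mul, norm_of_nonneg h0]
    exact mul_le_mul_of_nonneg_left (h j v hv') h0
  refine (mul_le_mul_of_nonneg_left h1 (exp_pos _).le).trans_eq ?_
  -- The discount e^{−ρv} cancels the growth e^{ρv}, leaving the density λe^{−λv} of the holding
  -- time.
  rw [show -(|Λ i i| + ρ) * v = -|Λ i i| * v + -(ρ * v) by ring, exp_add, exp_neg (ρ * v)]
  have := (exp_pos (ρ * v)).ne'
  field_simp

end Memory

section Operator

variable {T : ℝ} {r : Fin k → ℝ} {σ : Fin k → Matrix (Fin d) (Fin d) ℝ}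
  {Λ : Matrix (Fin k) (Fin k) ℝ} {K : (Fin d → ℝ) → ℝ} {φ ψ : ℝ → (Fin d → ℝ) → Fin k → ℝ}

/-- The integral operator in terms of transition expectations. -/
lemma operatorA_eq (hσ : ∀ i, IsUnit (σ i)) (hK : ContinuousOn K (orthant d)) {t : ℝ}
    (ht : t ≤ T) {s : Fin d → ℝ} (hs : s ∈ orthant d) (i : Fin k) :
    operatorA T r σ Λ K φ t s i
      = exp (-(|Λ i i| + r i) * (T - t)) * transition (r i) (σ i) (T - t) K s
        + ∫ v in (0 : ℝ)..(T - t), exp (-(|Λ i i| + r i) * v)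
          * ∑ j ∈ Finset.univ.erase i, Λ i j
            * transition (r i) (σ i) v (fun x => φ (t + v) x j) s := by
  rw [operatorA, eta_eq_transition ht hK hs, ← mul_assoc, ← exp_add]
  congr 1
  · ring_nf
  · rw [intervalIntegral.integral_of_le (by linarith), intervalIntegral.integral_of_le (by linarith)]
    refine setIntegral_congr_fun measurableSet_Ioc fun v hv => ?_
    simp only [integral_alpha (hσ i) hv.1 hs]

lemma MemV.continuousOn (h : MemV T φ) {u : ℝ} (hu : u ∈ Ioo 0 T) (j : Fin k) :
    ContinuousOn (fun x => φ u x j) (orthant d) :=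
  (h.1 j).comp (f := fun x => (u, x)) (by fun_prop) fun _ hx => ⟨hu, hx⟩

lemma MemV.exists_bound (h : MemV T φ) :
    ∃ C, 0 ≤ C ∧ ∀ u ∈ Ioo 0 T, ∀ x ∈ orthant d, ∀ j, |φ u x j| ≤ C * weight x := by
  obtain ⟨C, hC⟩ := h.2
  refine ⟨max C 0, le_max_right _ _, fun u hu x hx j => (hC u hu x hx j).trans ?_⟩
  exact mul_le_mul_of_nonneg_right (le_max_left _ _) (weight_pos x).le

/-- Measurability in `v` comes from joint continuity in time and noise and the measurability of
partial integrals. The open interval keeps t + v inside (0,T), where continuity and the growth bound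
hold. -/
lemma MemV.intervalIntegrable_transition (h : MemV T φ) {ρ : ℝ} (hρ : 0 ≤ ρ)
    (σ : Matrix (Fin d) (Fin d) ℝ) {t : ℝ} (ht : t ∈ Icc 0 T) {s : Fin d → ℝ}
    (hs : s ∈ orthant d) (j : Fin k) :
    IntervalIntegrable (fun v => transition ρ σ v (fun x => φ (t + v) x j) s)
      volume 0 (T - t) := by
  obtain ⟨C, hC, hb⟩ := h.exists_bound
  have hτ : 0 ≤ T - t := by linarith [ht.2]
  have hmem : ∀ v ∈ Ioo 0 (T - t), t + v ∈ Ioo 0 T := fun v hv =>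
    ⟨by linarith [hv.1, ht.1], by linarith [hv.2]⟩
  rw [intervalIntegrable_iff_integrableOn_Ioo_of_le hτ]
  refine Integrable.mono' (g := fun _ => C * weight s * exp (ρ * (T - t))) (integrable_const _) ?_
    (ae_restrict_of_forall_mem measurableSet_Ioo fun v hv => ?_)
  · have hc : ContinuousOn (fun p : ℝ × (Fin d → ℝ) => φ (t + p.1) (gbm ρ σ s p.1 (√p.1 • p.2)) j)
        (Ioo 0 (T - t) ×ˢ univ) :=
      (h.1 j).comp (f := fun p : ℝ × (Fin d → ℝ) => (t + p.1, gbm ρ σ s p.1 (√p.1 • p.2)))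
        (Continuous.continuousOn ((by fun_prop : Continuous fun p : ℝ × (Fin d → ℝ) =>
          t + p.1).prodMk (continuous_gbm.comp
            (f := fun p : ℝ × (Fin d → ℝ) => (s, p.1, √p.1 • p.2)) (by fun_prop))))
        fun p hp => ⟨hmem _ hp.1, gbm_mem_orthant hs _ _⟩
    have hm := hc.aestronglyMeasurable (μ := volume.prod (stdNormal d))
      (measurableSet_Ioo.prod MeasurableSet.univ)
    rw [← Measure.prod_restrict, Measure.restrict_univ] at hm
    exact hm.integral_prod_right'
  · refine (abs_transition_le hρ (h.continuousOn (hmem v hv) j) hC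
      (fun x hx => hb _ (hmem v hv) x hx j) hs hv.1.le).trans ?_
    have := (weight_pos s).le
    gcongr
    exact hv.2.le

lemma MemV.intervalIntegrable_memory (h : MemV T φ) (hr : ∀ i, 0 ≤ r i) {t : ℝ}
    (ht : t ∈ Icc 0 T) {s : Fin d → ℝ} (hs : s ∈ orthant d) (i : Fin k) :
    IntervalIntegrable (fun v => exp (-(|Λ i i| + r i) * v) * ∑ j ∈ Finset.univ.erase i, Λ i j
      * transition (r i) (σ i) v (fun x => φ (t + v) x j) s) volume 0 (T - t) := by
  refine IntervalIntegrable.continuousOn_mul ?_ (by fun_prop)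
  refine (IntervalIntegrable.sum (f := fun j v => Λ i j
      * transition (r i) (σ i) v (fun x => φ (t + v) x j) s) (Finset.univ.erase i) fun j _ =>
    (h.intervalIntegrable_transition (hr i) (σ i) ht hs j).const_mul _).congr fun v _ => ?_
  simp

/-- The integral operator is Lipschitz in the weighted norm. -/
lemma abs_operatorA_sub_le (hr : ∀ i, 0 ≤ r i) (hσ : ∀ i, IsUnit (σ i)) (hΛ : IsRateMatrix Λ)
    (hK : ContinuousOn K (orthant d)) (hφ : MemV T φ) (hψ : MemV T ψ) {D : ℝ} (hD : 0 ≤ D)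
    (h : ∀ u ∈ Ioo 0 T, ∀ x ∈ orthant d, ∀ j, |φ u x j - ψ u x j| ≤ D * weight x)
    {t : ℝ} (ht : t ∈ Icc 0 T) {s : Fin d → ℝ} (hs : s ∈ orthant d) (i : Fin k) :
    |operatorA T r σ Λ K φ t s i - operatorA T r σ Λ K ψ t s i|
      ≤ D * weight s * (1 - exp (-|Λ i i| * T)) := by
  obtain ⟨C, -, hb⟩ := hφ.exists_bound
  obtain ⟨C', -, hb'⟩ := hψ.exists_bound
  have hmem : ∀ v ∈ Ioo 0 (T - t), t + v ∈ Ioo 0 T := fun v hv =>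
    ⟨by linarith [hv.1, ht.1], by linarith [hv.2]⟩
  rw [operatorA_eq hσ hK ht.2 hs, operatorA_eq hσ hK ht.2 hs, add_sub_add_left_eq_sub]
  refine (abs_memory_sub_le hΛ i (by linarith [ht.2]) (B := D * weight s)
    (X := fun j v => transition (r i) (σ i) v (fun x => φ (t + v) x j) s)
    (Y := fun j v => transition (r i) (σ i) v (fun x => ψ (t + v) x j) s)
    (hφ.intervalIntegrable_memory hr ht hs i) (hψ.intervalIntegrable_memory hr ht hs i)
    fun j v hv => ?_).trans ?_
  · exact abs_transition_sub_le (hr i) (hφ.continuousOn (hmem v hv) j)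
      (fun x hx => hb _ (hmem v hv) x hx j) (hψ.continuousOn (hmem v hv) j)
      (fun x hx => hb' _ (hmem v hv) x hx j) hD (fun x hx => h _ (hmem v hv) x hx j) hs hv.1.le
  · have := (weight_pos s).le
    gcongr _ * (1 - exp ?_)
    rw [neg_mul, neg_mul, neg_le_neg_iff]
    gcongr
    linarith [ht.1]

/-- The integral operator preserves non-negativity. -/
lemma operatorA_nonneg (hσ : ∀ i, IsUnit (σ i)) (hΛ : IsRateMatrix Λ)
    (hK : ContinuousOn K (orthant d)) (hK0 : ∀ x ∈ orthant d, 0 ≤ K x)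
    (h : ∀ u, ∀ x ∈ orthant d, ∀ j, 0 ≤ φ u x j)
    {t : ℝ} (ht : t ∈ Icc 0 T) {s : Fin d → ℝ} (hs : s ∈ orthant d) (i : Fin k) :
    0 ≤ operatorA T r σ Λ K φ t s i := by
  rw [operatorA_eq hσ hK ht.2 hs]
  refine add_nonneg (mul_nonneg (exp_pos _).le (transition_nonneg hK0 hs _))
    (intervalIntegral.integral_nonneg (by linarith [ht.2]) fun v _ =>
      mul_nonneg (exp_pos _).le (Finset.sum_nonneg fun j hj => ?_))
  exact mul_nonneg (hΛ.nonneg i j (Finset.ne_of_mem_erase hj).symm)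
    (transition_nonneg (fun x hx => h _ x hx j) hs _)

/-- The integral operator preserves Lipschitz bounds in the space variable. -/
lemma abs_operatorA_sub_le_of_lipschitz (hr : ∀ i, 0 ≤ r i) (hσ : ∀ i, IsUnit (σ i))
    (hΛ : IsRateMatrix Λ) (hK : ContinuousOn K (orthant d)) {C L : ℝ}
    (hKb : ∀ x ∈ orthant d, |K x| ≤ C * weight x)
    (hKL : ∀ x ∈ orthant d, ∀ x' ∈ orthant d, |K x - K x'| ≤ L * ∑ l, |x l - x' l|)
    (hφ : MemV T φ)
    (h : ∀ u, ∀ x ∈ orthant d, ∀ x' ∈ orthant d, ∀ j,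
      |φ u x j - φ u x' j| ≤ L * ∑ l, |x l - x' l|)
    {t : ℝ} (ht : t ∈ Icc 0 T) {s s' : Fin d → ℝ} (hs : s ∈ orthant d) (hs' : s' ∈ orthant d)
    (i : Fin k) :
    |operatorA T r σ Λ K φ t s i - operatorA T r σ Λ K φ t s' i| ≤ L * ∑ l, |s l - s' l| := by
  obtain ⟨C', -, hb⟩ := hφ.exists_bound
  have hτ : 0 ≤ T - t := by linarith [ht.2]
  have hmem : ∀ v ∈ Ioo 0 (T - t), t + v ∈ Ioo 0 T := fun v hv =>
    ⟨by linarith [hv.1, ht.1], by linarith [hv.2]⟩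
  have h1 := abs_memory_sub_le hΛ i hτ (B := L * ∑ l, |s l - s' l|)
    (X := fun j v => transition (r i) (σ i) v (fun x => φ (t + v) x j) s)
    (Y := fun j v => transition (r i) (σ i) v (fun x => φ (t + v) x j) s')
    (hφ.intervalIntegrable_memory hr ht hs i) (hφ.intervalIntegrable_memory hr ht hs' i)
    fun j v hv => abs_transition_sub_le_of_lipschitz (hφ.continuousOn (hmem v hv) j)
      (fun x hx => hb _ (hmem v hv) x hx j) (fun x hx x' hx' => h _ x hx x' hx' j)
      hs hs' hv.1.le
  have h2 := abs_transition_sub_le_of_lipschitz (ρ := r i) (σ := σ i) hK hKb hKL hs hs' hτ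
  have h3 : |exp (-(|Λ i i| + r i) * (T - t)) * transition (r i) (σ i) (T - t) K s
      - exp (-(|Λ i i| + r i) * (T - t)) * transition (r i) (σ i) (T - t) K s'|
      ≤ L * (∑ l, |s l - s' l|) * exp (-|Λ i i| * (T - t)) := by
    rw [← mul_sub, abs_mul, abs_of_pos (exp_pos _)]
    refine (mul_le_mul_of_nonneg_left h2 (exp_pos _).le).trans_eq ?_
    rw [mul_left_comm, ← exp_add]
    ring_nf
  rw [operatorA_eq hσ hK ht.2 hs, operatorA_eq hσ hK ht.2 hs', add_sub_add_comm]
  -- The two parts carry the probabilities e^{−λτ} of no jump and 1 − e^{−λτ} of a jump. They add up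
  -- to 1, so the Lipschitz constant does not increase.
  refine (abs_add_le _ _).trans ((add_le_add h3 h1).trans_eq ?_)
  ring

end Operator

end RegimeSwitching

end

/-! ### Brownian coordinates -/

noncomputable section

namespace RegimeSwitching

open Real Set Filter Topology

variable {d k : ℕ}

/-- The drift in the coordinates in which the price process is a Brownian motion. -/
def logDrift (ρ : ℝ) (σ : Matrix (Fin d) (Fin d) ℝ) : Fin d → ℝ :=
  σ⁻¹.mulVec fun l => ρ - diffusion σ l l / 2

/-- The Brownian coordinates at time `t` of the price vector `s`. -/
def toLog (ρ : ℝ) (σ : Matrix (Fin d) (Fin d) ℝ) (t : ℝ) (s : Fin d → ℝ) : Fin d → ℝ :=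
  σ⁻¹.mulVec (fun l => log (s l)) - t • logDrift ρ σ

/-- The price vector at time `u` with Brownian coordinates `y`. -/
def ofLog (ρ : ℝ) (σ : Matrix (Fin d) (Fin d) ℝ) (u : ℝ) (y : Fin d → ℝ) : Fin d → ℝ :=
  fun l => exp (∑ j, σ l j * (y j + u * logDrift ρ σ j))

section Coordinates

variable {ρ : ℝ} {σ : Matrix (Fin d) (Fin d) ℝ}

lemma sum_mul_inv_mulVec (hσ : IsUnit σ) (z : Fin d → ℝ) (l : Fin d) :
    ∑ j, σ l j * σ⁻¹.mulVec z j = z l := by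
  have hdet := (Matrix.isUnit_iff_isUnit_det σ).1 hσ
  have := Matrix.mulVec_mulVec z σ σ⁻¹
  rw [Matrix.mul_nonsing_inv _ hdet, Matrix.one_mulVec] at this
  exact congrFun this l

lemma ofLog_mem_orthant (u : ℝ) (y : Fin d → ℝ) : ofLog ρ σ u y ∈ orthant d :=
  fun _ => exp_pos _

@[fun_prop]
lemma continuous_ofLog : Continuous fun p : ℝ × (Fin d → ℝ) => ofLog ρ σ p.1 p.2 := by
  unfold ofLog; fun_prop

/-- The drift is absorbed by the moving coordinates, so the price evolves by adding the increment
`w`; transition expectations become Gaussian averages centred at `toLog`. -/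
lemma gbm_eq_ofLog (hσ : IsUnit σ) {s : Fin d → ℝ} (hs : s ∈ orthant d) (t v : ℝ)
    (w : Fin d → ℝ) : gbm ρ σ s v w = ofLog ρ σ (t + v) (toLog ρ σ t s + w) := by
  ext l
  have h1 := sum_mul_inv_mulVec hσ (fun l => log (s l)) l
  have h2 := sum_mul_inv_mulVec hσ (fun l => ρ - diffusion σ l l / 2) l
  have h3 : ∑ j, σ l j * ((toLog ρ σ t s + w) j + (t + v) * logDrift ρ σ j)
      = log (s l) + ((ρ - diffusion σ l l / 2) * v + ∑ j, σ l j * w j) := by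
    rw [← h1, ← h2, Finset.sum_mul, ← Finset.sum_add_distrib, ← Finset.sum_add_distrib]
    refine Finset.sum_congr rfl fun j _ => ?_
    simp only [toLog, logDrift, Pi.add_apply, Pi.sub_apply, Pi.smul_apply, smul_eq_mul]
    ring
  rw [gbm, ofLog, h3, exp_add (log (s l)), exp_log (hs l)]

lemma ofLog_toLog (hσ : IsUnit σ) {s : Fin d → ℝ} (hs : s ∈ orthant d) (t : ℝ) :
    ofLog ρ σ t (toLog ρ σ t s) = s := by
  have := gbm_eq_ofLog (ρ := ρ) hσ hs t 0 0
  rw [add_zero, add_zero] at this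
  rw [← this]
  ext l; simp [gbm]

/-- For b ≤ a one has e^a − e^b = e^a (1 − e^{b−a}) ≤ e^a (a − b); the sum of exponentials makes the
bound symmetric. -/
lemma abs_exp_sub_exp_le (a b : ℝ) : |exp a - exp b| ≤ |a - b| * (exp a + exp b) := by
  wlog h : b ≤ a generalizing a b
  · rw [abs_sub_comm, abs_sub_comm a, add_comm]; exact this b a (le_of_not_ge h)
  have h1 := add_one_le_exp (b - a)
  have h2 : exp b = exp a * exp (b - a) := by rw [← exp_add]; ring_nf
  rw [abs_of_nonneg (sub_nonneg.2 (exp_le_exp.2 h)), abs_of_nonneg (sub_nonneg.2 h)]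
  nlinarith [exp_pos a, exp_pos b, mul_nonneg (sub_nonneg.2 h) (exp_pos b).le]

/-- Growth and Lipschitz bounds of the price vector in Brownian coordinates. -/
lemma exists_ofLog_bounds (ρ : ℝ) (σ : Matrix (Fin d) (Fin d) ℝ) {T : ℝ} (hT : 0 ≤ T) :
    ∃ κ E : ℝ, 0 ≤ κ ∧ 0 ≤ E ∧ ∀ u ∈ Icc 0 T,
      (∀ y, weight (ofLog ρ σ u y) ≤ E * exp (κ * ∑ l, |y l|)) ∧
      ∀ x y, ∑ l, |ofLog ρ σ u x l - ofLog ρ σ u y l|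
        ≤ E * (∑ l, |x l - y l|) * (exp (κ * ∑ l, |x l|) + exp (κ * ∑ l, |y l|)) := by
  set κ := ∑ l, ∑ j, |σ l j| with hκ
  set B := exp (κ * (T * ∑ j, |logDrift ρ σ j|)) with hB
  have hκ0 : 0 ≤ κ := Finset.sum_nonneg fun _ _ => Finset.sum_nonneg fun _ _ => abs_nonneg _
  have hσκ : ∀ l j, |σ l j| ≤ κ := fun l j =>
    (Finset.single_le_sum (f := fun j => |σ l j|) (fun _ _ => abs_nonneg _)
      (Finset.mem_univ j)).trans (Finset.single_le_sum (f := fun l => ∑ j, |σ l j|)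
        (fun _ _ => Finset.sum_nonneg fun _ _ => abs_nonneg _) (Finset.mem_univ l))
  have hD0 : 0 ≤ T * ∑ j, |logDrift ρ σ j| := mul_nonneg hT (sum_abs_nonneg _)
  have hB1 : 1 ≤ B := one_le_exp (by positivity)
  have hlin : ∀ l (z : Fin d → ℝ), |∑ j, σ l j * z j| ≤ κ * ∑ j, |z j| := fun l z => by
    rw [Finset.mul_sum]
    refine (Finset.abs_sum_le_sum_abs _ _).trans (Finset.sum_le_sum fun j _ => ?_)
    rw [abs_mul]
    exact mul_le_mul_of_nonneg_right (hσκ l j) (abs_nonneg _)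
  have hexp : ∀ u ∈ Icc 0 T, ∀ y l, ofLog ρ σ u y l ≤ B * exp (κ * ∑ l, |y l|) := by
    intro u hu y l
    rw [ofLog, hB, ← exp_add, exp_le_exp, ← mul_add]
    refine (le_abs_self _).trans ((hlin l fun j => y j + u * logDrift ρ σ j).trans ?_)
    gcongr
    rw [add_comm, Finset.mul_sum, ← Finset.sum_add_distrib]
    refine Finset.sum_le_sum fun j _ => (abs_add_le _ _).trans ?_
    rw [abs_mul, abs_of_nonneg hu.1]
    gcongr
    exact hu.2
  -- The first summand serves the growth bound, the second the Lipschitz bound.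
  refine ⟨κ, B * (1 + d) + d * κ * B, hκ0, by positivity, fun u hu => ⟨fun y => ?_, fun x y => ?_⟩⟩
  · have h1 : 1 ≤ exp (κ * ∑ l, |y l|) := one_le_exp (mul_nonneg hκ0 (sum_abs_nonneg y))
    have h2 : ∑ l, |ofLog ρ σ u y l| ≤ ∑ _l : Fin d, B * exp (κ * ∑ l, |y l|) :=
      Finset.sum_le_sum fun l _ => by
        rw [abs_of_pos (ofLog_mem_orthant u y l)]; exact hexp u hu y l
    rw [Finset.sum_const, Finset.card_univ, Fintype.card_fin, nsmul_eq_mul] at h2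
    have h3 : 1 ≤ B * exp (κ * ∑ l, |y l|) := by nlinarith
    have h4 : 0 ≤ d * κ * B * exp (κ * ∑ l, |y l|) := by positivity
    unfold weight
    linarith
  · have h1 : ∀ l, |ofLog ρ σ u x l - ofLog ρ σ u y l| ≤ κ * (∑ l, |x l - y l|)
        * (B * exp (κ * ∑ l, |x l|) + B * exp (κ * ∑ l, |y l|)) := fun l => by
      refine (abs_exp_sub_exp_le _ _).trans ?_
      have h2 : ∑ j, σ l j * (x j + u * logDrift ρ σ j) - ∑ j, σ l j * (y j + u * logDrift ρ σ j)
          = ∑ j, σ l j * (x j - y j) := by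
        rw [← Finset.sum_sub_distrib]
        exact Finset.sum_congr rfl fun j _ => by ring
      rw [h2]
      refine mul_le_mul (hlin l fun j => x j - y j) (add_le_add (hexp u hu x l) (hexp u hu y l))
        (by positivity) (mul_nonneg hκ0 (Finset.sum_nonneg fun _ _ => abs_nonneg _))
    refine (Finset.sum_le_sum fun l _ => h1 l).trans ?_
    rw [Finset.sum_const, Finset.card_univ, Fintype.card_fin, nsmul_eq_mul]
    have h5 : 0 ≤ (∑ l, |x l - y l|) := Finset.sum_nonneg fun _ _ => abs_nonneg _
    have h6 : 0 ≤ B * (1 + d) * (∑ l, |x l - y l|)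
        * (exp (κ * ∑ l, |x l|) + exp (κ * ∑ l, |y l|)) := by positivity
    linarith

end Coordinates

/-- Projection of the time variable onto `[0, T]`. -/
def clamp (T u : ℝ) : ℝ := max 0 (min u T)

@[fun_prop]
lemma continuous_clamp (T : ℝ) : Continuous (clamp T) := by
  unfold clamp; fun_prop

lemma clamp_mem {T : ℝ} (hT : 0 ≤ T) (u : ℝ) : clamp T u ∈ Icc 0 T :=
  ⟨le_max_left _ _, max_le hT (min_le_right _ _)⟩

lemma clamp_of_mem {T u : ℝ} (hu : u ∈ Icc 0 T) : clamp T u = u := by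
  rw [clamp, min_eq_left hu.2, max_eq_right hu.1]

/-- Continuity up to the end points, with a bound in the weighted norm. -/
structure IsAdmissible (T C : ℝ) (φ : ℝ → (Fin d → ℝ) → Fin k → ℝ) : Prop where
  cont : ∀ j, ContinuousOn (fun p : ℝ × (Fin d → ℝ) => φ p.1 p.2 j) (Icc 0 T ×ˢ orthant d)
  bound : ∀ u ∈ Icc 0 T, ∀ x ∈ orthant d, ∀ j, |φ u x j| ≤ C * weight x

lemma IsAdmissible.memV {T C : ℝ} {φ : ℝ → (Fin d → ℝ) → Fin k → ℝ} (h : IsAdmissible T C φ) :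
    MemV T φ :=
  ⟨fun i => (h.cont i).mono (prod_mono Ioo_subset_Icc_self le_rfl),
    C, fun t ht s hs i => h.bound t (Ioo_subset_Icc_self ht) s hs i⟩

lemma IsAdmissible.continuousOn {T C : ℝ} {φ : ℝ → (Fin d → ℝ) → Fin k → ℝ}
    (h : IsAdmissible T C φ) {u : ℝ} (hu : u ∈ Icc 0 T) (j : Fin k) :
    ContinuousOn (fun x => φ u x j) (orthant d) :=
  (h.cont j).comp (f := fun x => (u, x)) (by fun_prop) fun _ hx => ⟨hu, hx⟩

section Representation

variable {T : ℝ} {r : Fin k → ℝ} {σ : Fin k → Matrix (Fin d) (Fin d) ℝ}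
  {Λ : Matrix (Fin k) (Fin k) ℝ} {K : (Fin d → ℝ) → ℝ} {φ : ℝ → (Fin d → ℝ) → Fin k → ℝ}

/-- The discounted inflow from the other regimes in Brownian coordinates. -/
def source (T : ℝ) (r : Fin k → ℝ) (σ : Fin k → Matrix (Fin d) (Fin d) ℝ)
    (Λ : Matrix (Fin k) (Fin k) ℝ) (φ : ℝ → (Fin d → ℝ) → Fin k → ℝ) (i : Fin k)
    (u : ℝ) (y : Fin d → ℝ) : ℝ :=
  exp (-(|Λ i i| + r i) * clamp T u) * ∑ j ∈ Finset.univ.erase i,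
    Λ i j * φ (clamp T u) (ofLog (r i) (σ i) (clamp T u) y) j

/-- The discounted payoff in Brownian coordinates. -/
def terminal (T : ℝ) (r : Fin k → ℝ) (σ : Fin k → Matrix (Fin d) (Fin d) ℝ)
    (Λ : Matrix (Fin k) (Fin k) ℝ) (K : (Fin d → ℝ) → ℝ) (i : Fin k) (y : Fin d → ℝ) : ℝ :=
  exp (-(|Λ i i| + r i) * T) * K (ofLog (r i) (σ i) T y)

lemma continuous_terminal (hK : ContinuousOn K (orthant d)) (i : Fin k) :
    Continuous (terminal T r σ Λ K i) := by
  refine continuous_const.mul (hK.comp_continuous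
    (continuous_ofLog.comp (f := fun y => (T, y)) (by fun_prop)) fun _ => ofLog_mem_orthant _ _)

/-- Clamping extends data on [0,T] continuously to all times, as `IsGrowing` requires. For t in
[0,T] the Duhamel integral only samples times in [0,T], so the extension does not affect it. -/
lemma continuous_source (hT : 0 ≤ T) {C : ℝ} (hφ : IsAdmissible T C φ) (i : Fin k) :
    Continuous (Function.uncurry (source T r σ Λ φ i)) := by
  refine Continuous.mul (by fun_prop) (continuous_finsetSum _ fun j _ => continuous_const.mul ?_)
  refine (hφ.cont j).comp_continuous (f := fun p : ℝ × (Fin d → ℝ) =>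
    (clamp T p.1, ofLog (r i) (σ i) (clamp T p.1) p.2)) ?_
    fun p => ⟨clamp_mem hT _, ofLog_mem_orthant _ _⟩
  exact (by fun_prop : Continuous fun p : ℝ × (Fin d → ℝ) => clamp T p.1).prodMk
    (continuous_ofLog.comp (f := fun p : ℝ × (Fin d → ℝ) => (clamp T p.1, p.2)) (by fun_prop))

lemma exists_expGrowth_terminal (hT : 0 ≤ T) {C : ℝ} (hC : 0 ≤ C)
    (hKb : ∀ x ∈ orthant d, |K x| ≤ C * weight x) (i : Fin k) :
    ∃ κ C', 0 ≤ κ ∧ ExpGrowth κ C' (terminal T r σ Λ K i) := by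
  obtain ⟨κ, E, hκ, hE, h⟩ := exists_ofLog_bounds (r i) (σ i) hT
  refine ⟨κ, exp (-(|Λ i i| + r i) * T) * (C * E), hκ, fun y => ?_⟩
  rw [terminal, abs_mul, abs_of_pos (exp_pos _), mul_assoc]
  gcongr
  refine (hKb _ (ofLog_mem_orthant _ _)).trans ?_
  rw [mul_assoc]
  gcongr
  exact (h T ⟨hT, le_rfl⟩).1 y

/-- Both conclusions share their constants, with C + L in place of C or L. The Lipschitz hypothesis
is confined to the second, so the first is available for arbitrary Picard iterates. -/
lemma exists_isSource (hT : 0 ≤ T) (hr : ∀ i, 0 ≤ r i) {C L : ℝ} (hC : 0 ≤ C) (hL : 0 ≤ L)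
    (hφ : IsAdmissible T C φ) (i : Fin k) :
    ∃ κ C', IsGrowing κ C' (source T r σ Λ φ i) ∧
      ((∀ u ∈ Icc 0 T, ∀ x ∈ orthant d, ∀ x' ∈ orthant d, ∀ j,
        |φ u x j - φ u x' j| ≤ L * ∑ l, |x l - x' l|) → IsSource κ C' (source T r σ Λ φ i)) := by
  obtain ⟨κ, E, hκ, hE, h⟩ := exists_ofLog_bounds (r i) (σ i) hT
  set R := ∑ j ∈ Finset.univ.erase i, |Λ i j| with hR
  have hR0 : 0 ≤ R := Finset.sum_nonneg fun _ _ => abs_nonneg _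
  have hexp : ∀ u, exp (-(|Λ i i| + r i) * clamp T u) ≤ 1 := fun u => by
    rw [exp_le_one_iff, neg_mul, neg_nonpos]
    exact mul_nonneg (add_nonneg (abs_nonneg _) (hr i)) (clamp_mem hT u).1
  have hg : IsGrowing κ (R * ((C + L) * E)) (source T r σ Λ φ i) := by
    refine ⟨hκ, continuous_source hT hφ i, fun u y => ?_⟩
    rw [source, abs_mul, abs_of_pos (exp_pos _)]
    refine (mul_le_of_le_one_left (abs_nonneg _) (hexp u)).trans ?_
    rw [hR, mul_assoc, Finset.sum_mul]
    refine (Finset.abs_sum_le_sum_abs _ _).trans (Finset.sum_le_sum fun j _ => ?_)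
    rw [abs_mul]
    gcongr
    refine (hφ.bound _ (clamp_mem hT u) _ (ofLog_mem_orthant _ _) j).trans ?_
    rw [mul_assoc]
    refine mul_le_mul (by linarith) ((h _ (clamp_mem hT u)).1 y) (weight_pos _).le (by positivity)
  refine ⟨κ, _, hg, fun hlip => ⟨hg, fun u x y => ?_⟩⟩
  have h5 : 0 ≤ (∑ l, |x l - y l|) := Finset.sum_nonneg fun _ _ => abs_nonneg _
  rw [source, source, ← mul_sub, ← Finset.sum_sub_distrib, abs_mul, abs_of_pos (exp_pos _)]
  refine (mul_le_of_le_one_left (abs_nonneg _) (hexp u)).trans ?_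
  rw [hR, mul_assoc, mul_assoc, Finset.sum_mul]
  refine (Finset.abs_sum_le_sum_abs _ _).trans (Finset.sum_le_sum fun j _ => ?_)
  rw [← mul_sub, abs_mul]
  gcongr
  refine (hlip _ (clamp_mem hT u) _ (ofLog_mem_orthant _ _) _ (ofLog_mem_orthant _ _) j).trans ?_
  rw [mul_assoc]
  refine mul_le_mul (by linarith) ?_ (Finset.sum_nonneg fun _ _ => abs_nonneg _) (by positivity)
  rw [← mul_assoc]
  exact (h _ (clamp_mem hT u)).2 x y

/-- The integral operator as a solution of the heat equation in Brownian coordinates. -/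
lemma operatorA_eq_heat (hσ : ∀ i, IsUnit (σ i)) (hK : ContinuousOn K (orthant d))
    {C : ℝ} (hφ : IsAdmissible T C φ) {t : ℝ} (ht : t ∈ Icc 0 T) {s : Fin d → ℝ}
    (hs : s ∈ orthant d) (i : Fin k) :
    operatorA T r σ Λ K φ t s i = exp ((|Λ i i| + r i) * t)
      * (gaussAvg (fun _ => 1) (terminal T r σ Λ K i) (T - t) (toLog (r i) (σ i) t s)
        + duhamel T (source T r σ Λ φ i) t (toLog (r i) (σ i) t s)) := by
  rw [operatorA_eq hσ hK ht.2 hs, mul_add]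
  congr 1
  · simp only [gaussAvg, terminal, transition, mul_one]
    rw [integral_const_mul, ← mul_assoc, ← exp_add]
    congr 1
    · ring_nf
    · refine integral_congr_ae (Eventually.of_forall fun w => ?_)
      dsimp only
      rw [gbm_eq_ofLog (hσ i) hs t, add_sub_cancel]
  · rw [duhamel, ← intervalIntegral.integral_const_mul]
    refine intervalIntegral.integral_congr fun v hv => ?_
    rw [uIcc_of_le (by linarith [ht.2])] at hv
    have hmem : t + v ∈ Icc 0 T := ⟨by linarith [ht.1, hv.1], by linarith [hv.2]⟩
    have hInt : ∀ j, Integrable (fun w => φ (t + v) (gbm (r i) (σ i) s v (√v • w)) j)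
        (stdNormal d) := fun j =>
      integrable_comp_gbm (hφ.continuousOn hmem j) (fun x hx => hφ.bound _ hmem x hx j) hs v
    simp only [gaussAvg, source, clamp_of_mem hmem, mul_one, ← gbm_eq_ofLog (hσ i) hs t v]
    rw [integral_const_mul, integral_finsetSum _ fun j _ => (hInt j).const_mul _, ← mul_assoc,
      ← exp_add]
    congr 1
    · ring_nf
    · exact Finset.sum_congr rfl fun j _ => by rw [integral_const_mul, transition]

end Representation

end RegimeSwitching

end

/-! ### Contraction, uniqueness and existence -/

noncomputable section

namespace RegimeSwitching

open Real Set Filter Topology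

variable {d k : ℕ}

open scoped BoundedContinuousFunction

/-- The metric on `Fin d → ℝ` is the supremum metric, which the ℓ¹ distance dominates; the ℓ¹ form
is the one that the martingale identity propagates. -/
lemma sum_abs_sub_le_of_lipschitz {K : (Fin d → ℝ) → ℝ} {L : NNReal}
    (hK : LipschitzOnWith L K (orthant d)) :
    ∀ x ∈ orthant d, ∀ x' ∈ orthant d, |K x - K x'| ≤ L * ∑ l, |x l - x' l| := by
  intro x hx x' hx'
  have h := hK.dist_le_mul x hx x' hx'
  rw [Real.dist_eq] at h
  refine h.trans (mul_le_mul_of_nonneg_left ?_ L.2)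
  refine (dist_pi_le_iff (Finset.sum_nonneg fun _ _ => abs_nonneg _)).2 fun l => ?_
  rw [Real.dist_eq]
  exact abs_le_sum_abs (fun l => x l - x' l) l

lemma exists_abs_le_weight {K : (Fin d → ℝ) → ℝ} {L : ℝ} (hL : 0 ≤ L)
    (hK : ∀ x ∈ orthant d, ∀ x' ∈ orthant d, |K x - K x'| ≤ L * ∑ l, |x l - x' l|) :
    ∃ C, 0 ≤ C ∧ ∀ x ∈ orthant d, |K x| ≤ C * weight x := by
  -- The reference point is (1,…,1) because the origin is outside the orthant.
  refine ⟨|K 1| + L * (d + 1), by positivity, fun x hx => ?_⟩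
  have h1 := hK x hx 1 fun _ => one_pos
  have h2 : ∑ l, |x l - (1 : Fin d → ℝ) l| ≤ ∑ l, |x l| + d := by
    calc ∑ l, |x l - (1 : Fin d → ℝ) l| ≤ ∑ l, (|x l| + 1) :=
          Finset.sum_le_sum fun l _ => (abs_sub _ _).trans (by simp)
      _ = _ := by simp [Finset.sum_add_distrib]
  have h3 : |K x| ≤ |K x - K 1| + |K 1| := by
    simpa using abs_add_le (K x - K 1) (K 1)
  have h4 := mul_le_mul_of_nonneg_left h2 hL
  have h5 := sum_abs_nonneg x
  unfold weight
  nlinarith [abs_nonneg (K 1), mul_nonneg hL h5, mul_nonneg (abs_nonneg (K 1)) h5,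
    mul_nonneg (mul_nonneg hL (Nat.cast_nonneg (α := ℝ) d)) h5]

section

variable {T : ℝ} {r : Fin k → ℝ} {σ : Fin k → Matrix (Fin d) (Fin d) ℝ}
  {Λ : Matrix (Fin k) (Fin k) ℝ} {K : (Fin d → ℝ) → ℝ} {φ ψ : ℝ → (Fin d → ℝ) → Fin k → ℝ}

lemma continuousOn_toLog (ρ : ℝ) (σ : Matrix (Fin d) (Fin d) ℝ) :
    ContinuousOn (fun p : ℝ × (Fin d → ℝ) => toLog ρ σ p.1 p.2) (univ ×ˢ orthant d) := by
  unfold toLog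
  refine ContinuousOn.sub ?_ (by fun_prop)
  refine (Continuous.matrix_mulVec continuous_const continuous_id).comp_continuousOn
    (continuousOn_pi.2 fun l => ContinuousOn.log (by fun_prop) fun p hp => (hp.2 l).ne')

/-- The integral operator produces functions that are continuous up to the end points. -/
lemma continuousOn_operatorA (hT : 0 ≤ T) (hr : ∀ i, 0 ≤ r i) (hσ : ∀ i, IsUnit (σ i))
    (hK : ContinuousOn K (orthant d)) {C C' : ℝ} (hC : 0 ≤ C) (hC' : 0 ≤ C')
    (hKb : ∀ x ∈ orthant d, |K x| ≤ C' * weight x) (hφ : IsAdmissible T C φ) (i : Fin k) :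
    ContinuousOn (fun p : ℝ × (Fin d → ℝ) => operatorA T r σ Λ K φ p.1 p.2 i)
      (Icc 0 T ×ˢ orthant d) := by
  -- Only the growth half is used, so 0 is taken as the Lipschitz constant.
  obtain ⟨κ, B, hg, -⟩ := exists_isSource (σ := σ) (Λ := Λ) hT hr hC le_rfl hφ i
  obtain ⟨κ', B', hκ', hk⟩ := exists_expGrowth_terminal (r := r) (σ := σ) (Λ := Λ) hT hC' hKb i
  have h1 : Continuous fun p : ℝ × (Fin d → ℝ) =>
      gaussAvg (fun _ => 1) (terminal T r σ Λ K i) (T - p.1) p.2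
        + duhamel T (source T r σ Λ φ i) p.1 p.2 :=
    (solvesHeat_gaussAvg hκ' (continuous_terminal hK i) hk T).cont.add (hg.continuous_duhamel T)
  have h2 : ContinuousOn (fun p : ℝ × (Fin d → ℝ) => (p.1, toLog (r i) (σ i) p.1 p.2))
      (Icc 0 T ×ˢ orthant d) :=
    continuousOn_fst.prodMk ((continuousOn_toLog _ _).mono (prod_mono (subset_univ _) le_rfl))
  refine ContinuousOn.congr (ContinuousOn.mul (f := fun p : ℝ × (Fin d → ℝ) =>
    exp ((|Λ i i| + r i) * p.1)) (by fun_prop) (h1.comp_continuousOn h2)) ?_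
  rintro ⟨t, s⟩ ⟨ht, hs⟩
  exact operatorA_eq_heat hσ hK hφ ht hs i

/-- Comparison with φ = 0, for which only the discounted payoff remains. -/
lemma abs_operatorA_le (hr : ∀ i, 0 ≤ r i) (hσ : ∀ i, IsUnit (σ i)) (hΛ : IsRateMatrix Λ)
    (hK : ContinuousOn K (orthant d)) {C C' : ℝ} (hC : 0 ≤ C) (hC' : 0 ≤ C')
    (hKb : ∀ x ∈ orthant d, |K x| ≤ C' * weight x) (hφ : IsAdmissible T C φ) {t : ℝ}
    (ht : t ∈ Icc 0 T) {s : Fin d → ℝ} (hs : s ∈ orthant d) (i : Fin k) :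
    |operatorA T r σ Λ K φ t s i| ≤ (C' + C) * weight s := by
  have hτ : 0 ≤ T - t := by linarith [ht.2]
  have hw := (weight_pos s).le
  have h0 : MemV T (fun (_ : ℝ) (_ : Fin d → ℝ) (_ : Fin k) => (0 : ℝ)) :=
    ⟨fun _ => continuousOn_const, 0, by simp⟩
  have h1 := abs_operatorA_sub_le hr hσ hΛ hK hφ.memV h0 hC
    (fun u hu x hx j => by simpa using hφ.bound u (Ioo_subset_Icc_self hu) x hx j) ht hs i
  have h2 : |operatorA T r σ Λ K (fun _ _ _ => 0) t s i| ≤ C' * weight s := by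
    rw [operatorA_eq hσ hK ht.2 hs]
    have h3 := abs_transition_le (σ := σ i) (hr i) hK hC' hKb hs hτ
    simp only [transition, integral_zero, mul_zero, Finset.sum_const_zero,
      intervalIntegral.integral_zero, add_zero]
    rw [abs_mul, abs_of_pos (exp_pos _)]
    refine (mul_le_mul_of_nonneg_left h3 (exp_pos _).le).trans ?_
    rw [mul_left_comm, ← exp_add]
    refine mul_le_of_le_one_right (by positivity) (exp_le_one_iff.2 ?_)
    nlinarith [abs_nonneg (Λ i i), mul_nonneg (abs_nonneg (Λ i i)) hτ]
  have h4 : C * weight s * (1 - exp (-|Λ i i| * T)) ≤ C * weight s :=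
    mul_le_of_le_one_right (by positivity) (by linarith [exp_pos (-|Λ i i| * T)])
  have h5 := abs_add_le (operatorA T r σ Λ K φ t s i - operatorA T r σ Λ K (fun _ _ _ => 0) t s i)
    (operatorA T r σ Λ K (fun _ _ _ => 0) t s i)
  rw [sub_add_cancel] at h5
  linarith

/-- A common contraction factor for all regimes. -/
def contractionFactor (T : ℝ) (Λ : Matrix (Fin k) (Fin k) ℝ) : ℝ :=
  1 - exp (-(∑ i, |Λ i i|) * T)

lemma contractionFactor_nonneg (hT : 0 ≤ T) (Λ : Matrix (Fin k) (Fin k) ℝ) :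
    0 ≤ contractionFactor T Λ := by
  rw [contractionFactor, sub_nonneg, exp_le_one_iff, neg_mul, neg_nonpos]
  exact mul_nonneg (Finset.sum_nonneg fun _ _ => abs_nonneg _) hT

lemma contractionFactor_lt_one (T : ℝ) (Λ : Matrix (Fin k) (Fin k) ℝ) :
    contractionFactor T Λ < 1 := by
  rw [contractionFactor]; linarith [exp_pos (-(∑ i, |Λ i i|) * T)]

lemma one_sub_exp_le_contractionFactor (hT : 0 ≤ T) (Λ : Matrix (Fin k) (Fin k) ℝ) (i : Fin k) :
    1 - exp (-|Λ i i| * T) ≤ contractionFactor T Λ := by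
  rw [contractionFactor]
  have h : |Λ i i| ≤ ∑ i, |Λ i i| :=
    Finset.single_le_sum (f := fun i => |Λ i i|) (fun _ _ => abs_nonneg _) (Finset.mem_univ i)
  gcongr

/-- Uniqueness for the integral equation. -/
lemma SolvesIE.eq_of_solvesIE (hT : 0 ≤ T) (hr : ∀ i, 0 ≤ r i) (hσ : ∀ i, IsUnit (σ i))
    (hΛ : IsRateMatrix Λ) (hK : ContinuousOn K (orthant d)) (hφ : SolvesIE T r σ Λ K φ)
    (hψ : SolvesIE T r σ Λ K ψ) :
    ∀ t ∈ Icc 0 T, ∀ s ∈ orthant d, ∀ i, φ t s i = ψ t s i := by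
  obtain ⟨C, hC, hb⟩ := hφ.1.exists_bound
  obtain ⟨C', hC', hb'⟩ := hψ.1.exists_bound
  set q := contractionFactor T Λ
  have hq0 : 0 ≤ q := contractionFactor_nonneg hT Λ
  have hstep : ∀ D, 0 ≤ D →
      (∀ u ∈ Ioo 0 T, ∀ x ∈ orthant d, ∀ j, |φ u x j - ψ u x j| ≤ D * weight x) →
      ∀ t ∈ Icc 0 T, ∀ s ∈ orthant d, ∀ i, |φ t s i - ψ t s i| ≤ q * D * weight s := by
    intro D hD h t ht s hs i
    rw [hφ.2 t ht s hs i, hψ.2 t ht s hs i]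
    refine (abs_operatorA_sub_le hr hσ hΛ hK hφ.1 hψ.1 hD h ht hs i).trans ?_
    have h1 := one_sub_exp_le_contractionFactor hT Λ i
    have h2 : 0 ≤ D * weight s := mul_nonneg hD (weight_pos s).le
    nlinarith [mul_le_mul_of_nonneg_left h1 h2]
  -- Iterating the contraction estimate on the two given solutions makes their difference decay
  -- geometrically; completeness of V plays no role.
  have hiter : ∀ n : ℕ, ∀ t ∈ Icc 0 T, ∀ s ∈ orthant d, ∀ i,
      |φ t s i - ψ t s i| ≤ q ^ (n + 1) * (C + C') * weight s := by
    intro n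
    induction n with
    | zero =>
      simp only [zero_add, pow_one]
      refine hstep _ (by positivity) fun u hu x hx j => (abs_sub _ _).trans ?_
      linarith [hb u hu x hx j, hb' u hu x hx j]
    | succ n ih =>
      intro t ht s hs i
      refine (hstep (q ^ (n + 1) * (C + C')) (by positivity)
        (fun u hu x hx j => ih u (Ioo_subset_Icc_self hu) x hx j) t ht s hs i).trans_eq ?_
      ring
  intro t ht s hs i
  have hlim : Tendsto (fun n : ℕ => q ^ (n + 1) * (C + C') * weight s) atTop (𝓝 0) := by
    have := ((tendsto_pow_atTop_nhds_zero_of_lt_one hq0 (contractionFactor_lt_one T Λ)).comp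
      (tendsto_add_atTop_nat 1)).mul_const ((C + C') * weight s)
    simpa [Function.comp_def, mul_assoc] using this
  have h0 : |φ t s i - ψ t s i| ≤ 0 :=
    ge_of_tendsto' hlim fun n => hiter n t ht s hs i
  exact sub_eq_zero.1 (abs_nonpos_iff.1 h0)

/-- The function encoded by a family of bounded functions of time and log-prices. -/
def unpack (hT : 0 ≤ T) (ψ : Fin k → (Icc (0 : ℝ) T × (Fin d → ℝ)) →ᵇ ℝ) (t : ℝ)
    (s : Fin d → ℝ) (i : Fin k) : ℝ :=
  ψ i (projIcc 0 T hT t, fun l => log (s l)) * weight s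

lemma isAdmissible_unpack (hT : 0 ≤ T) (ψ : Fin k → (Icc (0 : ℝ) T × (Fin d → ℝ)) →ᵇ ℝ) :
    IsAdmissible T ‖ψ‖ (unpack hT ψ) := by
  refine ⟨fun j => ?_, fun u _ x _ j => ?_⟩
  · refine ContinuousOn.mul ((ψ j).continuous.comp_continuousOn ?_)
      (continuous_weight.comp continuous_snd).continuousOn
    refine (continuous_projIcc.comp continuous_fst).continuousOn.prodMk
      (continuousOn_pi.2 fun l => ContinuousOn.log (by fun_prop) fun p hp => (hp.2 l).ne')
  · rw [unpack, abs_mul, abs_of_pos (weight_pos x)]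
    exact mul_le_mul_of_nonneg_right (((ψ j).norm_coe_le_norm _).trans (norm_le_pi_norm ψ j))
      (weight_pos x).le

lemma exp_mem_orthant (y : Fin d → ℝ) : (fun l => exp (y l)) ∈ orthant d := fun _ => exp_pos _

/-- Existence for the integral equation, with a non-negative solution that is Lipschitz in the
space variable and continuous up to the end points. -/
lemma exists_solution (hT : 0 ≤ T) (hr : ∀ i, 0 ≤ r i) (hσ : ∀ i, IsUnit (σ i))
    (hΛ : IsRateMatrix Λ) (hK0 : ∀ x ∈ orthant d, 0 ≤ K x) {L : NNReal}
    (hKL : LipschitzOnWith L K (orthant d)) :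
    ∃ φ : ℝ → (Fin d → ℝ) → Fin k → ℝ, (∃ C, 0 ≤ C ∧ IsAdmissible T C φ) ∧
      (∀ u, ∀ x ∈ orthant d, ∀ j, 0 ≤ φ u x j) ∧
      (∀ u, ∀ x ∈ orthant d, ∀ x' ∈ orthant d, ∀ j,
        |φ u x j - φ u x' j| ≤ L * ∑ l, |x l - x' l|) ∧
      SolvesIE T r σ Λ K φ := by
  have hK := hKL.continuousOn
  have hKL' := sum_abs_sub_le_of_lipschitz hKL
  obtain ⟨CK, hCK, hKb⟩ := exists_abs_le_weight L.2 hKL'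
  let W := Fin k → (Icc (0 : ℝ) T × (Fin d → ℝ)) →ᵇ ℝ
  -- Divided by the weight and written in log-prices, the operator acts on bounded continuous
  -- functions on [0,T] × ℝ^d, a complete space for Banach's theorem.
  have hexists : ∀ (ψ : W) (i : Fin k), ∃ b : (Icc (0 : ℝ) T × (Fin d → ℝ)) →ᵇ ℝ, ∀ p,
      b p * weight (fun l => exp (p.2 l))
        = operatorA T r σ Λ K (unpack hT ψ) p.1 (fun l => exp (p.2 l)) i := by
    intro ψ i
    have had := isAdmissible_unpack hT ψ
    have hcont : Continuous fun p : Icc (0 : ℝ) T × (Fin d → ℝ) =>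
        operatorA T r σ Λ K (unpack hT ψ) p.1 (fun l => exp (p.2 l)) i
          / weight (fun l => exp (p.2 l)) := by
      refine Continuous.div ?_ (continuous_weight.comp (by fun_prop)) fun p => (weight_pos _).ne'
      exact (continuousOn_operatorA hT hr hσ hK (norm_nonneg ψ) hCK hKb had i).comp_continuous
        (f := fun p : Icc (0 : ℝ) T × (Fin d → ℝ) => ((p.1 : ℝ), fun l => exp (p.2 l)))
        (by fun_prop) fun p => ⟨p.1.2, exp_mem_orthant _⟩
    refine ⟨BoundedContinuousFunction.ofNormedAddCommGroup _ hcont (CK + ‖ψ‖) fun p => ?_,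
      fun p => div_mul_cancel₀ _ (weight_pos _).ne'⟩
    rw [norm_div, norm_eq_abs, norm_of_nonneg (weight_pos _).le, div_le_iff₀ (weight_pos _)]
    exact abs_operatorA_le hr hσ hΛ hK (norm_nonneg ψ) hCK hKb had p.1.2 (exp_mem_orthant _) i
  choose F hF using hexists
  have hF' : ∀ (ψ : W) t (ht : t ∈ Icc 0 T) (s) (_ : s ∈ orthant d) i,
      F ψ i (⟨t, ht⟩, fun l => log (s l)) * weight s = operatorA T r σ Λ K (unpack hT ψ) t s i := by
    intro ψ t ht s hs i
    have h1 := hF ψ i (⟨t, ht⟩, fun l => log (s l))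
    have h2 : (fun l => exp (log (s l))) = s := funext fun l => exp_log (hs l)
    simpa only [h2] using h1
  have hq0 := contractionFactor_nonneg hT Λ
  have hcontr : ContractingWith ⟨contractionFactor T Λ, hq0⟩ F := by
    refine ⟨by exact_mod_cast contractionFactor_lt_one T Λ, LipschitzWith.of_dist_le_mul fun ψ χ => ?_⟩
    change dist (F ψ) (F χ) ≤ contractionFactor T Λ * dist ψ χ
    have hD : 0 ≤ contractionFactor T Λ * dist ψ χ := by positivity
    refine (dist_pi_le_iff hD).2 fun i => (BoundedContinuousFunction.dist_le hD).2 fun p => ?_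
    have h1 := abs_operatorA_sub_le hr hσ hΛ hK (isAdmissible_unpack hT ψ).memV
      (isAdmissible_unpack hT χ).memV (dist_nonneg (x := ψ) (y := χ)) (fun u _ x _ j => ?_)
      p.1.2 (exp_mem_orthant p.2) i
    · rw [← hF, ← hF, ← sub_mul, abs_mul, abs_of_pos (weight_pos _), mul_right_comm] at h1
      rw [Real.dist_eq]
      refine (le_of_mul_le_mul_right h1 (weight_pos _)).trans ?_
      rw [mul_comm]
      exact mul_le_mul_of_nonneg_right (one_sub_exp_le_contractionFactor hT Λ i) dist_nonneg
    · rw [unpack, unpack, ← sub_mul, abs_mul, abs_of_pos (weight_pos x), ← Real.dist_eq]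
      exact mul_le_mul_of_nonneg_right
        ((BoundedContinuousFunction.dist_coe_le_dist _).trans (dist_le_pi_dist ψ χ j))
        (weight_pos x).le
  -- This set contains 0 and is closed and invariant under `F`; hence it contains the limit of the
  -- Picard iterates from 0.
  let S : Set W := {ψ | (∀ u, ∀ x ∈ orthant d, ∀ j, 0 ≤ unpack hT ψ u x j) ∧
    ∀ u, ∀ x ∈ orthant d, ∀ x' ∈ orthant d, ∀ j,
      |unpack hT ψ u x j - unpack hT ψ u x' j| ≤ L * ∑ l, |x l - x' l|}
  have hSclosed : IsClosed S := by
    have hev : ∀ u x j, Continuous fun ψ : W => unpack hT ψ u x j := fun u x j =>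
      ((continuous_eval_const _).comp (continuous_apply j)).mul
        continuous_const
    have hS : S = (⋂ u, ⋂ x ∈ orthant d, ⋂ j, {ψ : W | 0 ≤ unpack hT ψ u x j}) ∩
        ⋂ u, ⋂ x ∈ orthant d, ⋂ x' ∈ orthant d, ⋂ j,
          {ψ : W | |unpack hT ψ u x j - unpack hT ψ u x' j| ≤ L * ∑ l, |x l - x' l|} := by
      ext ψ; simp [S]
    rw [hS]
    refine IsClosed.inter ?_ ?_
    · exact isClosed_iInter fun u => isClosed_biInter fun x _ => isClosed_iInter fun j =>
        isClosed_le continuous_const (hev u x j)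
    · exact isClosed_iInter fun u => isClosed_biInter fun x _ => isClosed_biInter fun x' _ =>
        isClosed_iInter fun j => isClosed_le ((hev u x j).sub (hev u x' j)).abs continuous_const
  have hFu : ∀ ψ u, ∀ x ∈ orthant d, ∀ j, unpack hT (F ψ) u x j
      = operatorA T r σ Λ K (unpack hT ψ) (projIcc 0 T hT u) x j := fun ψ u x hx j =>
    hF' ψ _ (projIcc 0 T hT u).2 x hx j
  have hmaps : ∀ ψ ∈ S, F ψ ∈ S := by
    rintro ψ ⟨h1, h2⟩
    refine ⟨fun u x hx j => ?_, fun u x hx x' hx' j => ?_⟩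
    · rw [hFu ψ u x hx]
      exact operatorA_nonneg hσ hΛ hK hK0 h1 (projIcc 0 T hT u).2 hx j
    · rw [hFu ψ u x hx, hFu ψ u x' hx']
      exact abs_operatorA_sub_le_of_lipschitz hr hσ hΛ hK hKb hKL'
        (isAdmissible_unpack hT ψ).memV h2 (projIcc 0 T hT u).2 hx hx' j
  have hzero : (0 : W) ∈ S := by
    have hz : ∀ u x j, unpack hT (0 : W) u x j = 0 := fun u x j => zero_mul (weight x)
    refine ⟨fun u x _ j => (hz u x j).ge, fun u x _ x' _ j => ?_⟩
    have : (0 : ℝ) ≤ L * ∑ l, |x l - x' l| :=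
      mul_nonneg L.2 (Finset.sum_nonneg fun _ _ => abs_nonneg _)
    simpa [hz] using this
  have hiter : ∀ n, F^[n] 0 ∈ S := fun n => by
    induction n with
    | zero => exact hzero
    | succ n ih => rw [Function.iterate_succ_apply']; exact hmaps _ ih
  have hmem := hSclosed.mem_of_tendsto (hcontr.tendsto_iterate_fixedPoint 0)
    (Eventually.of_forall hiter)
  have hfix := hcontr.fixedPoint_isFixedPt
  set ψ := ContractingWith.fixedPoint F hcontr
  refine ⟨unpack hT ψ, ⟨‖ψ‖, norm_nonneg _, isAdmissible_unpack hT ψ⟩, hmem.1, hmem.2,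
    (isAdmissible_unpack hT ψ).memV, fun t ht s hs i => ?_⟩
  rw [← hF' ψ t ht s hs i, hfix.eq, unpack, projIcc_of_mem hT ht]

end

end RegimeSwitching

end

/-! ### Return to the price variables -/

noncomputable section

namespace RegimeSwitching

open Real Set Filter Topology

variable {d k : ℕ}

section ChainRule

variable {ρ T c : ℝ} {σ : Matrix (Fin d) (Fin d) ℝ} {f Z : ℝ → (Fin d → ℝ) → ℝ}
  {Z₁ : Fin d → ℝ → (Fin d → ℝ) → ℝ} {Z₂ : Fin d → Fin d → ℝ → (Fin d → ℝ) → ℝ}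
  {u : ℝ → (Fin d → ℝ) → ℝ}

/-- The total time derivative of a solution of the heat equation along the drift. -/
lemma SolvesHeat.hasDerivAt_comp_toLog (hZ : SolvesHeat T f Z Z₁ Z₂)
    (hf : Continuous (Function.uncurry f)) {t : ℝ} (ht : t < T) (s : Fin d → ℝ) :
    HasDerivAt (fun τ => Z τ (toLog ρ σ τ s))
      (-f t (toLog ρ σ t s) - 1 / 2 * ∑ m, Z₂ m m t (toLog ρ σ t s)
        - ∑ m, Z₁ m t (toLog ρ σ t s) * logDrift ρ σ m) t := by
  set y := toLog ρ σ t s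
  have hnhds : Iio T ×ˢ (univ : Set (Fin d → ℝ)) ∈ 𝓝 (t, y) :=
    (isOpen_Iio.prod isOpen_univ).mem_nhds ⟨ht, mem_univ _⟩
  have hc1 : ContinuousAt (fun p : ℝ × (Fin d → ℝ) =>
      -f p.1 p.2 - 1 / 2 * ∑ m, Z₂ m m p.1 p.2) (t, y) :=
    hf.neg.continuousAt.sub (continuousAt_const.mul (tendsto_finsetSum _ fun m _ =>
      (hZ.cont_yy m m).continuousAt hnhds))
  have hc2 : ContinuousAt (fun p : ℝ × (Fin d → ℝ) => grad fun m => Z₁ m p.1 p.2) (t, y) :=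
    continuous_grad.continuousAt.comp (f := fun p : ℝ × (Fin d → ℝ) => fun m => Z₁ m p.1 p.2)
      (continuousAt_pi.2 fun m => (hZ.cont_y m).continuousAt hnhds)
  -- The path moves in time and space at once, while derivatives are known in each variable
  -- separately; their joint continuity gives total differentiability.
  have key := hasStrictFDerivAt_uncurry_coprod (𝕜 := ℝ) (u := (t, y)) (f := Z)
    (f₁ := fun t y => ContinuousLinearMap.toSpanSingleton ℝ
      (-f t y - 1 / 2 * ∑ m, Z₂ m m t y))
    (f₂ := fun t y => grad fun m => Z₁ m t y)
    (by filter_upwards [hnhds] with p hp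
        exact (hZ.deriv_t p.1 hp.1 p.2).hasFDerivAt)
    (by filter_upwards [hnhds] with p hp
        exact hZ.deriv_y p.1 hp.1 p.2)
    ((ContinuousLinearMap.toSpanSingletonCLE (𝕜 := ℝ) (E := ℝ)).continuous.continuousAt.comp hc1)
    hc2
  have hpath : HasDerivAt (fun τ => (τ, toLog ρ σ τ s)) (1, -logDrift ρ σ) t := by
    refine (hasDerivAt_id t).prodMk ?_
    have := ((hasDerivAt_id t).smul_const (logDrift ρ σ)).const_sub
      (σ⁻¹.mulVec fun l => log (s l))
    exact this.congr_deriv (by simp)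
  refine (key.hasFDerivAt.comp_hasDerivAt t hpath).congr_deriv ?_
  simp [Function.HasUncurry.uncurry, Finset.sum_neg_distrib, sub_eq_add_neg]

lemma hasDerivAt_update (s : Fin d → ℝ) (l l' : Fin d) (x : ℝ) :
    HasDerivAt (fun y => Function.update s l y l') ((1 : Matrix (Fin d) (Fin d) ℝ) l l') x := by
  rcases eq_or_ne l l' with rfl | h
  · simpa using hasDerivAt_id' x
  · simpa [Function.update_of_ne h.symm, Matrix.one_apply_ne h] using hasDerivAt_const x (s l')

lemma hasDerivAt_toLog_update (t : ℝ) {s : Fin d → ℝ} (hs : s ∈ orthant d) (l : Fin d) :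
    HasDerivAt (fun y => toLog ρ σ t (Function.update s l y)) (fun m => σ⁻¹ m l / s l) (s l) := by
  rw [hasDerivAt_pi]
  intro m
  have h : ∀ l', HasDerivAt (fun y => σ⁻¹ m l' * log (Function.update s l y l'))
      (σ⁻¹ m l' * ((1 : Matrix (Fin d) (Fin d) ℝ) l l' / s l')) (s l) := fun l' => by
    have := ((hasDerivAt_update s l l' (s l)).log
      (by rw [Function.update_eq_self]; exact (hs l').ne')).const_mul (σ⁻¹ m l')
    rwa [Function.update_eq_self] at this
  refine ((HasDerivAt.fun_sum fun l' (_ : l' ∈ Finset.univ) => h l').sub_const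
    (t * logDrift ρ σ m)).congr_deriv ?_
  rw [Finset.sum_eq_single l (fun l' _ hl' => by simp [Matrix.one_apply_ne hl'.symm]) (by simp)]
  simp [div_eq_mul_inv]

lemma hasDerivAt_comp_toLog_update {G : (Fin d → ℝ) → ℝ} {g : Fin d → ℝ} (t : ℝ)
    {s : Fin d → ℝ} (hs : s ∈ orthant d) (hG : HasFDerivAt G (grad g) (toLog ρ σ t s))
    (l : Fin d) :
    HasDerivAt (fun y => G (toLog ρ σ t (Function.update s l y)))
      (∑ m, g m * (σ⁻¹ m l / s l)) (s l) := by
  have h := hasDerivAt_toLog_update (ρ := ρ) (σ := σ) t hs l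
  have hG' : HasFDerivAt G (grad g) (toLog ρ σ t (Function.update s l (s l))) := by
    rwa [Function.update_eq_self]
  simpa [Function.comp_def] using hG'.comp_hasDerivAt (s l) h

lemma update_mem_orthant {s : Fin d → ℝ} (hs : s ∈ orthant d) (l : Fin d) {y : ℝ} (hy : 0 < y) :
    Function.update s l y ∈ orthant d := fun l' => by
  rcases eq_or_ne l' l with rfl | h
  · simpa using hy
  · simpa [Function.update_of_ne h] using hs l'

/-- The function with Brownian-coordinate representation `Z` and growth rate `c`. -/
def IsRepresented (T ρ c : ℝ) (σ : Matrix (Fin d) (Fin d) ℝ) (Z u : ℝ → (Fin d → ℝ) → ℝ) : Prop :=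
  ∀ t ∈ Ioo 0 T, ∀ s ∈ orthant d, u t s = exp (c * t) * Z t (toLog ρ σ t s)

lemma IsRepresented.hasDerivAt_time (hu : IsRepresented T ρ c σ Z u)
    (hZ : SolvesHeat T f Z Z₁ Z₂)
    (hf : Continuous (Function.uncurry f)) {t : ℝ}
    (ht : t ∈ Ioo 0 T) {s : Fin d → ℝ} (hs : s ∈ orthant d) :
    HasDerivAt (fun τ => u τ s) (exp (c * t) * (c * Z t (toLog ρ σ t s)
      + (-f t (toLog ρ σ t s) - 1 / 2 * ∑ m, Z₂ m m t (toLog ρ σ t s)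
        - ∑ m, Z₁ m t (toLog ρ σ t s) * logDrift ρ σ m))) t := by
  have h0 : HasDerivAt (fun τ => exp (c * τ)) (exp (c * t) * c) t := by
    have : HasDerivAt (fun τ => c * τ) c t := by simpa using (hasDerivAt_id t).const_mul c
    exact this.exp
  refine ((h0.mul (hZ.hasDerivAt_comp_toLog hf ht.2 s)).congr_deriv (by ring)).congr_of_eventuallyEq
    ?_
  filter_upwards [isOpen_Ioo.mem_nhds ht] with τ hτ
  exact hu τ hτ s hs

lemma IsRepresented.hasDerivAt_space (hu : IsRepresented T ρ c σ Z u)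
    (hZ : SolvesHeat T f Z Z₁ Z₂)
    {t : ℝ} (ht : t ∈ Ioo 0 T) {s : Fin d → ℝ}
    (hs : s ∈ orthant d) (l : Fin d) :
    HasDerivAt (fun y => u t (Function.update s l y))
      (exp (c * t) * ∑ m, Z₁ m t (toLog ρ σ t s) * (σ⁻¹ m l / s l)) (s l) := by
  refine ((hasDerivAt_comp_toLog_update t hs (hZ.deriv_y t ht.2 _) l).const_mul
    (exp (c * t))).congr_of_eventuallyEq ?_
  filter_upwards [lt_mem_nhds (hs l)] with y hy
  exact hu t ht _ (update_mem_orthant hs l hy)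

lemma IsRepresented.partialS_eq (hu : IsRepresented T ρ c σ Z u)
    (hZ : SolvesHeat T f Z Z₁ Z₂)
    {t : ℝ} (ht : t ∈ Ioo 0 T) {s : Fin d → ℝ}
    (hs : s ∈ orthant d) (l : Fin d) :
    partialS l u t s = exp (c * t) * ∑ m, Z₁ m t (toLog ρ σ t s) * (σ⁻¹ m l / s l) :=
  (hu.hasDerivAt_space hZ ht hs l).deriv

lemma IsRepresented.hasDerivAt_space_space (hu : IsRepresented T ρ c σ Z u)
    (hZ : SolvesHeat T f Z Z₁ Z₂)
    {t : ℝ} (ht : t ∈ Ioo 0 T) {s : Fin d → ℝ}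
    (hs : s ∈ orthant d) (l l' : Fin d) :
    HasDerivAt (fun y => partialS l' u t (Function.update s l y))
      (exp (c * t) * ∑ m, ((∑ n, Z₂ m n t (toLog ρ σ t s) * (σ⁻¹ n l / s l)) * (σ⁻¹ m l' / s l')
        + Z₁ m t (toLog ρ σ t s)
          * (σ⁻¹ m l' * (-(1 : Matrix (Fin d) (Fin d) ℝ) l l' / s l' ^ 2)))) (s l) := by
  have h : ∀ m, HasDerivAt (fun y => Z₁ m t (toLog ρ σ t (Function.update s l y))
      * (σ⁻¹ m l' / Function.update s l y l'))
      ((∑ n, Z₂ m n t (toLog ρ σ t s) * (σ⁻¹ n l / s l)) * (σ⁻¹ m l' / s l')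
        + Z₁ m t (toLog ρ σ t s)
          * (σ⁻¹ m l' * (-(1 : Matrix (Fin d) (Fin d) ℝ) l l' / s l' ^ 2))) (s l) := fun m => by
    have h1 := hasDerivAt_comp_toLog_update (ρ := ρ) (σ := σ) t hs (hZ.deriv_yy m t ht.2 _) l
    have h2 := ((hasDerivAt_update s l l' (s l)).fun_inv
      (by rw [Function.update_eq_self]; exact (hs l').ne')).const_mul (σ⁻¹ m l')
    have h3 := h1.fun_mul h2
    simp only [Function.update_eq_self] at h3
    simpa only [div_eq_mul_inv] using h3
  refine ((HasDerivAt.fun_sum fun m (_ : m ∈ Finset.univ) => h m).const_mul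
    (exp (c * t))).congr_of_eventuallyEq ?_
  filter_upwards [lt_mem_nhds (hs l)] with y hy
  exact hu.partialS_eq hZ ht (update_mem_orthant hs l hy) l'

lemma IsRepresented.partialSS_eq (hu : IsRepresented T ρ c σ Z u)
    (hZ : SolvesHeat T f Z Z₁ Z₂)
    {t : ℝ} (ht : t ∈ Ioo 0 T) {s : Fin d → ℝ}
    (hs : s ∈ orthant d) (l l' : Fin d) :
    partialS l (partialS l' u) t s
      = exp (c * t) * ∑ m, ((∑ n, Z₂ m n t (toLog ρ σ t s) * (σ⁻¹ n l / s l)) * (σ⁻¹ m l' / s l')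
        + Z₁ m t (toLog ρ σ t s)
          * (σ⁻¹ m l' * (-(1 : Matrix (Fin d) (Fin d) ℝ) l l' / s l' ^ 2))) :=
  (hu.hasDerivAt_space_space hZ ht hs l l').deriv

lemma IsRepresented.isC12 (hu : IsRepresented T ρ c σ Z u)
    (hZ : SolvesHeat T f Z Z₁ Z₂)
    (hf : Continuous (Function.uncurry f)) : IsC12 T u := by
  have hlog : ContinuousOn (fun p : ℝ × (Fin d → ℝ) => (p.1, toLog ρ σ p.1 p.2))
      (Ioo 0 T ×ˢ orthant d) :=
    continuousOn_fst.prodMk ((continuousOn_toLog _ _).mono (prod_mono (subset_univ _) le_rfl))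
  have hmaps : MapsTo (fun p : ℝ × (Fin d → ℝ) => (p.1, toLog ρ σ p.1 p.2))
      (Ioo 0 T ×ˢ orthant d) (Iio T ×ˢ univ) := fun p hp => ⟨hp.1.2, mem_univ _⟩
  have hexp : ContinuousOn (fun p : ℝ × (Fin d → ℝ) => exp (c * p.1)) (Ioo 0 T ×ˢ orthant d) := by
    fun_prop
  have c0 : ContinuousOn (fun p : ℝ × (Fin d → ℝ) => Z p.1 (toLog ρ σ p.1 p.2))
      (Ioo 0 T ×ˢ orthant d) := hZ.cont.comp_continuousOn hlog
  have cf : ContinuousOn (fun p : ℝ × (Fin d → ℝ) => f p.1 (toLog ρ σ p.1 p.2))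
      (Ioo 0 T ×ˢ orthant d) := hf.comp_continuousOn hlog
  have c1 : ∀ m, ContinuousOn (fun p : ℝ × (Fin d → ℝ) => Z₁ m p.1 (toLog ρ σ p.1 p.2))
      (Ioo 0 T ×ˢ orthant d) := fun m => (hZ.cont_y m).comp hlog hmaps
  have c2 : ∀ m n, ContinuousOn (fun p : ℝ × (Fin d → ℝ) => Z₂ m n p.1 (toLog ρ σ p.1 p.2))
      (Ioo 0 T ×ˢ orthant d) := fun m n => (hZ.cont_yy m n).comp hlog hmaps
  have cdiv : ∀ (a : ℝ) l, ContinuousOn (fun p : ℝ × (Fin d → ℝ) => a / p.2 l)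
      (Ioo 0 T ×ˢ orthant d) := fun a l =>
    continuousOn_const.div (by fun_prop) fun p hp => (hp.2 l).ne'
  refine ⟨fun t ht s hs => (hu.hasDerivAt_time hZ hf ht hs).differentiableAt,
    fun t ht s hs l => (hu.hasDerivAt_space hZ ht hs l).differentiableAt,
    fun t ht s hs l l' => (hu.hasDerivAt_space_space hZ ht hs l l').differentiableAt,
    ?_, ?_, fun l => ?_, fun l l' => ?_⟩
  · refine (hexp.mul c0).congr ?_
    rintro ⟨t, s⟩ ⟨ht, hs⟩
    exact hu t ht s hs
  · have ct : ContinuousOn (fun p : ℝ × (Fin d → ℝ) => exp (c * p.1)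
        * (c * Z p.1 (toLog ρ σ p.1 p.2) + (-f p.1 (toLog ρ σ p.1 p.2)
          - 1 / 2 * ∑ m, Z₂ m m p.1 (toLog ρ σ p.1 p.2)
          - ∑ m, Z₁ m p.1 (toLog ρ σ p.1 p.2) * logDrift ρ σ m))) (Ioo 0 T ×ˢ orthant d) :=
      hexp.mul ((continuousOn_const.mul c0).add ((cf.neg.sub (continuousOn_const.mul
        (continuousOn_finsetSum _ fun m _ => c2 m m))).sub
        (continuousOn_finsetSum _ fun m _ => (c1 m).mul continuousOn_const)))
    refine ct.congr ?_
    rintro ⟨t, s⟩ ⟨ht, hs⟩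
    exact (hu.hasDerivAt_time hZ hf ht hs).deriv
  · refine (hexp.mul (continuousOn_finsetSum Finset.univ fun m _ =>
      (c1 m).mul (cdiv (σ⁻¹ m l) l))).congr ?_
    rintro ⟨t, s⟩ ⟨ht, hs⟩
    exact hu.partialS_eq hZ ht hs l
  · have cdiv2 : ContinuousOn (fun p : ℝ × (Fin d → ℝ) =>
        -(1 : Matrix (Fin d) (Fin d) ℝ) l l' / p.2 l' ^ 2) (Ioo 0 T ×ˢ orthant d) :=
      continuousOn_const.div (by fun_prop) fun p hp => pow_ne_zero _ (hp.2 l').ne'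
    refine (hexp.mul (continuousOn_finsetSum Finset.univ fun m _ =>
      ((continuousOn_finsetSum Finset.univ fun n _ => (c2 m n).mul (cdiv (σ⁻¹ n l) l)).mul
        (cdiv (σ⁻¹ m l') l')).add ((c1 m).mul ((continuousOn_const (c := σ⁻¹ m l')).mul cdiv2)))).congr ?_
    rintro ⟨t, s⟩ ⟨ht, hs⟩
    exact hu.partialSS_eq hZ ht hs l l'

/-- The second-order part of the generator in Brownian coordinates. -/
lemma sum_diffusion_mul (hσ : IsUnit σ) (H : Fin d → Fin d → ℝ) (p s : Fin d → ℝ)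
    (hs : s ∈ orthant d) :
    ∑ l, ∑ l', diffusion σ l l' * s l * s l'
        * ∑ m, ((∑ n, H m n * (σ⁻¹ n l / s l)) * (σ⁻¹ m l' / s l')
          + p m * (σ⁻¹ m l' * (-(1 : Matrix (Fin d) (Fin d) ℝ) l l' / s l' ^ 2)))
      = ∑ m, H m m - ∑ m, p m * ∑ l, σ⁻¹ m l * diffusion σ l l := by
  have hdet := (Matrix.isUnit_iff_isUnit_det σ).1 hσ
  -- This identity turns the second-order term into the Laplacian. The δ term, from differentiating
  -- 1/s, leaves the contribution of the diagonal of `diffusion σ`.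
  have hone : σ⁻¹ * diffusion σ * σ⁻¹.transpose = 1 := by
    rw [diffusion, ← Matrix.mul_assoc, Matrix.nonsing_inv_mul _ hdet, Matrix.one_mul,
      ← Matrix.transpose_mul, Matrix.nonsing_inv_mul _ hdet, Matrix.transpose_one]
  have hterm : ∀ l l', diffusion σ l l' * s l * s l'
      * ∑ m, ((∑ n, H m n * (σ⁻¹ n l / s l)) * (σ⁻¹ m l' / s l')
          + p m * (σ⁻¹ m l' * (-(1 : Matrix (Fin d) (Fin d) ℝ) l l' / s l' ^ 2)))
      = ∑ m, ∑ n, H m n * (σ⁻¹ n l * diffusion σ l l' * σ⁻¹ m l')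
        - ∑ m, p m * (σ⁻¹ m l' * diffusion σ l l' * (1 : Matrix (Fin d) (Fin d) ℝ) l l') := by
    intro l l'
    rw [Finset.mul_sum, ← Finset.sum_sub_distrib]
    refine Finset.sum_congr rfl fun m _ => ?_
    have h1 := (hs l).ne'
    have h2 := (hs l').ne'
    rw [mul_add, sub_eq_add_neg]
    congr 1
    · rw [Finset.sum_mul, Finset.mul_sum]
      refine Finset.sum_congr rfl fun n _ => ?_
      field_simp
    · rcases eq_or_ne l l' with rfl | h
      · rw [Matrix.one_apply_eq]; field_simp
      · rw [Matrix.one_apply_ne h]; simp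
  simp_rw [hterm, Finset.sum_sub_distrib]
  congr 1
  · have h1 : ∀ m, H m m = ∑ n, H m n * (σ⁻¹ * diffusion σ * σ⁻¹.transpose) n m := fun m => by
      rw [hone]; simp [Matrix.one_apply]
    simp_rw [h1, Matrix.mul_apply, Matrix.transpose_apply, Finset.sum_mul, Finset.mul_sum]
    calc _ = ∑ l, ∑ m, ∑ l', ∑ n, H m n * (σ⁻¹ n l * diffusion σ l l' * σ⁻¹ m l') :=
          Finset.sum_congr rfl fun l _ => Finset.sum_comm
      _ = ∑ m, ∑ l, ∑ l', ∑ n, H m n * (σ⁻¹ n l * diffusion σ l l' * σ⁻¹ m l') := Finset.sum_comm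
      _ = _ := by
          refine Finset.sum_congr rfl fun m _ => ?_
          calc _ = ∑ l, ∑ n, ∑ l', H m n * (σ⁻¹ n l * diffusion σ l l' * σ⁻¹ m l') :=
                Finset.sum_congr rfl fun l _ => Finset.sum_comm
            _ = ∑ n, ∑ l, ∑ l', H m n * (σ⁻¹ n l * diffusion σ l l' * σ⁻¹ m l') :=
                Finset.sum_comm
            _ = _ := Finset.sum_congr rfl fun n _ => Finset.sum_comm
  · have h1 : ∀ l, ∑ l', ∑ m, p m * (σ⁻¹ m l' * diffusion σ l l'
        * (1 : Matrix (Fin d) (Fin d) ℝ) l l') = ∑ m, p m * (σ⁻¹ m l * diffusion σ l l) := fun l => by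
      rw [Finset.sum_eq_single l (fun l' _ h => by simp [Matrix.one_apply_ne h.symm]) (by simp)]
      simp
    simp_rw [h1, Finset.mul_sum]
    exact Finset.sum_comm

/-- The Black–Scholes equation with source in the original coordinates. -/
lemma IsRepresented.pde (hu : IsRepresented T ρ c σ Z u)
    (hZ : SolvesHeat T f Z Z₁ Z₂)
    (hσ : IsUnit σ) (hf : Continuous (Function.uncurry f)) {t : ℝ}
    (ht : t ∈ Ioo 0 T) {s : Fin d → ℝ} (hs : s ∈ orthant d) :
    partialT u t s + (ρ * ∑ l, s l * partialS l u t s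
      + 1 / 2 * ∑ l, ∑ l', diffusion σ l l' * s l * s l' * partialS l (partialS l' u) t s)
      = c * u t s - exp (c * t) * f t (toLog ρ σ t s) := by
  have e1 : ∑ l, s l * partialS l u t s
      = exp (c * t) * ∑ m, Z₁ m t (toLog ρ σ t s) * ∑ l, σ⁻¹ m l := by
    simp_rw [hu.partialS_eq hZ ht hs, Finset.mul_sum]
    rw [Finset.sum_comm]
    refine Finset.sum_congr rfl fun m _ => Finset.sum_congr rfl fun l _ => ?_
    have := (hs l).ne'
    field_simp
  have e2 : ∑ l, ∑ l', diffusion σ l l' * s l * s l' * partialS l (partialS l' u) t s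
      = exp (c * t) * (∑ m, Z₂ m m t (toLog ρ σ t s)
        - ∑ m, Z₁ m t (toLog ρ σ t s) * ∑ l, σ⁻¹ m l * diffusion σ l l) := by
    rw [← sum_diffusion_mul hσ (fun m n => Z₂ m n t (toLog ρ σ t s))
      (fun m => Z₁ m t (toLog ρ σ t s)) s hs, Finset.mul_sum]
    refine Finset.sum_congr rfl fun l _ => ?_
    rw [Finset.mul_sum]
    refine Finset.sum_congr rfl fun l' _ => ?_
    rw [hu.partialSS_eq hZ ht hs, mul_left_comm]
  -- The drift of the coordinates was chosen so that the first-order terms of the time derivative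
  -- cancel those of `e1` and `e2`.
  have e3 : ∑ m, Z₁ m t (toLog ρ σ t s) * logDrift ρ σ m
      = ρ * ∑ m, Z₁ m t (toLog ρ σ t s) * ∑ l, σ⁻¹ m l
        - 1 / 2 * ∑ m, Z₁ m t (toLog ρ σ t s) * ∑ l, σ⁻¹ m l * diffusion σ l l := by
    rw [Finset.mul_sum, Finset.mul_sum, ← Finset.sum_sub_distrib]
    refine Finset.sum_congr rfl fun m _ => ?_
    have : logDrift ρ σ m = ρ * ∑ l, σ⁻¹ m l - 1 / 2 * ∑ l, σ⁻¹ m l * diffusion σ l l := by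
      change ∑ l, σ⁻¹ m l * (ρ - diffusion σ l l / 2) = _
      rw [Finset.mul_sum, Finset.mul_sum, ← Finset.sum_sub_distrib]
      exact Finset.sum_congr rfl fun l _ => by ring
    rw [this]; ring
  have e4 : partialT u t s = _ := (hu.hasDerivAt_time hZ hf ht hs).deriv
  rw [e4, e1, e2, e3, hu t ht s hs]
  ring

end ChainRule

section Main

variable {T : ℝ} {r : Fin k → ℝ} {σ : Fin k → Matrix (Fin d) (Fin d) ℝ}
  {Λ : Matrix (Fin k) (Fin k) ℝ} {K : (Fin d → ℝ) → ℝ} {φ : ℝ → (Fin d → ℝ) → Fin k → ℝ}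

/-- A solution of the integral equation is a classical solution, is non-negative and has linear
growth. -/
lemma SolvesIE.isClassicalSolution (hT : 0 ≤ T) (hr : ∀ i, 0 ≤ r i) (hσ : ∀ i, IsUnit (σ i))
    (hΛ : IsRateMatrix Λ) (hK0 : ∀ x ∈ orthant d, 0 ≤ K x) {L : NNReal}
    (hKL : LipschitzOnWith L K (orthant d)) (hφ : SolvesIE T r σ Λ K φ) :
    IsClassicalSolution T r σ Λ K φ ∧
      (∀ t ∈ Icc 0 T, ∀ s ∈ orthant d, ∀ i, 0 ≤ φ t s i) ∧ LinearGrowth (Icc 0 T) φ := by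
  have hK := hKL.continuousOn
  obtain ⟨CK, hCK, hKb⟩ := exists_abs_le_weight L.2 (sum_abs_sub_le_of_lipschitz hKL)
  obtain ⟨ψ, ⟨C, hC, hψa⟩, hψ0, hψL, hψ⟩ := exists_solution hT hr hσ hΛ hK0 hKL
  -- Uniqueness transfers sign, growth, Lipschitz bound and continuity at the end points from the
  -- constructed solution to `φ`.
  have heq := hφ.eq_of_solvesIE hT hr hσ hΛ hK hψ
  have had : IsAdmissible T C φ := by
    refine ⟨fun j => (hψa.cont j).congr ?_, fun u hu x hx j => ?_⟩
    · rintro ⟨t, s⟩ ⟨ht, hs⟩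
      exact heq t ht s hs j
    · rw [heq u hu x hx j]; exact hψa.bound u hu x hx j
  have hlip : ∀ u ∈ Icc 0 T, ∀ x ∈ orthant d, ∀ x' ∈ orthant d, ∀ j,
      |φ u x j - φ u x' j| ≤ L * ∑ l, |x l - x' l| := fun u hu x hx x' hx' j => by
    rw [heq u hu x hx j, heq u hu x' hx' j]; exact hψL u x hx x' hx' j
  have hheat : ∀ i, ∃ Z Z₁ Z₂, SolvesHeat T (source T r σ Λ φ i) Z Z₁ Z₂ ∧
      IsRepresented T (r i) (|Λ i i| + r i) (σ i) Z (fun t s => φ t s i) := fun i => by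
    obtain ⟨κ, B, -, hs⟩ := exists_isSource (σ := σ) (Λ := Λ) hT hr hC L.2 had i
    obtain ⟨κ', B', hκ', hk⟩ := exists_expGrowth_terminal (r := r) (σ := σ) (Λ := Λ) hT hCK hKb i
    have h1 := (solvesHeat_gaussAvg hκ' (continuous_terminal hK i) hk T).add
      ((hs hlip).solvesHeat_duhamel T)
    simp only [zero_add] at h1
    refine ⟨_, _, _, h1, fun t ht s hs => ?_⟩
    have ht' := Ioo_subset_Icc_self ht
    exact (hφ.2 t ht' s hs i).trans (operatorA_eq_heat hσ hK had ht' hs i)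
  refine ⟨⟨fun i => ?_, had.cont, fun t ht s hs i => ?_, fun s hs i => ?_⟩,
    fun t ht s hs i => ?_, C, fun t ht s hs i => had.bound t ht s hs i⟩
  · obtain ⟨Z, Z₁, Z₂, hZ, hu⟩ := hheat i
    exact hu.isC12 hZ (continuous_source hT had i)
  · obtain ⟨Z, Z₁, Z₂, hZ, hu⟩ := hheat i
    have h1 := hu.pde hZ (hσ i) (continuous_source hT had i) ht hs
    -- Undoing discount and coordinates recovers the off-diagonal coupling; the diagonal term comes
    -- from the |Λ_ii| in the growth rate, since Λ_ii = −|Λ_ii|.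
    have h2 : exp ((|Λ i i| + r i) * t) * source T r σ Λ φ i t (toLog (r i) (σ i) t s)
        = ∑ j ∈ Finset.univ.erase i, Λ i j * φ t s j := by
      rw [source, clamp_of_mem (Ioo_subset_Icc_self ht), ofLog_toLog (hσ i) hs, ← mul_assoc,
        ← exp_add]
      rw [show (|Λ i i| + r i) * t + -(|Λ i i| + r i) * t = 0 by ring, exp_zero, one_mul]
    rw [h2, abs_of_nonpos (hΛ.diag_nonpos i)] at h1
    rw [operatorL, ← Finset.add_sum_erase _ _ (Finset.mem_univ i)]
    linarith
  · rw [hφ.2 T ⟨hT, le_rfl⟩ s hs i, operatorA_eq hσ hK le_rfl hs]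
    have h0 : gbm (r i) (σ i) s 0 0 = s := by ext l; simp [gbm]
    simp [transition, h0]
  · rw [heq t ht s hs i]; exact hψ0 t s hs i

end Main

end RegimeSwitching

end

theorem theorem3p9 {d k : ℕ} (T : ℝ) (hT : 0 < T)
    (r : Fin k → ℝ) (hr : ∀ i, 0 ≤ r i)
    (σ : Fin k → Matrix (Fin d) (Fin d) ℝ) (hσ : ∀ i, IsUnit (σ i))
    (Λ : Matrix (Fin k) (Fin k) ℝ) (hΛ : RegimeSwitching.IsRateMatrix Λ)
    (K : (Fin d → ℝ) → ℝ) (hK_nonneg : ∀ s ∈ RegimeSwitching.orthant d, 0 ≤ K s)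
    (hK_lip : ∃ L : NNReal, LipschitzOnWith L K (RegimeSwitching.orthant d)) :
    -- each `η_i` is a classical solution of the (uncoupled) Black–Scholes–Merton problem
    RegimeSwitching.IsClassicalSolution T r σ 0 K
        (fun t s i => RegimeSwitching.eta T (r i) (σ i) K t s) ∧
    -- the integral equation has a solution in `V`, and only one
    (∃ φ, RegimeSwitching.SolvesIE T r σ Λ K φ) ∧
    (∀ φ ψ, RegimeSwitching.SolvesIE T r σ Λ K φ → RegimeSwitching.SolvesIE T r σ Λ K ψ →
      ∀ t ∈ Set.Icc 0 T, ∀ s ∈ RegimeSwitching.orthant d, ∀ i, φ t s i = ψ t s i) ∧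
    -- this solution solves the system of PDEs, is non-negative and has at most linear growth
    ∀ φ, RegimeSwitching.SolvesIE T r σ Λ K φ →
      RegimeSwitching.IsClassicalSolution T r σ Λ K φ ∧
      (∀ t ∈ Set.Icc 0 T, ∀ s ∈ RegimeSwitching.orthant d, ∀ i, 0 ≤ φ t s i) ∧
      RegimeSwitching.LinearGrowth (Set.Icc 0 T) φ := by
  obtain ⟨L, hL⟩ := hK_lip
  have hzero : RegimeSwitching.IsRateMatrix (0 : Matrix (Fin k) (Fin k) ℝ) :=
    ⟨fun _ _ _ => le_rfl, fun _ => by simp⟩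
  refine ⟨?_, ?_, fun φ ψ hφ hψ => hφ.eq_of_solvesIE hT.le hr hσ hΛ hL.continuousOn hψ,
    fun φ hφ => hφ.isClassicalSolution hT.le hr hσ hΛ hK_nonneg hL⟩
  · obtain ⟨ψ, ⟨C, -, hψa⟩, -, -, hψ⟩ :=
      RegimeSwitching.exists_solution hT.le hr hσ hzero hK_nonneg hL
    -- For Λ = 0 the operator does not depend on `φ`, so η solves the integral equation with zero
    -- rates and the first claim is a case of the general result.
    have heta : ∀ φ t s i, RegimeSwitching.operatorA T r σ 0 K φ t s i
        = RegimeSwitching.eta T (r i) (σ i) K t s := fun φ t s i => by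
      simp [RegimeSwitching.operatorA]
    have heq : ∀ t ∈ Set.Icc 0 T, ∀ s ∈ RegimeSwitching.orthant d, ∀ i,
        RegimeSwitching.eta T (r i) (σ i) K t s = ψ t s i := fun t ht s hs i => by
      rw [hψ.2 t ht s hs i, heta]
    have had : RegimeSwitching.IsAdmissible T C
        (fun t s (i : Fin k) => RegimeSwitching.eta T (r i) (σ i) K t s) :=
      ⟨fun j => (hψa.cont j).congr fun p hp => heq p.1 hp.1 p.2 hp.2 j,
        fun u hu x hx j => by rw [heq u hu x hx j]; exact hψa.bound u hu x hx j⟩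
    have hsol : RegimeSwitching.SolvesIE T r σ 0 K
        (fun t s i => RegimeSwitching.eta T (r i) (σ i) K t s) :=
      ⟨had.memV, fun t _ s _ i => (heta _ t s i).symm⟩
    exact (hsol.isClassicalSolution hT.le hr hσ hzero hK_nonneg hL).1
  · obtain ⟨ψ, -, -, -, hψ⟩ := RegimeSwitching.exists_solution hT.le hr hσ hΛ hK_nonneg hL
    exact ⟨ψ, hψ⟩
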